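/- **Conventions.** Let $s\le r\le\omega$ with $r\ge 1$. A map $g(x,y)$ on an open subset of $\mathbb R^k\times\mathbb R^l$ is of class $C^{r,s}$ if it is jointly of class $C^s$, of class $C^r$ in $x$, and all its partial derivatives of order $a$ in $x$ and $b$ in $y$ with $a+b\le r$, $b\le s$ exist and are continuous. A foliated manifold $W$ (Hausdorff, second countable, with $k$-dimensional leaves, transverse dimension $l$, class $C^{r,s}$) has an atlas of charts into $\mathbb R^k\times\mathbb R^l$ whose changes of charts have the form $(x,y)\mapsto(X(x,y),Y(y))$ with $X$ of class $C^{r,s}$ and $Y$ of class $C^s$. A flow-box of $W$ is a chart whose changes of charts with the atlas (in both directions) are locally of this form. A $k$-solenoid is a compact space $S$ embedded as a union of leaves in such a $W$ (only the germ of $W$ along $S$ matters). A flow-box of $S$ is the restriction $\varphi:U\to D^k\times K$, $U=\hat U\cap S$, of a flow-box $(\hat U,\hat\varphi)$ of $W$ that maps $U$ onto $D^k\times K$, where $D^k$ is the open unit ball and $K\subset\mathbb R^l$; the sets $T=\varphi^{-1}(\{0\}\times K)\neq\emptyset$ are the local transversals of $S$. An orientation of $S$ is a continuous orientation of its leaves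 (for $k=0$: a continuous function $S\to\{\pm1\}$). A transversal measure on $S$ is a family $\mu=(\mu_T)$ of locally finite Borel measures supported on the local transversals $T$ and invariant under holonomy; it may be identically zero here, and is called non-trivial if some $\mu_T\ne0$. Its support is the set of points $p$ such that $\mu_T\neq 0$ for all local transversals $T\ni p$. Let $M$ be a (Hausdorff, second countable) $C^\infty$ manifold of dimension $n$ (analytic if $r=\omega$). An immersed solenoid is a map $f:S\to M$ that extends to a map of class $C^{r,s}$ on a neighbourhood of $S$ in $W$ and whose differential along the leaves is injective at each point of $S$. **Proposition.** Let $f_1:S_1\to M$ and $f_2:S_2\to M$ be immersed solenoids of class $C^{r,s}$, of dimensions $k_1,k_2$ and transverse dimensions $l_1,l_2$, that intersect transversally: if $f_1(p_1)=f_2(p_2)=x$ then $df_1(T_{p_1}L_1)+df_2(T_{p_2}L_2)=T_xM$, where $L_i$ is the leaf through $p_i$. Let $$S=\{(p_1,p_2)\in S_1\times S_2:\ f_1(p_1)=f_2(p_2)\},\qquad f(p_1,p_2)=f_1(p_1)=f_2(p_2),$$ and assume $S\neq\emptyset$. Then $k:=k_1+k_2-n\ge 0$, and $S$ (with the subspace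 topology) has the structure of a $k$-solenoid of class $C^{r,s}$ and transverse dimension $l_1+l_2$ such that $f:S\to M$ is an immersed solenoid and the structure is induced by $S_1$ and $S_2$: for all flow-boxes $U_1\ni p_1$ of $S_1$ and $U_2\ni p_2$ of $S_2$, with transverse coordinates $y$ and $z$, where $(p_1,p_2)\in S$, there is a flow-box $U\subset U_1\times U_2$ of $S$ around $(p_1,p_2)$ with transverse coordinate $(y,z)$. Moreover: 1. If $M$ is oriented and $S_1$, $S_2$ are oriented, then $S$ has an induced orientation: if a basis $e$ of the tangent space of the leaf of $S$ at a point is completed to bases $(e,a)$ and $(e,b)$ of the tangent spaces of the leaves of $S_1$ and $S_2$ (seen in $TM$), then the sign of $e$ is the product of the signs of the bases $(e,a)$, $(e,b)$ and $(e,a,b)$ of the tangent spaces of the leaves of $S_1$, of $S_2$ and of $M$. (For $k=0$ it is the intersection index.) 2. If $\mu_1$, $\mu_2$ are transversal measures on $S_1$, $S_2$, then $S$ has an induced transversal measure $\mu$, the product measure: let $U_1,U_2$ be flow-boxes of $S_1,S_2$ with local transversals $T_1$, $T_2$, let $T$ be a local transversal of $S$, and let $A\subset T\cap(U_1\times U_2)$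 be a Borel set on which the projection $\pi:U_1\times U_2\to T_1\times T_2$ along the plaques is injective; then $\mu_T(A)=(\mu_{1,T_1}\times\mu_{2,T_2})(\pi(A))$. The measure $\mu$ is non-trivial if and only if $S$ meets $\operatorname{supp}\mu_1\times\operatorname{supp}\mu_2$. -/

import Mathlib

open Set Filter Topology MeasureTheory
open scoped ContDiff Manifold unitInterval

universe u v w

noncomputable section

/-- The model space `ℝ^d` with its Euclidean norm. -/
abbrev Eu (d : ℕ) : Type := EuclideanSpace ℝ (Fin d)

/-! ### Regularity of class `C^{r,s}` and foliated maps -/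

/-- `f (x, y)` is of class `C^{r,s}` on the open set `U`: it is jointly of class `C^s`, of class
`C^r` in the leaf variable `x`, and all partial derivatives of order `a` in `x` and order `b`
in `y` with `a + b ≤ r` and `b ≤ s` exist and are continuous in `(x, y)`
(the `m`-th `x`-derivative is jointly of class `C^j` whenever `m + j ≤ r` and `j ≤ s`).
For `r = ω` the function is analytic along the leaves; for `r = s = ω` it is analytic. -/
def IsClassCrs {E F G : Type*} [NormedAddCommGroup E] [NormedSpace ℝ E]
    [NormedAddCommGroup F] [NormedSpace ℝ F] [NormedAddCommGroup G] [NormedSpace ℝ G]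
    (r s : WithTop ℕ∞) (f : E × F → G) (U : Set (E × F)) : Prop :=
  ContDiffOn ℝ s f U ∧
  (∀ z ∈ U, ContDiffAt ℝ r (fun x => f (x, z.2)) z.1) ∧
  ∀ m j : ℕ, ((m + j : ℕ) : WithTop ℕ∞) ≤ r → ((j : ℕ) : WithTop ℕ∞) ≤ s →
    ContDiffOn ℝ j (fun z : E × F => iteratedFDeriv ℝ m (fun x => f (x, z.2)) z.1) U

/-- `g` has on `U` the form `g (x, y) = (X (x, y), Y y)` with `X` of class `C^{r,s}` and `Y` of
class `C^s`. -/
def IsFoliatedOn {k l : ℕ} (r s : WithTop ℕ∞) (g : Eu k × Eu l → Eu k × Eu l)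
    (U : Set (Eu k × Eu l)) : Prop :=
  ∃ (X : Eu k × Eu l → Eu k) (Y : Eu l → Eu l),
    IsClassCrs r s X U ∧ ContDiffOn ℝ s Y (Prod.snd '' U) ∧ ∀ z ∈ U, g z = (X z, Y z.2)

/-- `g` has the form `(X (x, y), Y y)` in a neighbourhood of each point of the open set `U`. -/
def IsLocallyFoliatedOn {k l : ℕ} (r s : WithTop ℕ∞) (g : Eu k × Eu l → Eu k × Eu l)
    (U : Set (Eu k × Eu l)) : Prop :=
  ∀ z ∈ U, ∃ V, IsOpen V ∧ z ∈ V ∧ IsFoliatedOn r s g (U ∩ V)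

/-! ### Foliated manifolds -/

/-- A foliated atlas of class `C^{r,s}`, with `k`-dimensional leaves and `l` transverse
dimensions, on the space `W`. -/
structure FoliatedAtlas (k l : ℕ) (r s : WithTop ℕ∞) (W : Type u) [TopologicalSpace W] where
  charts : Set (OpenPartialHomeomorph W (Eu k × Eu l))
  cover : ∀ x : W, ∃ φ ∈ charts, x ∈ φ.source
  compat : ∀ φ ∈ charts, ∀ ψ ∈ charts,
    IsFoliatedOn r s (φ.symm.trans ψ) (φ.symm.trans ψ).source

namespace FoliatedAtlas

variable {k l : ℕ} {r s : WithTop ℕ∞} {W : Type u} [TopologicalSpace W]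

/-- A flow-box of a foliated manifold: a chart that is compatible with the foliated atlas. -/
def IsFlowChart (A : FoliatedAtlas k l r s W)
    (φ : OpenPartialHomeomorph W (Eu k × Eu l)) : Prop :=
  ∀ ψ ∈ A.charts, IsLocallyFoliatedOn r s (φ.symm.trans ψ) (φ.symm.trans ψ).source ∧
    IsLocallyFoliatedOn r s (ψ.symm.trans φ) (ψ.symm.trans φ).source

/-- A path contained in a leaf (and continuous in it): in the charts, its transverse coordinate
is locally constant. Two points lie in the same leaf iff such a path joins them. -/
def IsLeafPath (A : FoliatedAtlas k l r s W) (γ : I → W) : Prop :=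
  Continuous γ ∧ ∀ φ ∈ A.charts, ∀ t : I, γ t ∈ φ.source →
    ∀ᶠ t' in 𝓝 t, (φ (γ t')).2 = (φ (γ t)).2

end FoliatedAtlas

/-! ### Solenoids -/

/-- A pre-solenoid structure of dimension `k`, transverse dimension `l` and class `C^{r,s}` on the
space `S`: `S` is compact and is embedded in a foliated manifold `W` (Hausdorff, second countable)
as a union of leaves. It represents a solenoid structure on `S`: two structures represent the same
solenoid if some foliated diffeomorphism between neighbourhoods of `S` in the ambient manifolds
is the identity on `S`. All notions below depend on `W` only through the germ of the foliated
manifold `W` along `S`, so they are notions for solenoids. -/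
structure PreSolenoid (k l : ℕ) (r s : WithTop ℕ∞) (S : Type u) [TopologicalSpace S] where
  W : Type u
  [topW : TopologicalSpace W]
  [t2W : T2Space W]
  [sccW : SecondCountableTopology W]
  foliation : FoliatedAtlas k l r s W
  ι : S → W
  isEmbedding : IsEmbedding ι
  compact : CompactSpace S
  saturated : ∀ γ : I → W, foliation.IsLeafPath γ → γ 0 ∈ range ι → γ 1 ∈ range ι

attribute [instance] PreSolenoid.topW PreSolenoid.t2W PreSolenoid.sccW

namespace PreSolenoid

variable {k l : ℕ} {r s : WithTop ℕ∞} {S : Type u} [TopologicalSpace S]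

/-- A flow-box of the solenoid `S`: a flow-box of the ambient manifold that maps its intersection
`U` with `S` onto `D^k × K`, where `D^k` is the open unit ball. -/
structure FlowBox (P : PreSolenoid k l r s S) where
  chart : OpenPartialHomeomorph P.W (Eu k × Eu l)
  isFlowChart : P.foliation.IsFlowChart chart
  K : Set (Eu l)
  image_eq : chart '' (chart.source ∩ range P.ι) = Metric.ball 0 1 ×ˢ K

namespace FlowBox

variable {P : PreSolenoid k l r s S}

/-- The open subset `U` of `S` on which the flow-box is defined. -/
def domain (B : P.FlowBox) : Set S := {p | P.ι p ∈ B.chart.source}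

/-- The leaf coordinate of the flow-box. -/
def leafCoord (B : P.FlowBox) (p : S) : Eu k := (B.chart (P.ι p)).1

/-- The transverse coordinate of the flow-box. -/
def transCoord (B : P.FlowBox) (p : S) : Eu l := (B.chart (P.ι p)).2

/-- The local transversal `φ⁻¹({0} × K)` of the flow-box. -/
def transversal (B : P.FlowBox) : Set S := {p | p ∈ B.domain ∧ B.leafCoord p = 0}

end FlowBox

/-- `T` is a local transversal of `S` (at each of its points). -/
def IsLocalTransversal (P : PreSolenoid k l r s S) (T : Set S) : Prop :=
  T.Nonempty ∧ ∃ B : P.FlowBox, T = B.transversal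

/-- A path of `S` contained in a leaf. -/
def IsLeafPath (P : PreSolenoid k l r s S) (γ : I → S) : Prop :=
  P.foliation.IsLeafPath fun t => P.ι (γ t)

/-- `h : V ⊆ T₁ → T₂` is a holonomy map, `V` open in `T₁`: it is injective and is obtained by
moving the points of `V` along leaf paths that depend continuously on the starting point. -/
def IsHolonomyMap (P : PreSolenoid k l r s S) (T₁ T₂ V : Set S) (h : S → S) : Prop :=
  (∃ O : Set S, IsOpen O ∧ V = T₁ ∩ O) ∧ InjOn h V ∧ MapsTo h V T₂ ∧
  ∃ H : S × I → S, ContinuousOn H (V ×ˢ univ) ∧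
    ∀ q ∈ V, P.IsLeafPath (fun t => H (q, t)) ∧ H (q, 0) = q ∧ H (q, 1) = h q

/-- A holonomy invariant family `μ = (μ_T)` of locally finite Borel measures `μ_T` supported on the
local transversals `T` of `S`. Only the values of `measure` at local transversals are relevant.
The zero family is allowed here; see `IsNontrivial`. -/
structure TransversalMeasure [MeasurableSpace S] (P : PreSolenoid k l r s S) where
  measure : Set S → Measure S
  supported : ∀ T, P.IsLocalTransversal T → measure T Tᶜ = 0
  locallyFinite : ∀ T, P.IsLocalTransversal T → ∀ p ∈ T, ∃ V ∈ 𝓝 p, measure T V < ⊤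
  invariant : ∀ T₁ T₂ V h, P.IsLocalTransversal T₁ → P.IsLocalTransversal T₂ →
    P.IsHolonomyMap T₁ T₂ V h → ∀ A, A ⊆ V → MeasurableSet A →
      measure T₂ (h '' A) = measure T₁ A

/-- `μ_T` is non-zero for some local transversal `T`. -/
def TransversalMeasure.IsNontrivial [MeasurableSpace S] {P : PreSolenoid k l r s S}
    (μ : P.TransversalMeasure) : Prop :=
  ∃ T, P.IsLocalTransversal T ∧ μ.measure T ≠ 0

/-- The support: the points all of whose local transversals have positive measure. -/
def TransversalMeasure.support [MeasurableSpace S] {P : PreSolenoid k l r s S}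
    (μ : P.TransversalMeasure) : Set S :=
  {p | ∀ T, P.IsLocalTransversal T → p ∈ T → μ.measure T ≠ 0}

/-- An orientation of the leaves of `S`, continuous on `S`: to each chart `φ` and point `p` of `S`
in it, the sign that compares the orientation of the leaf through `p` with the standard orientation
of `ℝ^k` through `φ`. For `k = 0` it is a continuous function `S → {±1}`. -/
structure LeafOrientation (P : PreSolenoid k l r s S) where
  sign : OpenPartialHomeomorph P.W (Eu k × Eu l) → S → ℤˣ
  locally_const : ∀ φ ∈ P.foliation.charts, ∀ p, P.ι p ∈ φ.source →
    ∀ᶠ q in 𝓝 p, sign φ q = sign φ p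
  compat : ∀ φ ∈ P.foliation.charts, ∀ ψ ∈ P.foliation.charts, ∀ p,
    P.ι p ∈ φ.source → P.ι p ∈ ψ.source →
    0 < (((sign φ p * sign ψ p : ℤˣ) : ℤ) : ℝ) *
      (fderiv ℝ (fun x => (ψ (φ.symm (x, (φ (P.ι p)).2))).1) (φ (P.ι p)).1).det

/-! ### Immersions into a manifold -/

variable (n : ℕ) {M : Type w} [TopologicalSpace M] [ChartedSpace (Eu n) M]

/-- The leafwise differential at `p` of a map `f : S → M`, in the chart `φ` and in the preferred
chart of `M` at `f p`. The map is differentiated along the plaque through `p`, a neighbourhood of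
`p` in which is contained in `S`; the default value of `Function.extend` outside of `S` plays
no role. -/
def leafDiff (P : PreSolenoid k l r s S) (f : S → M)
    (φ : OpenPartialHomeomorph P.W (Eu k × Eu l)) (p : S) : Eu k →L[ℝ] Eu n :=
  fderiv ℝ (fun x => chartAt (Eu n) (f p)
    (Function.extend P.ι f (fun _ => f p) (φ.symm (x, (φ (P.ι p)).2)))) (φ (P.ι p)).1

/-- `f : S → M` is an immersed solenoid: `f` has an extension of class `C^{r,s}` to a neighbourhood
of `S` in the ambient foliated manifold, and its leafwise differential has rank `k` at each point
of `S`. -/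
def IsImmersion (P : PreSolenoid k l r s S) (f : S → M) : Prop :=
  (∃ (U : Set P.W) (F : P.W → M), IsOpen U ∧ range P.ι ⊆ U ∧ (∀ p, F (P.ι p) = f p) ∧
    ContinuousOn F U ∧ ∀ φ ∈ P.foliation.charts, ∀ ψ ∈ atlas (Eu n) M,
      IsClassCrs r s (fun z => ψ (F (φ.symm z)))
        {z | z ∈ φ.target ∧ φ.symm z ∈ U ∧ F (φ.symm z) ∈ ψ.source}) ∧
  ∀ p, ∀ φ ∈ P.foliation.charts, P.ι p ∈ φ.source → Function.Injective (P.leafDiff n f φ p)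

end PreSolenoid

/-- The immersed solenoids `f₁`, `f₂` intersect transversally: wherever `f₁ p₁ = f₂ p₂`, the images
of the tangent spaces of the leaves through `p₁` and `p₂` span the tangent space of `M`. -/
def IntersectTransversally (n : ℕ) {k₁ k₂ l₁ l₂ : ℕ} {r s : WithTop ℕ∞}
    {M : Type w} [TopologicalSpace M] [ChartedSpace (Eu n) M]
    {S₁ : Type u} [TopologicalSpace S₁] {S₂ : Type v} [TopologicalSpace S₂]
    (P₁ : PreSolenoid k₁ l₁ r s S₁) (P₂ : PreSolenoid k₂ l₂ r s S₂)
    (f₁ : S₁ → M) (f₂ : S₂ → M) : Prop :=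
  ∀ p₁ p₂, f₁ p₁ = f₂ p₂ →
    ∀ φ₁ ∈ P₁.foliation.charts, P₁.ι p₁ ∈ φ₁.source →
    ∀ φ₂ ∈ P₂.foliation.charts, P₂.ι p₂ ∈ φ₂.source →
      (P₁.leafDiff n f₁ φ₁ p₁).range ⊔ (P₂.leafDiff n f₂ φ₂ p₂).range = ⊤

/-- An orientation of the manifold `M`, as signs relative to the charts. -/
structure ManifoldOrientation (n : ℕ) (M : Type w) [TopologicalSpace M]
    [ChartedSpace (Eu n) M] where
  sign : OpenPartialHomeomorph M (Eu n) → M → ℤˣ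
  locally_const : ∀ φ ∈ atlas (Eu n) M, ∀ x ∈ φ.source, ∀ᶠ y in 𝓝 x, sign φ y = sign φ x
  compat : ∀ φ ∈ atlas (Eu n) M, ∀ ψ ∈ atlas (Eu n) M, ∀ x, x ∈ φ.source → x ∈ ψ.source →
    0 < (((sign φ x * sign ψ x : ℤˣ) : ℤ) : ℝ) *
      (fderiv ℝ (fun z => ψ (φ.symm z)) (φ x)).det

/-- The determinant of `d` vectors of `ℝ^d`. -/
def frameDet {d : ℕ} (e : Fin d → Eu d) : ℝ := Matrix.det (Matrix.of fun i j => e j i)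

/-- Concatenation of coordinates, `ℝ^{l₁} × ℝ^{l₂} → ℝ^{l₁ + l₂}`. -/
def appendCoord {l₁ l₂ : ℕ} (a : Eu l₁) (b : Eu l₂) : Eu (l₁ + l₂) :=
  WithLp.toLp 2 (Fin.append (fun i => a i) (fun j => b j))

section Intersection

variable {n k k₁ k₂ l l₁ l₂ : ℕ} {r s : WithTop ℕ∞}
  {M : Type w} [TopologicalSpace M] [ChartedSpace (Eu n) M]
  {S₁ : Type u} [TopologicalSpace S₁] {S₂ : Type v} [TopologicalSpace S₂]
  {f₁ : S₁ → M} {f₂ : S₂ → M}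

/-- The common map `f (p₁, p₂) = f₁ p₁ = f₂ p₂` on the fibre product. -/
def commonMap (f₁ : S₁ → M) (f₂ : S₂ → M) (p : f₁.Pullback f₂) : M := f₁ p.1.1

/-- The solenoid structure of the fibre product is the one induced by those of `S₁` and `S₂`: inside
given flow-boxes of `S₁` and `S₂` around `p₁` and `p₂`, with transverse coordinates `y` and `z`,
there is a flow-box of the fibre product around `(p₁, p₂)` with transverse coordinate `(y, z)`. -/
def IsInducedStructure (P₁ : PreSolenoid k₁ l₁ r s S₁) (P₂ : PreSolenoid k₂ l₂ r s S₂)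
    (P : PreSolenoid k (l₁ + l₂) r s (f₁.Pullback f₂)) : Prop :=
  ∀ (p : f₁.Pullback f₂) (B₁ : P₁.FlowBox) (B₂ : P₂.FlowBox),
    p.1.1 ∈ B₁.domain → p.1.2 ∈ B₂.domain →
    ∃ B : P.FlowBox, p ∈ B.domain ∧ ∀ q ∈ B.domain,
      q.1.1 ∈ B₁.domain ∧ q.1.2 ∈ B₂.domain ∧
      B.transCoord q = appendCoord (B₁.transCoord q.1.1) (B₂.transCoord q.1.2)

/-- The intersection orientation. Let `e` be a basis of the tangent space of the leaf of the fibre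
product, completed to bases `u` and `v` of the tangent spaces of the two leaves (all seen in the
tangent space of `M`). Then `u` followed by the vectors of `v` not in `e` is a basis `w` of the
tangent space of `M`, and the sign of `e` is the product of the signs of `u`, `v` and `w`.
For `k = 0` this is the intersection index. -/
def IsInducedOrientation (hk : k + n = k₁ + k₂)
    (P₁ : PreSolenoid k₁ l₁ r s S₁) (P₂ : PreSolenoid k₂ l₂ r s S₂)
    (P : PreSolenoid k l r s (f₁.Pullback f₂)) (oM : ManifoldOrientation n M)
    (o₁ : P₁.LeafOrientation) (o₂ : P₂.LeafOrientation) (o : P.LeafOrientation) : Prop :=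
  ∀ p : f₁.Pullback f₂,
    ∀ φ₁ ∈ P₁.foliation.charts, P₁.ι p.1.1 ∈ φ₁.source →
    ∀ φ₂ ∈ P₂.foliation.charts, P₂.ι p.1.2 ∈ φ₂.source →
    ∀ φ ∈ P.foliation.charts, P.ι p ∈ φ.source →
    ∀ (e : Fin k → Eu k) (u : Fin k₁ → Eu k₁) (v : Fin k₂ → Eu k₂),
      LinearIndependent ℝ u → LinearIndependent ℝ v →
      (∀ (i : Fin k) (i₁ : Fin k₁) (i₂ : Fin k₂), i₁.val = i.val → i₂.val = i.val →
        P₁.leafDiff n f₁ φ₁ p.1.1 (u i₁) = P.leafDiff n (commonMap f₁ f₂) φ p (e i) ∧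
        P₂.leafDiff n f₂ φ₂ p.1.2 (v i₂) = P.leafDiff n (commonMap f₁ f₂) φ p (e i)) →
      0 < (((o.sign φ p * o₁.sign φ₁ p.1.1 * o₂.sign φ₂ p.1.2 *
          oM.sign (chartAt (Eu n) (commonMap f₁ f₂ p)) (commonMap f₁ f₂ p) : ℤˣ) : ℤ) : ℝ) *
        (frameDet e * frameDet u * frameDet v *
          frameDet fun i : Fin n =>
            if h : i.val < k₁ then P₁.leafDiff n f₁ φ₁ p.1.1 (u ⟨i.val, h⟩)
            else P₂.leafDiff n f₂ φ₂ p.1.2 (v ⟨i.val - k₁ + k, by have := i.isLt; omega⟩))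

/-- `μ` is the transversal measure induced by the product of `μ₁` and `μ₂`. Let `B₁`, `B₂` be
flow-boxes of `S₁`, `S₂` with local transversals `T₁`, `T₂`, and let `A` be a Borel subset of a
local transversal `T` of the fibre product, over the flow-boxes, on which the projection along
the leaves to `T₁ × T₂` is injective. Then `μ_T (A)` is the `μ_{T₁} × μ_{T₂}`-measure of the
projection of `A`. -/
def IsProductMeasure [MeasurableSpace S₁] [MeasurableSpace S₂]
    {P₁ : PreSolenoid k₁ l₁ r s S₁} {P₂ : PreSolenoid k₂ l₂ r s S₂}
    {P : PreSolenoid k l r s (f₁.Pullback f₂)}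
    (μ₁ : P₁.TransversalMeasure) (μ₂ : P₂.TransversalMeasure) (μ : P.TransversalMeasure) :
    Prop :=
  ∀ (B₁ : P₁.FlowBox) (B₂ : P₂.FlowBox) (T A : Set (f₁.Pullback f₂)),
    P.IsLocalTransversal T → A ⊆ T → MeasurableSet A →
    (∀ q ∈ A, q.1.1 ∈ B₁.domain ∧ q.1.2 ∈ B₂.domain) →
    InjOn (fun q => (B₁.transCoord q.1.1, B₂.transCoord q.1.2)) A →
    μ.measure T A =
      ((μ₁.measure B₁.transversal).prod (μ₂.measure B₂.transversal))
        {t | t.1 ∈ B₁.transversal ∧ t.2 ∈ B₂.transversal ∧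
          ∃ q ∈ A, B₁.transCoord q.1.1 = B₁.transCoord t.1 ∧
            B₂.transCoord q.1.2 = B₂.transCoord t.2}

end Intersection

end

/-! Extend `f₁`, `f₂` to maps `F₁`, `F₂` of class `C^{r,s}` on neighbourhoods in the ambient
foliated manifolds. The pairs where `F₁ = F₂` and the leafwise differentials are transversal
(`fibreSet`) form the ambient foliated manifold of the fibre product. In flow charts with leaf
coordinates `x₁`, `x₂` and transverse coordinates `y`, `z`, the equation reads `H₁ (x₁, y) = H₂ (x₂,
z)`. By transversality its derivative in `(x₁, x₂)` alone is onto, so it can be solved for `n` of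
the leaf variables with `(y, z)` as parameters. A linear function `C (x₁, x₂)` with `k` components
and the pair `(y, z)` are then coordinates (`exists_isAdapted`). Leaf paths project to leaf paths of
both factors (`isLeafPath_fibre`), so the fibre product of the solenoids is a union of leaves.

Since `s` may be `0`, differentiability in the parameters is not available. The inverse function
theorem is therefore proved with merely continuous dependence on parameters
(`exists_openPartialHomeomorph_of_leafDeriv`), and the class `C^{r,s}` of the inverse is obtained
afterwards by bootstrapping along the leaves (`IsClassCrs.inverse`). The mixed conditions of
`C^{r,s}` are handled through the recursive predicate `LeafContDiffOn`, which is stable under the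
chain and product rules.

For the orientation, the derivative of `(F₁ - F₂, C)` in the leaf variables is an isomorphism. The
sign of its determinant, relative to the fixed identification `jointFrame`, times the three given
signs is the sign of an adapted chart. `jointDet_change` shows that these signs are compatible, and
`jointDet_frame` is the characterization by frames.

For the measure, `μ₁` and `μ₂` are pushed to the transverse spaces of flow-boxes (`boxMeasure`), and
their product is pulled back by `(y, z)`, which is locally injective on local transversals. The
result does not depend on the flow-boxes, because projections along plaques are holonomy maps
(`boxMeasure_image`, `exists_boxProduct_eq`). Along a family of leaf paths `(y, z)` is locally
constant in time, and connectedness of the interval gives holonomy invariance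
(`isTransported_of_leafPath`). Non-triviality also needs the induced flow-boxes to contain all
points over a product neighbourhood in the transverse spaces (`IsStronglyInduced`). -/

noncomputable section

set_option linter.unusedSectionVars false

/-! ### Calculus of maps of class `C^{r,s}` -/

section Calculus

variable {E F G G₁ G₂ G₃ E' F' : Type u} [NormedAddCommGroup E] [NormedSpace ℝ E]
  [NormedAddCommGroup F] [NormedSpace ℝ F] [NormedAddCommGroup G] [NormedSpace ℝ G]
  [NormedAddCommGroup G₁] [NormedSpace ℝ G₁] [NormedAddCommGroup G₂] [NormedSpace ℝ G₂]
  [NormedAddCommGroup G₃] [NormedSpace ℝ G₃]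
  [NormedAddCommGroup E'] [NormedSpace ℝ E'] [NormedAddCommGroup F'] [NormedSpace ℝ F']

/-- The partial derivative in the leaf variable. -/
def leafDeriv (f : E × F → G) (z : E × F) : E →L[ℝ] G := fderiv ℝ (fun x => f (x, z.2)) z.1

/-- The leaf derivatives of order at most `q` of `f` exist and are jointly of class `C^b`. -/
def LeafContDiffOn (b : WithTop ℕ∞) : ∀ (_ : ℕ) {G : Type u} [NormedAddCommGroup G]
    [NormedSpace ℝ G], (E × F → G) → Set (E × F) → Prop
  | 0, _, _, _, f, U => ContDiffOn ℝ b f U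
  | q + 1, _, _, _, f, U => ContDiffOn ℝ b f U ∧
      (∀ z ∈ U, DifferentiableAt ℝ (fun x => f (x, z.2)) z.1) ∧ LeafContDiffOn b q (leafDeriv f) U

theorem eventually_leaf_mem {U : Set (E × F)} (hU : IsOpen U) {z : E × F} (hz : z ∈ U) :
    ∀ᶠ x in 𝓝 z.1, (x, z.2) ∈ U :=
  (Continuous.prodMk_left z.2).continuousAt.eventually_mem (hU.mem_nhds hz)

theorem leafDeriv_congr {U : Set (E × F)} (hU : IsOpen U) {f g : E × F → G} (h : EqOn f g U) :
    EqOn (leafDeriv f) (leafDeriv g) U := fun z hz => by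
  apply Filter.EventuallyEq.fderiv_eq
  filter_upwards [eventually_leaf_mem hU hz] with x hx using h hx

namespace LeafContDiffOn

variable {b : WithTop ℕ∞} {q : ℕ} {U : Set (E × F)}

theorem contDiffOn {f : E × F → G} (h : LeafContDiffOn b q f U) : ContDiffOn ℝ b f U := by
  cases q with
  | zero => exact h
  | succ q => exact h.1

theorem of_succ {f : E × F → G} (h : LeafContDiffOn b (q + 1) f U) : LeafContDiffOn b q f U := by
  induction q generalizing G with
  | zero => exact h.1
  | succ q ih => exact ⟨h.1, h.2.1, ih h.2.2⟩

theorem congr {f g : E × F → G} (hU : IsOpen U) (h : LeafContDiffOn b q f U) (hfg : EqOn f g U) :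
    LeafContDiffOn b q g U := by
  induction q generalizing G with
  | zero => exact ContDiffOn.congr h fun z hz => (hfg hz).symm
  | succ q ih =>
    refine ⟨h.1.congr fun z hz => (hfg hz).symm, fun z hz => ?_, ih h.2.2 (leafDeriv_congr hU hfg)⟩
    refine (h.2.1 z hz).congr_of_eventuallyEq ?_
    filter_upwards [eventually_leaf_mem hU hz] with x hx using (hfg hx).symm

theorem of_local {f : E × F → G}
    (h : ∀ z ∈ U, ∃ V, IsOpen V ∧ z ∈ V ∧ LeafContDiffOn b q f (U ∩ V)) :
    LeafContDiffOn b q f U := by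
  induction q generalizing G with
  | zero => exact contDiffOn_of_locally_contDiffOn h
  | succ q ih =>
    refine ⟨contDiffOn_of_locally_contDiffOn fun z hz => ?_, fun z hz => ?_, ih fun z hz => ?_⟩ <;>
      obtain ⟨V, hV, hzV, h⟩ := h z hz
    exacts [⟨V, hV, hzV, h.1⟩, h.2.1 z ⟨hz, hzV⟩, ⟨V, hV, hzV, h.2.2⟩]

theorem clm_comp {f : E × F → G} (L : G →L[ℝ] G₁) (hU : IsOpen U) (h : LeafContDiffOn b q f U) :
    LeafContDiffOn b q (fun z => L (f z)) U := by
  induction q generalizing G G₁ with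
  | zero => exact L.contDiff.comp_contDiffOn h
  | succ q ih =>
    refine ⟨L.contDiff.comp_contDiffOn h.1,
      fun z hz => L.differentiableAt.comp z.1 (h.2.1 z hz), ?_⟩
    refine congr hU (ih (ContinuousLinearMap.compL ℝ E G G₁ L) h.2.2) fun z hz => ?_
    exact ((L.hasFDerivAt.comp z.1 (h.2.1 z hz).hasFDerivAt).fderiv).symm

theorem add {f g : E × F → G} (hU : IsOpen U) (hf : LeafContDiffOn b q f U)
    (hg : LeafContDiffOn b q g U) : LeafContDiffOn b q (fun z => f z + g z) U := by
  induction q generalizing G with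
  | zero => exact ContDiffOn.add hf hg
  | succ q ih =>
    refine ⟨hf.1.add hg.1, fun z hz => (hf.2.1 z hz).add (hg.2.1 z hz), ?_⟩
    refine congr hU (ih hf.2.2 hg.2.2) fun z hz => ?_
    exact (fderiv_fun_add (hf.2.1 z hz) (hg.2.1 z hz)).symm

theorem prodMk {f : E × F → G} {g : E × F → G₁} (hU : IsOpen U) (hf : LeafContDiffOn b q f U)
    (hg : LeafContDiffOn b q g U) : LeafContDiffOn b q (fun z => (f z, g z)) U := by
  refine congr hU (add hU (clm_comp (.inl ℝ G G₁) hU hf) (clm_comp (.inr ℝ G G₁) hU hg)) ?_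
  intro z _
  simp

/-- By the product rule the leaf derivative is a sum of two expressions of the same kind, for the
bilinear maps `precompR` and `precompL`; the induction on `q` therefore runs over all bilinear maps
and target spaces at once. -/
theorem bilinear {f : E × F → G₁} {g : E × F → G₂} (B : G₁ →L[ℝ] G₂ →L[ℝ] G₃) (hU : IsOpen U)
    (hf : LeafContDiffOn b q f U) (hg : LeafContDiffOn b q g U) :
    LeafContDiffOn b q (fun z => B (f z) (g z)) U := by
  induction q generalizing G₁ G₂ G₃ with
  | zero => exact B.isBoundedBilinearMap.contDiff.comp_contDiffOn (ContDiffOn.prodMk hf hg)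
  | succ q ih =>
    refine ⟨B.isBoundedBilinearMap.contDiff.comp_contDiffOn (hf.1.prodMk hg.1), fun z hz => ?_, ?_⟩
    · exact (B.hasFDerivAt_of_bilinear (hf.2.1 z hz).hasFDerivAt
        (hg.2.1 z hz).hasFDerivAt).differentiableAt
    · refine congr hU (add hU (ih (ContinuousLinearMap.precompR E B) hf.of_succ hg.2.2)
        (ih (ContinuousLinearMap.precompL E B) hf.2.2 hg.of_succ)) fun z hz => ?_
      exact (B.fderiv_of_bilinear (hf.2.1 z hz) (hg.2.1 z hz)).symm

theorem of_leafDeriv_eq_zero {f : E × F → G} (hU : IsOpen U) (h : ContDiffOn ℝ b f U)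
    (hf : ∀ z ∈ U, HasFDerivAt (fun x => f (x, z.2)) (0 : E →L[ℝ] G) z.1) :
    LeafContDiffOn b q f U := by
  induction q generalizing G with
  | zero => exact h
  | succ q ih =>
    refine ⟨h, fun z hz => (hf z hz).differentiableAt, ?_⟩
    have h0 : EqOn (fun _ => 0) (leafDeriv f) U := fun z hz => (hf z hz).fderiv.symm
    refine congr hU (ih contDiffOn_const fun z _ => ?_) h0
    exact hasFDerivAt_const 0 z.1

theorem fst (hU : IsOpen U) : LeafContDiffOn b q (Prod.fst : E × F → E) U := by
  cases q with
  | zero => exact contDiff_fst.contDiffOn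
  | succ q =>
    refine ⟨contDiff_fst.contDiffOn, fun z _ => differentiableAt_id, ?_⟩
    have h0 : EqOn (fun _ => ContinuousLinearMap.id ℝ E) (leafDeriv (Prod.fst : E × F → E)) U :=
      fun z hz => (hasFDerivAt_id (𝕜 := ℝ) z.1).fderiv.symm
    exact congr hU (of_leafDeriv_eq_zero hU contDiffOn_const
      fun z _ => hasFDerivAt_const _ z.1) h0

/-- `Y` depends on the transverse variable only, so the chain rule along a leaf involves just the
leaf derivatives of `f` and `g`. These are combined by composition of linear maps, which is
bilinear, and `Y` needs no more than class `C^b`. -/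
theorem comp {U' : Set (E' × F')} {f : E' × F' → G} {g : E × F → E'} {Y : F → F'}
    (hU : IsOpen U) (hf : LeafContDiffOn b q f U') (hg : LeafContDiffOn b q g U)
    (hY : ContDiffOn ℝ b (fun z : E × F => Y z.2) U) (hm : ∀ z ∈ U, (g z, Y z.2) ∈ U') :
    LeafContDiffOn b q (fun z => f (g z, Y z.2)) U := by
  induction q generalizing G with
  | zero => exact ContDiffOn.comp hf (ContDiffOn.prodMk hg hY) hm
  | succ q ih =>
    have key : ∀ z ∈ U, HasFDerivAt (fun x => f (g (x, z.2), Y z.2))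
        ((leafDeriv f (g z, Y z.2)).comp (leafDeriv g z)) z.1 := fun z hz =>
      HasFDerivAt.comp (f := fun x => g (x, z.2)) (g := fun x => f (x, Y z.2)) z.1
        (hf.2.1 _ (hm z hz)).hasFDerivAt (hg.2.1 z hz).hasFDerivAt
    refine ⟨hf.1.comp (hg.1.prodMk hY) hm, fun z hz => (key z hz).differentiableAt, ?_⟩
    refine congr hU (bilinear (ContinuousLinearMap.compL ℝ E E' G) hU (ih hf.2.2 hg.of_succ)
      hg.2.2) fun z hz => ?_
    exact (key z hz).fderiv.symm

/-- Smoothness of the outer map makes its derivative an outer map of the same kind, so that the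
induction on `q` closes. The decisive application is to inversion of linear maps, in the inverse
function theorem. -/
theorem contDiffOn_comp {f : G → G₁} {g : E × F → G} {O : Set G} (hU : IsOpen U) (hO : IsOpen O)
    (hf : ContDiffOn ℝ ∞ f O) (hb : b ≤ ∞) (hg : LeafContDiffOn b q g U) (hm : MapsTo g U O) :
    LeafContDiffOn b q (fun z => f (g z)) U := by
  induction q generalizing G₁ with
  | zero => exact ContDiffOn.comp (hf.of_le hb) hg hm
  | succ q ih =>
    have hd : ∀ w ∈ O, DifferentiableAt ℝ f w := fun w hw =>
      (hf.differentiableOn (by simp)).differentiableAt (hO.mem_nhds hw)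
    have key : ∀ z ∈ U, HasFDerivAt (fun x => f (g (x, z.2)))
        ((fderiv ℝ f (g z)).comp (leafDeriv g z)) z.1 := fun z hz =>
      (hd _ (hm hz)).hasFDerivAt.comp z.1 (hg.2.1 z hz).hasFDerivAt
    refine ⟨(hf.of_le hb).comp hg.1 hm, fun z hz => (key z hz).differentiableAt, ?_⟩
    have hf' : ContDiffOn ℝ ∞ (fderiv ℝ f) O := hf.fderiv_of_isOpen hO (by simp)
    refine congr hU (bilinear (ContinuousLinearMap.compL ℝ E G G₁) hU (ih hf' hg.of_succ)
      hg.2.2) fun z hz => ?_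
    exact (key z hz).fderiv.symm

/-- Currying is a linear isometry that identifies the leafwise derivative of order `q + 1` of `f`
with that of order `q` of `leafDeriv f`. The same identification gives the converse
`of_iteratedFDeriv`. -/
theorem iteratedFDeriv {f : E × F → G} (h : LeafContDiffOn b q f U) :
    ContDiffOn ℝ b (fun z : E × F => iteratedFDeriv ℝ q (fun x => f (x, z.2)) z.1) U := by
  induction q generalizing G with
  | zero =>
    simp only [iteratedFDeriv_zero_eq_comp]
    exact (LinearIsometryEquiv.contDiff _).comp_contDiffOn h
  | succ q ih =>
    simp only [iteratedFDeriv_succ_eq_comp_right]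
    exact (LinearIsometryEquiv.contDiff _).comp_contDiffOn (ih h.2.2)

theorem of_iteratedFDeriv {f : E × F → G}
    (hd : ∀ z ∈ U, ContDiffAt ℝ q (fun x => f (x, z.2)) z.1)
    (h : ∀ m ≤ q, ContDiffOn ℝ b (fun z : E × F =>
        _root_.iteratedFDeriv ℝ m (fun x => f (x, z.2)) z.1) U) :
    LeafContDiffOn b q f U := by
  induction q generalizing G with
  | zero =>
    have := h 0 le_rfl
    simp only [iteratedFDeriv_zero_eq_comp] at this
    exact (ContinuousLinearEquiv.comp_contDiffOn_iff
        (continuousMultilinearCurryFin0 ℝ E G).symm.toContinuousLinearEquiv).1 this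
  | succ q ih =>
    refine ⟨?_, fun z hz => (hd z hz).differentiableAt (by simp),
      ih (fun z hz => ?_) fun m hm => ?_⟩
    · have := h 0 (by omega)
      simp only [iteratedFDeriv_zero_eq_comp] at this
      exact (ContinuousLinearEquiv.comp_contDiffOn_iff
        (continuousMultilinearCurryFin0 ℝ E G).symm.toContinuousLinearEquiv).1 this
    · exact (hd z hz).fderiv_right (by simp)
    · have := h (m + 1) (by omega)
      simp only [iteratedFDeriv_succ_eq_comp_right] at this
      exact (ContinuousLinearEquiv.comp_contDiffOn_iff
        (continuousMultilinearCurryRightEquiv' ℝ m E G).symm.toContinuousLinearEquiv).1 this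

end LeafContDiffOn

variable {r s : WithTop ℕ∞} {U : Set (E × F)}

namespace IsClassCrs

theorem leafContDiffOn {f : E × F → G} (h : IsClassCrs r s f U) {q j : ℕ}
    (hq : ((q + j : ℕ) : WithTop ℕ∞) ≤ r) (hj : ((j : ℕ) : WithTop ℕ∞) ≤ s) :
    LeafContDiffOn j q f U := by
  refine .of_iteratedFDeriv (fun z hz => (h.2.1 z hz).of_le (le_trans ?_ hq)) fun m hm =>
    h.2.2 m j (le_trans ?_ hq) hj
  · exact_mod_cast Nat.le_add_right q j
  · exact_mod_cast Nat.add_le_add_right hm j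

/-- Together with `leafContDiffOn` this replaces the conditions on iterated derivatives by the
recursive predicate, through which the closure properties of the class are proved. -/
theorem mk' {f : E × F → G} (h₁ : ContDiffOn ℝ s f U)
    (h₂ : ∀ z ∈ U, ContDiffAt ℝ r (fun x => f (x, z.2)) z.1)
    (h₃ : ∀ q j : ℕ, ((q + j : ℕ) : WithTop ℕ∞) ≤ r → ((j : ℕ) : WithTop ℕ∞) ≤ s →
      LeafContDiffOn j q f U) : IsClassCrs r s f U :=
  ⟨h₁, h₂, fun m j hm hj => (h₃ m j hm hj).iteratedFDeriv⟩

theorem mono {f : E × F → G} {V : Set (E × F)} (h : IsClassCrs r s f U) (hV : V ⊆ U) :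
    IsClassCrs r s f V :=
  ⟨h.1.mono hV, fun z hz => h.2.1 z (hV hz), fun m j hm hj => (h.2.2 m j hm hj).mono hV⟩

theorem congr {f g : E × F → G} (hU : IsOpen U) (h : IsClassCrs r s f U) (hfg : EqOn f g U) :
    IsClassCrs r s g U :=
  mk' (h.1.congr fun z hz => (hfg hz).symm)
    (fun z hz => (h.2.1 z hz).congr_of_eventuallyEq (by
      filter_upwards [eventually_leaf_mem hU hz] with x hx using (hfg hx).symm))
    fun _ _ hq hj => (h.leafContDiffOn hq hj).congr hU hfg

theorem of_local {f : E × F → G}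
    (h : ∀ z ∈ U, ∃ V, IsOpen V ∧ z ∈ V ∧ IsClassCrs r s f (U ∩ V)) : IsClassCrs r s f U :=
  mk' (contDiffOn_of_locally_contDiffOn fun z hz =>
      let ⟨V, hV, hzV, h⟩ := h z hz; ⟨V, hV, hzV, h.1⟩)
    (fun z hz => let ⟨_, _, hzV, h⟩ := h z hz; h.2.1 z ⟨hz, hzV⟩)
    fun _ _ hq hj => .of_local fun z hz =>
      let ⟨V, hV, hzV, h⟩ := h z hz; ⟨V, hV, hzV, h.leafContDiffOn hq hj⟩

theorem continuousOn {f : E × F → G} (h : IsClassCrs r s f U) : ContinuousOn f U := h.1.continuousOn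

theorem clm_comp {f : E × F → G} (L : G →L[ℝ] G₁) (hU : IsOpen U) (h : IsClassCrs r s f U) :
    IsClassCrs r s (fun z => L (f z)) U :=
  mk' (L.contDiff.comp_contDiffOn h.1) (fun z hz => L.contDiff.contDiffAt.comp z.1 (h.2.1 z hz))
    fun _ _ hq hj => (h.leafContDiffOn hq hj).clm_comp L hU

theorem prodMk {f : E × F → G} {g : E × F → G₁} (hU : IsOpen U) (hf : IsClassCrs r s f U)
    (hg : IsClassCrs r s g U) : IsClassCrs r s (fun z => (f z, g z)) U :=
  mk' (hf.1.prodMk hg.1) (fun z hz => (hf.2.1 z hz).prodMk (hg.2.1 z hz))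
    fun _ _ hq hj => (hf.leafContDiffOn hq hj).prodMk hU (hg.leafContDiffOn hq hj)

theorem comp {U' : Set (E' × F')} {f : E' × F' → G} {g : E × F → E'} {Y : F → F'}
    (hU : IsOpen U) (hf : IsClassCrs r s f U') (hg : IsClassCrs r s g U)
    (hY : ContDiffOn ℝ s (fun z : E × F => Y z.2) U) (hm : ∀ z ∈ U, (g z, Y z.2) ∈ U') :
    IsClassCrs r s (fun z => f (g z, Y z.2)) U :=
  mk' (hf.1.comp (hg.1.prodMk hY) hm)
    (fun z hz => (hf.2.1 _ (hm z hz)).comp (f := fun x => g (x, z.2)) z.1 (hg.2.1 z hz))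
    fun _ _ hq hj => (hf.leafContDiffOn hq hj).comp hU (hg.leafContDiffOn hq hj) (hY.of_le hj) hm

theorem differentiableAt {f : E × F → G} (h : IsClassCrs r s f U) (hr : 1 ≤ r) {z : E × F}
    (hz : z ∈ U) : DifferentiableAt ℝ (fun x => f (x, z.2)) z.1 :=
  (h.2.1 z hz).differentiableAt (by rintro rfl; simp at hr)

theorem hasFDerivAt {f : E × F → G} (h : IsClassCrs r s f U) (hr : 1 ≤ r) {z : E × F}
    (hz : z ∈ U) : HasFDerivAt (fun x => f (x, z.2)) (leafDeriv f z) z.1 :=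
  (h.differentiableAt hr hz).hasFDerivAt

theorem continuousOn_leafDeriv {f : E × F → G} (h : IsClassCrs r s f U) (hr : 1 ≤ r) :
    ContinuousOn (leafDeriv f) U :=
  (h.leafContDiffOn (q := 1) (j := 0) (by simpa using hr) (by simp)).2.2.continuousOn

end IsClassCrs

/-- The slice at height `z.2` is mapped into the slice at height `Y z.2`, so the transverse part
contributes nothing to the derivative along the leaf. -/
theorem leafDeriv_comp {r s : WithTop ℕ∞} (hr : 1 ≤ r) {U' : Set (E' × F')} {f : E' × F' → G}
    {g : E × F → E'} {Y : F → F'} (hf : IsClassCrs r s f U') (hg : IsClassCrs r s g U) {z : E × F}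
    (hz : z ∈ U) (hm : (g z, Y z.2) ∈ U') :
    leafDeriv (fun z => f (g z, Y z.2)) z = (leafDeriv f (g z, Y z.2)).comp (leafDeriv g z) :=
  (HasFDerivAt.comp (f := fun x => g (x, z.2)) (g := fun x => f (x, Y z.2)) z.1
    (hf.hasFDerivAt hr hm) (hg.hasFDerivAt hr hz)).fderiv

end Calculus

/-! ### The inverse function theorem with parameters -/

section Inverse

variable {E F E' : Type u} [NormedAddCommGroup E] [NormedSpace ℝ E]
  [NormedAddCommGroup F] [NormedSpace ℝ F] [NormedAddCommGroup E'] [NormedSpace ℝ E']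

/-- The restriction to a horizontal slice of an open partial homeomorphism of the form
`(x, y) ↦ (G (x, y), y)`. -/
def sliceHomeomorph (e : OpenPartialHomeomorph (E × F) (E' × F))
    (he : ∀ z ∈ e.source, (e z).2 = z.2) (y : F) : OpenPartialHomeomorph E E' where
  toFun x := (e (x, y)).1
  invFun u := (e.symm (u, y)).1
  source := {x | (x, y) ∈ e.source}
  target := {u | (u, y) ∈ e.target}
  map_source' x hx := by
    have h : ((e (x, y)).1, y) = e (x, y) := Prod.ext rfl (he _ hx).symm
    simpa [h] using e.map_source hx
  map_target' u hu := by
    have h : ((e.symm (u, y)).1, y) = e.symm (u, y) := by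
      refine Prod.ext rfl ?_
      rw [← he _ (e.map_target hu), e.right_inv hu]
    simpa [h] using e.map_target hu
  left_inv' x hx := by
    have h : ((e (x, y)).1, y) = e (x, y) := Prod.ext rfl (he _ hx).symm
    rw [h, e.left_inv hx]
  right_inv' u hu := by
    have h : ((e.symm (u, y)).1, y) = e.symm (u, y) := by
      refine Prod.ext rfl ?_
      rw [← he _ (e.map_target hu), e.right_inv hu]
    rw [h, e.right_inv hu]
  open_source := e.open_source.preimage (Continuous.prodMk_left y)
  open_target := e.open_target.preimage (Continuous.prodMk_left y)
  continuousOn_toFun := continuous_fst.comp_continuousOn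
    (e.continuousOn.comp (Continuous.prodMk_left y).continuousOn fun _ h => h)
  continuousOn_invFun := continuous_fst.comp_continuousOn
    (e.continuousOn_symm.comp (Continuous.prodMk_left y).continuousOn fun _ h => h)

variable {r s : WithTop ℕ∞} {U : Set (E × F)} [CompleteSpace E] [CompleteSpace F]

/-- If `b ≠ 0`, the full derivative of `(x, y) ↦ (G (x, y), y)` is block triangular with the
invertible block `leafDeriv G` and an identity block, and the usual regularity of local inverses
applies. If `b = 0`, continuity of the inverse is all that is claimed. -/
theorem contDiffAt_symm_of_leafDeriv {b : WithTop ℕ∞} {G : E × F → E'}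
    {e : OpenPartialHomeomorph (E × F) (E' × F)} (hG : ContDiffOn ℝ b G e.source)
    (he : ∀ z ∈ e.source, e z = (G z, z.2))
    (hinv : ∀ z ∈ e.source, (leafDeriv G z).IsInvertible) :
    ContDiffOn ℝ b e.symm e.target := by
  intro u hu
  refine ContDiffAt.contDiffWithinAt ?_
  rcases eq_or_ne b 0 with rfl | hb
  · rw [contDiffAt_zero]
    exact ⟨e.target, e.open_target.mem_nhds hu, e.continuousOn_symm⟩
  have hz := e.map_target hu
  have hGz : ContDiffAt ℝ b G (e.symm u) := hG.contDiffAt (e.open_source.mem_nhds hz)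
  have hev : e =ᶠ[𝓝 (e.symm u)] fun z => (G z, z.2) := by
    filter_upwards [e.open_source.mem_nhds hz] with z hz using he z hz
  obtain ⟨A, hA⟩ := hinv _ hz
  have hd := (hGz.differentiableAt hb).hasFDerivAt
  set D := fderiv ℝ G (e.symm u)
  have hDA : ∀ x, D (x, 0) = A x := fun x => by
    have h1 : HasFDerivAt (fun x => G (x, (e.symm u).2)) (D.comp (.inl ℝ E F)) (e.symm u).1 :=
      HasFDerivAt.comp (g := G) (f := fun x => (x, (e.symm u).2)) (e.symm u).1 hd
        (hasFDerivAt_prodMk_left _ _)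
    have h2 : leafDeriv G (e.symm u) = D.comp (.inl ℝ E F) := h1.fderiv
    have h3 : (A : E →L[ℝ] E') = D.comp (.inl ℝ E F) := hA.trans h2
    exact (DFunLike.congr_fun h3 x).symm
  have hDs : ∀ z : E × F, D z = A z.1 + D (0, z.2) := fun z => by
    rw [← hDA, ← map_add]; simp
  -- The inverse of the block triangular derivative is `(u, y) ↦ (A⁻¹ (u - D (0, y)), y)`.
  let L : (E × F) ≃L[ℝ] (E' × F) := ContinuousLinearEquiv.equivOfInverse
    (D.prod (.snd ℝ E F))
    (((A.symm : E' →L[ℝ] E).comp ((ContinuousLinearMap.fst ℝ E' F) -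
      D.comp ((ContinuousLinearMap.inr ℝ E F).comp (.snd ℝ E' F)))).prod (.snd ℝ E' F))
    (fun z => by
      refine Prod.ext ?_ rfl
      change A.symm (D z - D (0, z.2)) = z.1
      rw [hDs z, add_sub_cancel_right, A.symm_apply_apply])
    (fun w => by
      refine Prod.ext ?_ rfl
      change D (A.symm (w.1 - D (0, w.2)), w.2) = w.1
      rw [hDs, A.apply_symm_apply, sub_add_cancel])
  refine e.contDiffAt_symm (f₀' := L) hu ?_ ?_
  · exact (hd.prodMk hasFDerivAt_snd).congr_of_eventuallyEq hev
  · exact (hGz.prodMk contDiffAt_snd).congr_of_eventuallyEq hev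

/-- On each slice the derivative of the inverse is the operator inverse of `leafDeriv G` at the
preimage. Operator inversion is smooth, so control of `q` leaf derivatives of the inverse map gives
control of `q` leaf derivatives of its leaf derivative, that is, of `q + 1` in all. -/
theorem IsClassCrs.inverse {G : E × F → E'} {e : OpenPartialHomeomorph (E × F) (E' × F)}
    (hr : 1 ≤ r) (hG : IsClassCrs r s G e.source) (he : ∀ z ∈ e.source, e z = (G z, z.2))
    (hinv : ∀ z ∈ e.source, (leafDeriv G z).IsInvertible) :
    IsClassCrs r s (fun u => (e.symm u).1) e.target := by
  have he2 : ∀ z ∈ e.source, (e z).2 = z.2 := fun z hz => by rw [he z hz]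
  have hs2 : ∀ u ∈ e.target, (e.symm u).2 = u.2 := fun u hu => by
    rw [← he2 _ (e.map_target hu), e.right_inv hu]
  have hslice : ∀ u ∈ e.target, ∀ A : E ≃L[ℝ] E', (A : E →L[ℝ] E') = leafDeriv G (e.symm u) →
      HasFDerivAt (sliceHomeomorph e he2 u.2) (A : E →L[ℝ] E')
        ((sliceHomeomorph e he2 u.2).symm u.1) := fun u hu A hA => by
    have hz := e.map_target hu
    have h := hG.hasFDerivAt hr hz
    rw [← hA] at h
    rw [hs2 u hu] at h
    refine h.congr_of_eventuallyEq ?_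
    filter_upwards [eventually_leaf_mem e.open_source hz] with x hx
    rw [hs2 u hu] at hx
    change (e (x, u.2)).1 = _
    rw [he _ hx]
  have hder : ∀ u ∈ e.target, ∀ A : E ≃L[ℝ] E', (A : E →L[ℝ] E') = leafDeriv G (e.symm u) →
      HasFDerivAt (fun x => (e.symm (x, u.2)).1) (A.symm : E' →L[ℝ] E) u.1 := fun u hu A hA =>
    (sliceHomeomorph e he2 u.2).hasFDerivAt_symm hu (hslice u hu A hA)
  have hC : ∀ b : WithTop ℕ∞, ContDiffOn ℝ b G e.source →
      ContDiffOn ℝ b (fun u => (e.symm u).1) e.target := fun b hb =>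
    contDiff_fst.comp_contDiffOn (contDiffAt_symm_of_leafDeriv hb he hinv)
  refine .mk' (hC s hG.1) (fun u hu => ?_) fun q j hq hj => ?_
  · obtain ⟨A, hA⟩ := hinv _ (e.map_target hu)
    refine (sliceHomeomorph e he2 u.2).contDiffAt_symm hu (hslice u hu A hA) ?_
    have h := hG.2.1 _ (e.map_target hu)
    rw [hs2 u hu] at h
    refine h.congr_of_eventuallyEq ?_
    filter_upwards [eventually_leaf_mem e.open_source (e.map_target hu)] with x hx
    rw [hs2 u hu] at hx
    change (e (x, u.2)).1 = _
    rw [he _ hx]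
  · induction q with
    | zero => exact hC j (hG.leafContDiffOn hq hj).contDiffOn
    | succ q ih =>
      have hqj : ((q + j : ℕ) : WithTop ℕ∞) ≤ r := le_trans (by exact_mod_cast (by omega)) hq
      refine ⟨(ih hqj).contDiffOn, fun u hu => ?_, ?_⟩
      · obtain ⟨A, hA⟩ := hinv _ (e.map_target hu)
        exact (hder u hu A hA).differentiableAt
      have h1 : LeafContDiffOn j q (fun u : E' × F => leafDeriv G ((e.symm u).1, u.2)) e.target :=
        LeafContDiffOn.comp (Y := fun y => y) e.open_target (hG.leafContDiffOn hq hj).2.2 (ih hqj)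
          contDiff_snd.contDiffOn fun u hu => by
            rw [← hs2 u hu]; exact e.map_target hu
      have hO : IsOpen {A : E →L[ℝ] E' | A.IsInvertible} :=
        ContinuousLinearEquiv.isOpen
      refine .congr e.open_target (LeafContDiffOn.contDiffOn_comp
        (f := ContinuousLinearMap.inverse) e.open_target hO ?_ ?_ h1 ?_) fun u hu => ?_
      · rintro _ ⟨A, rfl⟩
        exact (contDiffAt_map_inverse A).contDiffWithinAt
      · exact_mod_cast le_top
      · intro u hu
        have := hinv _ (e.map_target hu)
        rwa [← Prod.mk.eta (p := e.symm u), hs2 u hu] at this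
      · obtain ⟨A, hA⟩ := hinv _ (e.map_target hu)
        have h2 : leafDeriv (fun u => (e.symm u).1) u = A.symm := (hder u hu A hA).fderiv
        rw [h2]
        have h3 : ((e.symm u).1, u.2) = e.symm u := Prod.ext rfl (hs2 u hu).symm
        simp only [h3, ← hA, ContinuousLinearMap.inverse_equiv]

/-- No derivative in `y` is available, so the usual inverse function theorem cannot be applied to
`(x, y) ↦ (G (x, y), y)`. Continuity of the leaf derivative makes all slices near `z₀` approximately
linear, with the same linear map `A` and the same constant `c`, on a common ball. This gives
injectivity slice by slice, and a surjectivity onto balls that is uniform in `y` and hence makes the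
total map open. -/
theorem exists_openPartialHomeomorph_of_leafDeriv {G : E × F → E'} (hU : IsOpen U)
    (hG : ContinuousOn G U) (hd : ∀ z ∈ U, DifferentiableAt ℝ (fun x => G (x, z.2)) z.1)
    (hG' : ContinuousOn (leafDeriv G) U) {z₀ : E × F} (hz₀ : z₀ ∈ U)
    (hinv : (leafDeriv G z₀).IsInvertible) :
    ∃ e : OpenPartialHomeomorph (E × F) (E' × F), z₀ ∈ e.source ∧ e.source ⊆ U ∧
      (∀ z, e z = (G z, z.2)) ∧ ∀ z ∈ e.source, (leafDeriv G z).IsInvertible := by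
  obtain ⟨A, hA⟩ := hinv
  set K := ‖(A.symm : E' →L[ℝ] E)‖₊
  have hK : Subsingleton E ∨ 0 < K := A.subsingleton_or_nnnorm_symm_pos
  -- Half of the threshold `‖A⁻¹‖⁻¹` below which approximate linearity forces injectivity and
  -- surjectivity onto balls. If `E` is trivial, then `K = 0` and `c = 0`, a case treated
  -- separately.
  set c : NNReal := K⁻¹ / 2
  have hc : Subsingleton E ∨ c < K⁻¹ := hK.imp id fun h => by
    exact NNReal.half_lt_self (inv_pos.2 h).ne'
  have hcont : ContinuousAt (leafDeriv G) z₀ := hG'.continuousAt (hU.mem_nhds hz₀)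
  have h1 : ∀ᶠ z in 𝓝 z₀, ‖leafDeriv G z - A‖ ≤ c := by
    rcases hK with hE | hK
    · refine Eventually.of_forall fun z => ?_
      have : leafDeriv G z - A = 0 := by ext x; simp [Subsingleton.elim x 0]
      rw [this, norm_zero]; positivity
    · have h0 : (0 : ℝ) < c := by
        have : 0 < c := half_pos (inv_pos.2 hK)
        exact_mod_cast this
      have h3 : ContinuousAt (fun z => ‖leafDeriv G z - (A : E →L[ℝ] E')‖) z₀ :=
        (hcont.sub continuousAt_const).norm
      refine (h3.eventually_lt_const (by simpa [← hA] using h0)).mono fun z hz => hz.le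
  have h2 : ∀ᶠ z in 𝓝 z₀, (leafDeriv G z).IsInvertible := by
    refine hcont.eventually_mem (ContinuousLinearEquiv.isOpen.mem_nhds ⟨A, hA⟩)
  have h3 : ∀ᶠ z in 𝓝 z₀, z ∈ U := hU.mem_nhds hz₀
  obtain ⟨z₁, z₂⟩ := z₀
  have h4 := h1.and (h2.and h3)
  rw [nhds_prod_eq, Filter.eventually_iff, mem_prod_iff] at h4
  obtain ⟨B₀, hB₀, V₀, hV₀, hBV⟩ := h4
  obtain ⟨ε, hε, hB⟩ := Metric.mem_nhds_iff.1 hB₀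
  obtain ⟨V, hVV, hV, hzV⟩ := mem_nhds_iff.1 hV₀
  set B := Metric.ball z₁ ε
  have hN : ∀ x ∈ B, ∀ y ∈ V, ‖leafDeriv G (x, y) - A‖ ≤ c ∧
      (leafDeriv G (x, y)).IsInvertible ∧ (x, y) ∈ U := fun x hx y hy =>
    hBV (mk_mem_prod (hB hx) (hVV hy))
  have happ : ∀ y ∈ V, ApproximatesLinearOn (fun x => G (x, y)) (A : E →L[ℝ] E') B c := by
    intro y hy
    refine LipschitzOnWith.approximatesLinearOn ?_
    refine (convex_ball z₁ ε).lipschitzOnWith_of_nnnorm_hasFDerivWithin_le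
      (f' := fun x => leafDeriv G (x, y) - (A : E →L[ℝ] E')) (fun x hx => ?_) fun x hx => ?_
    · exact ((hd _ (hN x hx y hy).2.2).hasFDerivAt.sub A.hasFDerivAt).hasFDerivWithinAt
    · exact_mod_cast (hN x hx y hy).1
  have hBVo : IsOpen (B ×ˢ V) := Metric.isOpen_ball.prod hV
  have hGc : ContinuousOn (fun z : E × F => (G z, z.2)) (B ×ˢ V) :=
    (hG.mono fun z hz => (hN z.1 hz.1 z.2 hz.2).2.2).prodMk continuousOn_snd
  have hinj : InjOn (fun z : E × F => (G z, z.2)) (B ×ˢ V) := by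
    rintro ⟨x, y⟩ ⟨hx, hy⟩ ⟨x', y'⟩ ⟨hx', _⟩ h
    obtain ⟨h, rfl⟩ := Prod.ext_iff.1 h
    exact Prod.ext ((happ y hy).injOn hc hx hx' h) rfl
  have hopen : ∀ z ∈ B ×ˢ V, 𝓝 (G z, z.2) ≤ map (fun z : E × F => (G z, z.2)) (𝓝 z) := by
    rintro ⟨x, y⟩ ⟨hx, hy⟩ S hS
    rw [mem_map] at hS
    obtain ⟨T, hT, W, hW, hTW⟩ := mem_nhds_prod_iff.1 (inter_mem hS (hBVo.mem_nhds ⟨hx, hy⟩))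
    obtain ⟨δ, hδ, hδT⟩ := Metric.nhds_basis_closedBall.mem_iff.1 hT
    have hyW := mem_of_mem_nhds hW
    have hxy : ∀ x' ∈ Metric.closedBall x δ, ∀ y' ∈ W, (G (x', y'), y') ∈ S ∧ x' ∈ B ∧ y' ∈ V :=
      fun x' hx' y' hy' => hTW (mk_mem_prod (hδT hx') hy')
    have hxx : x ∈ Metric.closedBall x δ := Metric.mem_closedBall_self hδ.le
    have hGy : ContinuousAt (fun u : E' × F => (u.1, G (x, u.2))) (G (x, y), y) := by
      refine continuousAt_fst.prodMk ?_
      have h5 : ContinuousAt G (x, y) := hG.continuousAt (hU.mem_nhds (hN x hx y hy).2.2)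
      exact ContinuousAt.comp (f := fun u : E' × F => (x, u.2)) (x := (G (x, y), y)) h5
        (continuousAt_const.prodMk continuousAt_snd)
    -- To reach `u` one solves `G (x', u.2) = u.1` in the slice of `u.2`, with `x'` in the ball of
    -- radius `δ` at `x`. The quantitative surjectivity allows this as soon as the value at the
    -- centre is within `(K⁻¹ - c) δ` of `u.1`, which holds near the base point by joint continuity
    -- of `G`.
    have hdist : ∀ᶠ u : E' × F in 𝓝 (G (x, y), y),
        dist u.1 (G (x, u.2)) ≤ ((K : ℝ)⁻¹ - c) * δ := by
      rcases hK with hE | hK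
      · refine Eventually.of_forall fun u => ?_
        have : Subsingleton E' := A.symm.toEquiv.subsingleton
        rw [Subsingleton.elim u.1 (G (x, u.2)), dist_self]
        have : (c : ℝ) ≤ (K : ℝ)⁻¹ := by
          have : c ≤ K⁻¹ := half_le_self (by positivity)
          exact_mod_cast this
        exact mul_nonneg (sub_nonneg.2 this) hδ.le
      · have h0 : 0 < ((K : ℝ)⁻¹ - c) * δ := by
          have hK' : (0 : ℝ) < (K : ℝ)⁻¹ := by positivity
          have : (c : ℝ) = (K : ℝ)⁻¹ / 2 := by simp [c]
          rw [this]
          exact mul_pos (by linarith) hδ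
        have h6 : ContinuousAt (fun u : E' × F => dist u.1 (G (x, u.2))) (G (x, y), y) :=
          continuous_dist.continuousAt.comp hGy
        exact (h6.eventually_lt_const (by simpa using h0)).mono fun _ h => h.le
    filter_upwards [hdist, continuousAt_snd.eventually_mem hW] with u hu huW
    have hyV := (hxy x hxx _ huW).2.2
    obtain ⟨x', hx', hx'u⟩ := (happ u.2 hyV).surjOn_closedBall_of_nonlinearRightInverse
      A.toNonlinearRightInverse hδ.le (fun x' hx' => (hxy x' hx' _ huW).2.1) hu
    have := (hxy x' hx' _ huW).1
    simp only at hx'u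
    rwa [hx'u] at this
  let e₀ : PartialEquiv (E × F) (E' × F) := hinj.toPartialEquiv
  have hmap : IsOpenMap (e₀.source.domRestrict e₀) := by
    rw [isOpenMap_iff_nhds_le]
    intro z
    have : map (e₀.source.domRestrict e₀) (𝓝 z) =
        map (fun z : E × F => (G z, z.2)) (𝓝 (z : E × F)) := by
      rw [← map_nhds_subtype_coe_eq_nhds z.2 (hBVo.mem_nhds z.2), Filter.map_map]
      rfl
    rw [this]
    exact hopen z z.2
  refine ⟨OpenPartialHomeomorph.ofContinuousOpenRestrict e₀ hGc hmap hBVo, ?_, ?_, ?_, ?_⟩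
  · exact ⟨Metric.mem_ball_self hε, hzV⟩
  · exact fun z hz => (hN z.1 hz.1 z.2 hz.2).2.2
  · exact fun z => rfl
  · exact fun z hz => (hN z.1 hz.1 z.2 hz.2).2.1

end Inverse

/-! ### Foliated maps and flow charts -/

section FoliatedMaps

theorem IsClassCrs.of_leaf {E F G : Type u} [NormedAddCommGroup E] [NormedSpace ℝ E]
    [NormedAddCommGroup F] [NormedSpace ℝ F] [NormedAddCommGroup G] [NormedSpace ℝ G]
    {r s : WithTop ℕ∞} {U : Set (E × F)} (hU : IsOpen U) {α : E → G} (hα : ContDiff ℝ ω α) :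
    IsClassCrs r s (fun z => α z.1) U :=
  .mk' ((hα.of_le le_top).comp_contDiffOn contDiff_fst.contDiffOn)
    (fun _ _ => (hα.of_le le_top).contDiffAt)
    fun _ _ _ _ => (LeafContDiffOn.fst hU).contDiffOn_comp hU isOpen_univ
      (hα.of_le le_top).contDiffOn (by exact_mod_cast le_top) (mapsTo_univ _ _)

variable {k l : ℕ} {r s : WithTop ℕ∞} {g g₁ g₂ : Eu k × Eu l → Eu k × Eu l}
  {U U₁ U₂ : Set (Eu k × Eu l)}

theorem IsFoliatedOn.locally (h : IsFoliatedOn r s g U) : IsLocallyFoliatedOn r s g U :=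
  fun z _ => ⟨univ, isOpen_univ, mem_univ z, by simpa using h⟩

theorem IsFoliatedOn.comp (h₂ : IsFoliatedOn r s g₂ U₂) (h₁ : IsFoliatedOn r s g₁ U₁)
    (hU : IsOpen U) (hU₁ : U ⊆ U₁) (hm : MapsTo g₁ U U₂) : IsFoliatedOn r s (g₂ ∘ g₁) U := by
  obtain ⟨X₁, Y₁, hX₁, hY₁, hg₁⟩ := h₁
  obtain ⟨X₂, Y₂, hX₂, hY₂, hg₂⟩ := h₂
  have hm' : ∀ z ∈ U, (X₁ z, Y₁ z.2) ∈ U₂ := fun z hz => hg₁ z (hU₁ hz) ▸ hm hz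
  refine ⟨fun z => X₂ (X₁ z, Y₁ z.2), Y₂ ∘ Y₁, hX₂.comp hU (hX₁.mono hU₁) ?_ hm', ?_, ?_⟩
  · exact hY₁.comp contDiff_snd.contDiffOn fun z hz => mem_image_of_mem _ (hU₁ hz)
  · refine hY₂.comp (hY₁.mono (image_mono hU₁)) ?_
    rintro _ ⟨z, hz, rfl⟩
    exact mem_image_of_mem Prod.snd (hm' z hz)
  · intro z hz
    simp only [Function.comp_apply]
    rw [hg₂ _ (hm hz), hg₁ z (hU₁ hz)]

theorem IsLocallyFoliatedOn.comp (h₂ : IsLocallyFoliatedOn r s g₂ U₂)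
    (h₁ : IsLocallyFoliatedOn r s g₁ U₁) (hg₁ : ContinuousOn g₁ U)
    (hU : IsOpen U) (hU₁ : U ⊆ U₁) (hm : MapsTo g₁ U U₂) :
    IsLocallyFoliatedOn r s (g₂ ∘ g₁) U := by
  intro z hz
  obtain ⟨V₁, hV₁, hzV₁, h₁⟩ := h₁ z (hU₁ hz)
  obtain ⟨V₂, hV₂, hzV₂, h₂⟩ := h₂ _ (hm hz)
  have ho : IsOpen (U ∩ g₁ ⁻¹' V₂) := hg₁.isOpen_inter_preimage hU hV₂
  refine ⟨V₁ ∩ (U ∩ g₁ ⁻¹' V₂), hV₁.inter ho, ⟨hzV₁, hz, hzV₂⟩, ?_⟩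
  exact h₂.comp h₁ (hU.inter (hV₁.inter ho)) (fun y hy => ⟨hU₁ hy.1, hy.2.1⟩)
    fun y hy => ⟨hm hy.1, hy.2.2.2⟩

theorem IsLocallyFoliatedOn.congr (h : IsLocallyFoliatedOn r s g U) (hg : EqOn g g₁ U) :
    IsLocallyFoliatedOn r s g₁ U := fun z hz =>
  let ⟨V, hV, hzV, X, Y, hX, hY, h⟩ := h z hz
  ⟨V, hV, hzV, X, Y, hX, hY, fun z hz => by rw [← hg hz.1, h z hz]⟩

theorem IsLocallyFoliatedOn.fst (h : IsLocallyFoliatedOn r s g U) (hU : IsOpen U) :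
    IsClassCrs r s (fun z => (g z).1) U := .of_local fun z hz => by
  obtain ⟨V, hV, hzV, X, Y, hX, hY, h⟩ := h z hz
  exact ⟨V, hV, hzV, hX.congr (hU.inter hV) fun z hz => by rw [h z hz]⟩

theorem IsLocallyFoliatedOn.snd (h : IsLocallyFoliatedOn r s g U) {z : Eu k × Eu l} (hz : z ∈ U) :
    ∃ Y : Eu l → Eu l, ∃ V, IsOpen V ∧ z ∈ V ∧ ContDiffOn ℝ s Y (Prod.snd '' (U ∩ V)) ∧
      ∀ z' ∈ U ∩ V, (g z').2 = Y z'.2 := by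
  obtain ⟨V, hV, hzV, X, Y, hX, hY, h⟩ := h z hz
  exact ⟨Y, V, hV, hzV, hY, fun z hz => by rw [h z hz]⟩

end FoliatedMaps

namespace FoliatedAtlas

variable {k l : ℕ} {r s : WithTop ℕ∞} {W : Type u} [TopologicalSpace W]
  {A : FoliatedAtlas k l r s W} {φ χ ψ : OpenPartialHomeomorph W (Eu k × Eu l)}

theorem isFlowChart_of_mem (hφ : φ ∈ A.charts) : A.IsFlowChart φ := fun ψ hψ =>
  ⟨(A.compat φ hφ ψ hψ).locally, (A.compat ψ hψ φ hφ).locally⟩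

theorem locallyFoliated_trans {D : Set (Eu k × Eu l)} (hD : IsOpen D)
    (h₁ : IsLocallyFoliatedOn r s (φ.symm.trans χ) (φ.symm.trans χ).source)
    (h₂ : IsLocallyFoliatedOn r s (χ.symm.trans ψ) (χ.symm.trans ψ).source)
    (hDφ : D ⊆ (φ.symm.trans ψ).source) (hDχ : D ⊆ (φ.symm.trans χ).source) :
    IsLocallyFoliatedOn r s (φ.symm.trans ψ) D := by
  refine (h₂.comp (U := D) h₁ ((φ.symm.trans χ).continuousOn.mono hDχ) hD hDχ ?_).congr ?_
  · intro z hz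
    have h1 := hDφ hz
    have h2 := hDχ hz
    simp only [OpenPartialHomeomorph.trans_source, mem_inter_iff, mem_preimage,
      OpenPartialHomeomorph.symm_source, OpenPartialHomeomorph.coe_trans, Function.comp_apply]
      at h1 h2 ⊢
    exact ⟨χ.map_source h2.2, by rw [χ.left_inv h2.2]; exact h1.2⟩
  · intro z hz
    have h2 := hDχ hz
    simp only [OpenPartialHomeomorph.trans_source, mem_inter_iff, mem_preimage] at h2
    simp [χ.left_inv h2.2]

/-- Flow charts are compared with the atlas only, so two of them are compared by passing through an
atlas chart at the point. This chart varies with the point, which is why the foliated form is only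
local. -/
theorem IsFlowChart.locallyFoliated (hφ : A.IsFlowChart φ) (hψ : A.IsFlowChart ψ) :
    IsLocallyFoliatedOn r s (φ.symm.trans ψ) (φ.symm.trans ψ).source := by
  intro z hz
  obtain ⟨χ, hχ, hzχ⟩ := A.cover (φ.symm z)
  have hz' : z ∈ (φ.symm.trans χ).source := ⟨hz.1, hzχ⟩
  have ho : IsOpen ((φ.symm.trans ψ).source ∩ (φ.symm.trans χ).source) :=
    (φ.symm.trans ψ).open_source.inter (φ.symm.trans χ).open_source
  obtain ⟨V, hV, hzV, h⟩ := locallyFoliated_trans ho (hφ χ hχ).1 (hψ χ hχ).2 inter_subset_left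
    inter_subset_right z ⟨hz, hz'⟩
  exact ⟨(φ.symm.trans χ).source ∩ V, (φ.symm.trans χ).open_source.inter hV, ⟨hz', hzV⟩,
    inter_assoc _ _ V ▸ h⟩

/-- Near `w` one transverse coordinate is a function `Y` of the other. This is what allows leaf
paths to be tested in any flow chart. -/
theorem IsFlowChart.exists_nhds_snd_eq (hφ : A.IsFlowChart φ) (hψ : A.IsFlowChart ψ) {w : W}
    (hw : w ∈ φ.source) (hw' : w ∈ ψ.source) :
    ∃ N ∈ 𝓝 w, ∀ w₁ ∈ N, ∀ w₂ ∈ N, (φ w₁).2 = (φ w₂).2 → (ψ w₁).2 = (ψ w₂).2 := by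
  obtain ⟨Y, V, hV, hzV, -, h⟩ := (hφ.locallyFoliated hψ).snd (z := φ w)
    ⟨φ.map_source hw, by simpa [φ.left_inv hw] using hw'⟩
  refine ⟨(φ.source ∩ ψ.source) ∩ φ ⁻¹' V, inter_mem (inter_mem (φ.open_source.mem_nhds hw)
    (ψ.open_source.mem_nhds hw')) ((φ.continuousAt hw).preimage_mem_nhds (hV.mem_nhds hzV)), ?_⟩
  have key : ∀ w₁ ∈ (φ.source ∩ ψ.source) ∩ φ ⁻¹' V, (ψ w₁).2 = Y (φ w₁).2 := by
    intro w₁ hw₁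
    rw [← h (φ w₁) ⟨⟨φ.map_source hw₁.1.1, by simpa [φ.left_inv hw₁.1.1] using hw₁.1.2⟩, hw₁.2⟩]
    simp [φ.left_inv hw₁.1.1]
  intro w₁ hw₁ w₂ hw₂ h12
  rw [key w₁ hw₁, key w₂ hw₂, h12]

theorem IsLeafPath.eventually_eq {γ : I → W} (hγ : A.IsLeafPath γ) (hφ : A.IsFlowChart φ) {t : I}
    (ht : γ t ∈ φ.source) : ∀ᶠ t' in 𝓝 t, (φ (γ t')).2 = (φ (γ t)).2 := by
  obtain ⟨χ, hχ, htχ⟩ := A.cover (γ t)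
  obtain ⟨N, hN, h⟩ := (isFlowChart_of_mem hχ).exists_nhds_snd_eq hφ htχ ht
  filter_upwards [hγ.2 χ hχ t htχ, hγ.1.continuousAt.preimage_mem_nhds hN] with t' h1 h2
  exact h _ h2 _ (mem_of_mem_nhds hN) h1

theorem isLeafPath_of_eventually_eq {γ : I → W} (hγ : Continuous γ)
    (h : ∀ t, ∃ φ, A.IsFlowChart φ ∧ γ t ∈ φ.source ∧ ∀ᶠ t' in 𝓝 t, (φ (γ t')).2 = (φ (γ t)).2) :
    A.IsLeafPath γ := by
  refine ⟨hγ, fun χ hχ t ht => ?_⟩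
  obtain ⟨φ, hφ, htφ, hev⟩ := h t
  obtain ⟨N, hN, h⟩ := hφ.exists_nhds_snd_eq (isFlowChart_of_mem hχ) htφ ht
  filter_upwards [hev, hγ.continuousAt.preimage_mem_nhds hN] with t' h1 h2
  exact h _ h2 _ (mem_of_mem_nhds hN) h1

theorem IsFlowChart.isLeafPath_plaque (hφ : A.IsFlowChart φ) {x : I → Eu k} (hx : Continuous x)
    {y : Eu l} (h : ∀ t, (x t, y) ∈ φ.target) : A.IsLeafPath fun t => φ.symm (x t, y) := by
  refine isLeafPath_of_eventually_eq ?_ fun t => ⟨φ, hφ, φ.map_target (h t), ?_⟩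
  · exact φ.continuousOn_symm.comp_continuous (hx.prodMk continuous_const) h
  · exact .of_forall fun t' => by rw [φ.right_inv (h t'), φ.right_inv (h t)]

/-- A locally constant function is constant on a connected set; as long as a leaf path stays in one
flow chart it stays in one plaque. -/
theorem IsLeafPath.snd_eq_of_isPreconnected {γ : I → W} (hγ : A.IsLeafPath γ)
    (hφ : A.IsFlowChart φ) {J : Set I} (hJ : IsPreconnected J) (h : ∀ t ∈ J, γ t ∈ φ.source)
    {t t' : I} (ht : t ∈ J) (ht' : t' ∈ J) : (φ (γ t)).2 = (φ (γ t')).2 :=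
  hJ.induction₂ (fun t t' => (φ (γ t)).2 = (φ (γ t')).2)
    (fun x hx => ((hγ.eventually_eq hφ (h x hx)).filter_mono nhdsWithin_le_nhds).mono
      fun _ h => h.symm) (fun _ _ _ _ _ _ => Eq.trans) (fun _ _ _ _ => Eq.symm) ht ht'

/-! ### Changes of the leaf coordinate -/

/-- The leafwise derivative at `w` of the change of charts from `φ` to `ψ`. -/
def leafTransition (φ ψ : OpenPartialHomeomorph W (Eu k × Eu l)) (w : W) : Eu k →L[ℝ] Eu k :=
  leafDeriv (fun z => (ψ (φ.symm z)).1) (φ w)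

theorem IsFlowChart.classCrs_fst (hφ : A.IsFlowChart φ) (hψ : A.IsFlowChart ψ) :
    IsClassCrs r s (fun z => (ψ (φ.symm z)).1) (φ.symm.trans ψ).source :=
  (hφ.locallyFoliated hψ).fst (φ.symm.trans ψ).open_source

/-- A function that is of class `C^{r,s}` in the chart `χ` is so in the chart `φ`. -/
theorem IsFlowChart.classCrs_change {G : Type} [NormedAddCommGroup G] [NormedSpace ℝ G]
    (hφ : A.IsFlowChart φ) (hχ : A.IsFlowChart χ) {h : W → G} {O : Set W} (hO : IsOpen O)
    (hh : IsClassCrs r s (fun z => h (χ.symm z)) (χ.target ∩ χ.symm ⁻¹' O)) :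
    IsClassCrs r s (fun z => h (φ.symm z)) ((φ.symm.trans χ).source ∩ φ.symm ⁻¹' O) := by
  have hD : IsOpen ((φ.symm.trans χ).source ∩ φ.symm ⁻¹' O) := by
    exact (φ.continuousOn_symm.mono fun z hz => hz.1).isOpen_inter_preimage
      (φ.symm.trans χ).open_source hO
  refine .of_local fun z hz => ?_
  obtain ⟨V, hV, hzV, X, Y, hX, hY, hg⟩ := (hφ.locallyFoliated hχ) z hz.1
  have hg' : ∀ z' ∈ ((φ.symm.trans χ).source ∩ φ.symm ⁻¹' O) ∩ V,
      (X z', Y z'.2) = χ (φ.symm z') := fun z' hz' => (hg z' ⟨hz'.1.1, hz'.2⟩).symm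
  have hsub : ((φ.symm.trans χ).source ∩ φ.symm ⁻¹' O) ∩ V ⊆ (φ.symm.trans χ).source ∩ V :=
    fun z' hz' => ⟨hz'.1.1, hz'.2⟩
  refine ⟨V, hV, hzV, (hh.comp (hD.inter hV) (hX.mono hsub) (Y := Y) ?_ ?_).congr
    (hD.inter hV) ?_⟩
  · exact hY.comp contDiff_snd.contDiffOn fun z' hz' => mem_image_of_mem _ (hsub hz')
  · intro z' hz'
    have h1 : φ.symm z' ∈ χ.source := hz'.1.1.2
    rw [hg' z' hz']
    exact ⟨χ.map_source h1, by simpa only [mem_preimage, χ.left_inv h1] using hz'.1.2⟩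
  · intro z' hz'
    have h1 : φ.symm z' ∈ χ.source := hz'.1.1.2
    simp only [hg' z' hz', χ.left_inv h1]

/-- A change of charts sends the plaque `y = const` into the plaque over `Y y`, so leaf derivatives
obey the chain rule with only the leaf block `leafTransition`. -/
theorem IsFlowChart.leafDeriv_change {G : Type} [NormedAddCommGroup G] [NormedSpace ℝ G]
    (hr : 1 ≤ r) (hφ : A.IsFlowChart φ) (hχ : A.IsFlowChart χ) {h : W → G} {w : W}
    {D : Set (Eu k × Eu l)} (hh : IsClassCrs r s (fun z => h (χ.symm z)) D)
    (hD : χ w ∈ D) (hw : w ∈ φ.source) (hwχ : w ∈ χ.source) :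
    leafDeriv (fun z => h (φ.symm z)) (φ w) =
      (leafDeriv (fun z => h (χ.symm z)) (χ w)).comp (leafTransition φ χ w) := by
  have hz : φ w ∈ (φ.symm.trans χ).source := ⟨φ.map_source hw, by
    simpa [φ.left_inv hw] using hwχ⟩
  obtain ⟨V, hV, hzV, X, Y, hX, hY, hg⟩ := (hφ.locallyFoliated hχ) _ hz
  have ho : IsOpen ((φ.symm.trans χ).source ∩ V) := (φ.symm.trans χ).open_source.inter hV
  have hg' : ∀ z' ∈ (φ.symm.trans χ).source ∩ V, (X z', Y z'.2) = χ (φ.symm z') :=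
    fun z' hz' => (hg z' hz').symm
  have hw1 : (X (φ w), Y (φ w).2) = χ w := by rw [hg' _ ⟨hz, hzV⟩, φ.left_inv hw]
  have e1 : EqOn (fun z => h (φ.symm z)) (fun z => h (χ.symm (X z, Y z.2)))
      ((φ.symm.trans χ).source ∩ V) := fun z' hz' => by
    have h1 : φ.symm z' ∈ χ.source := hz'.1.2
    simp only [hg' z' hz', χ.left_inv h1]
  have e2 : EqOn (fun z => (χ (φ.symm z)).1) X ((φ.symm.trans χ).source ∩ V) := fun z' hz' => by
    simp only [← hg' z' hz']
  rw [leafDeriv_congr ho e1 ⟨hz, hzV⟩, leafTransition, leafDeriv_congr ho e2 ⟨hz, hzV⟩]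
  have := leafDeriv_comp (Y := Y) hr hh hX ⟨hz, hzV⟩ (by rw [hw1]; exact hD)
  rw [hw1] at this
  exact this

theorem leafTransition_self {w : W} (hw : w ∈ φ.source) :
    leafTransition φ φ w = ContinuousLinearMap.id ℝ (Eu k) := by
  have : EqOn (fun z => (φ (φ.symm z)).1) Prod.fst φ.target := fun z hz => by
    simp only [φ.right_inv hz]
  rw [leafTransition, leafDeriv_congr φ.open_target this (φ.map_source hw)]
  exact (hasFDerivAt_id (𝕜 := ℝ) (φ w).1).fderiv

theorem IsFlowChart.leafTransition_comp (hr : 1 ≤ r) (hφ : A.IsFlowChart φ)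
    (hχ : A.IsFlowChart χ) (hψ : A.IsFlowChart ψ) {w : W}
    (hw : w ∈ φ.source) (hwχ : w ∈ χ.source) (hwψ : w ∈ ψ.source) :
    leafTransition φ ψ w = (leafTransition χ ψ w).comp (leafTransition φ χ w) :=
  hφ.leafDeriv_change hr hχ (h := fun w => (ψ w).1) (hχ.classCrs_fst hψ)
    ⟨χ.map_source hwχ, by simpa [χ.left_inv hwχ] using hwψ⟩ hw hwχ

theorem IsFlowChart.leafTransition_bijective (hr : 1 ≤ r) (hφ : A.IsFlowChart φ)
    (hψ : A.IsFlowChart ψ) {w : W} (hw : w ∈ φ.source) (hwψ : w ∈ ψ.source) :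
    Function.Bijective (leafTransition φ ψ w) := by
  have h1 := hφ.leafTransition_comp hr hψ hφ hw hwψ hw
  have h2 := hψ.leafTransition_comp hr hφ hψ hwψ hw hwψ
  rw [leafTransition_self hw] at h1
  rw [leafTransition_self hwψ] at h2
  exact ⟨Function.LeftInverse.injective (g := leafTransition ψ φ w)
    fun x => (DFunLike.congr_fun h1 x).symm,
    Function.RightInverse.surjective (g := leafTransition ψ φ w)
    fun x => (DFunLike.congr_fun h2 x).symm⟩

/-! ### Rescaled flow charts -/

/-- The affine change of the leaf coordinate that maps the ball of radius `ε` at `x₀` onto the unit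
ball. -/
def rescale (l : ℕ) (x₀ : Eu k) {ε : ℝ} (hε : ε ≠ 0) : (Eu k × Eu l) ≃ₜ (Eu k × Eu l) :=
  ((Homeomorph.subRight x₀).trans (Homeomorph.smulOfNeZero ε⁻¹ (inv_ne_zero hε))).prodCongr
    (Homeomorph.refl (Eu l))

theorem rescale_apply {x₀ : Eu k} {ε : ℝ} (hε : ε ≠ 0) (z : Eu k × Eu l) :
    rescale l x₀ hε z = (ε⁻¹ • (z.1 - x₀), z.2) := rfl

theorem rescale_symm_apply {x₀ : Eu k} {ε : ℝ} (hε : ε ≠ 0) (z : Eu k × Eu l) :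
    (rescale l x₀ hε).symm z = (ε • z.1 + x₀, z.2) := by
  rw [Homeomorph.symm_apply_eq, rescale_apply]
  simp [smul_smul, inv_mul_cancel₀ hε]

theorem rescale_isFoliatedOn {x₀ : Eu k} {ε : ℝ} (hε : ε ≠ 0) :
    IsFoliatedOn r s (rescale l x₀ hε) univ :=
  ⟨fun z => ε⁻¹ • (z.1 - x₀), id,
    .of_leaf (α := fun x => ε⁻¹ • (x - x₀)) isOpen_univ (by fun_prop), contDiffOn_id,
    fun z _ => rescale_apply hε z⟩

theorem rescale_symm_isFoliatedOn {x₀ : Eu k} {ε : ℝ} (hε : ε ≠ 0) :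
    IsFoliatedOn r s (rescale l x₀ hε).symm univ :=
  ⟨fun z => ε • z.1 + x₀, id,
    .of_leaf (α := fun x => ε • x + x₀) isOpen_univ (by fun_prop), contDiffOn_id,
    fun z _ => rescale_symm_apply hε z⟩

/-- The restriction of a chart to the preimage of `ball x₀ ε × V`, rescaled to the unit ball. -/
def rescaledChart (φ : OpenPartialHomeomorph W (Eu k × Eu l)) (x₀ : Eu k) {ε : ℝ} (hε : ε ≠ 0)
    {V : Set (Eu l)} (hV : IsOpen V) : OpenPartialHomeomorph W (Eu k × Eu l) :=
  (φ.trans (OpenPartialHomeomorph.ofSet (Metric.ball x₀ ε ×ˢ V)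
    (Metric.isOpen_ball.prod hV))).transHomeomorph (rescale l x₀ hε)

section rescaledChart

variable {x₀ : Eu k} {ε : ℝ} (hε : ε ≠ 0) {V : Set (Eu l)} (hV : IsOpen V)

theorem rescaledChart_source : (rescaledChart φ x₀ hε hV).source =
    φ.source ∩ φ ⁻¹' (Metric.ball x₀ ε ×ˢ V) := rfl

theorem rescaledChart_apply (w : W) :
    rescaledChart φ x₀ hε hV w = (ε⁻¹ • ((φ w).1 - x₀), (φ w).2) := rfl

theorem rescaledChart_symm_apply (z : Eu k × Eu l) :
    (rescaledChart φ x₀ hε hV).symm z = φ.symm (ε • z.1 + x₀, z.2) := by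
  rw [← rescale_symm_apply hε z]
  rfl

theorem IsFlowChart.rescaledChart (hφ : A.IsFlowChart φ) :
    A.IsFlowChart (rescaledChart φ x₀ hε hV) := by
  set φ' := FoliatedAtlas.rescaledChart φ x₀ hε hV
  intro ψ hψ
  constructor
  · have hm : MapsTo (rescale l x₀ hε).symm (φ'.symm.trans ψ).source (φ.symm.trans ψ).source := by
      intro z hz
      rw [OpenPartialHomeomorph.trans_source, mem_inter_iff, mem_preimage,
        rescaledChart_symm_apply, ← rescale_symm_apply hε] at hz
      exact ⟨hz.1.2, hz.2⟩
    refine ((hφ ψ hψ).1.comp (rescale_symm_isFoliatedOn hε).locally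
      (rescale l x₀ hε).symm.continuous.continuousOn (φ'.symm.trans ψ).open_source
      (subset_univ _) hm).congr fun z _ => ?_
    simp [φ', rescaledChart_symm_apply, rescale_symm_apply]
  · refine ((rescale_isFoliatedOn hε).locally.comp (hφ ψ hψ).2
      ((ψ.symm.trans φ).continuousOn.mono ?_) (ψ.symm.trans φ').open_source ?_
      (mapsTo_univ _ _)).congr fun z _ => rfl
    all_goals exact fun z hz => ⟨hz.1, hz.2.1⟩

end rescaledChart

end FoliatedAtlas

/-! ### Flow-boxes of solenoids -/

namespace PreSolenoid

variable {k l : ℕ} {r s : WithTop ℕ∞} {S : Type u} [TopologicalSpace S] {P : PreSolenoid k l r s S}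
  {φ : OpenPartialHomeomorph P.W (Eu k × Eu l)}

/-- The segment from `x` to `x'` in the plaque is a leaf path, and `S` is saturated under leaf
paths. -/
theorem mem_range_of_plaque (hφ : P.foliation.IsFlowChart φ) {B : Set (Eu k)} (hB : Convex ℝ B)
    {y : Eu l} (h : ∀ x ∈ B, (x, y) ∈ φ.target) {x x' : Eu k} (hx : x ∈ B) (hx' : x' ∈ B)
    (hr : φ.symm (x, y) ∈ range P.ι) : φ.symm (x', y) ∈ range P.ι := by
  have hc : Continuous fun t : I => AffineMap.lineMap (k := ℝ) x x' (t : ℝ) :=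
    AffineMap.lineMap_continuous.comp continuous_subtype_val
  have hm : ∀ t : I, AffineMap.lineMap (k := ℝ) x x' (t : ℝ) ∈ B := fun t =>
    hB.lineMap_mem hx hx' t.2
  have := P.saturated _ (hφ.isLeafPath_plaque hc fun t => h _ (hm t))
  simpa using this (by simpa using hr)

/-- Take a small product of a ball and an open set in the target of `φ` and rescale the ball to the
unit ball. By saturation a plaque lies in `S` as soon as its centre does, so the trace of `S` is the
ball times `K`. The point `p` is at the centre, and the explicit form of `K` serves to decide later
which transverse values occur. -/
theorem exists_flowBox (hφ : P.foliation.IsFlowChart φ) {p : S} (hp : P.ι p ∈ φ.source)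
    {N : Set P.W} (hN : N ∈ 𝓝 (P.ι p)) :
    ∃ B : P.FlowBox, p ∈ B.transversal ∧ B.chart.source ⊆ φ.source ∩ N ∧
      (∀ w, (B.chart w).2 = (φ w).2) ∧ ∃ V, IsOpen V ∧ (φ (P.ι p)).2 ∈ V ∧
      (∀ y ∈ V, ((φ (P.ι p)).1, y) ∈ φ.target) ∧
      B.K = {y | y ∈ V ∧ φ.symm ((φ (P.ι p)).1, y) ∈ range P.ι} := by
  obtain ⟨x₀, hx₀⟩ : ∃ x₀, (φ (P.ι p)).1 = x₀ := ⟨_, rfl⟩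
  obtain ⟨y₀, hy₀⟩ : ∃ y₀, (φ (P.ι p)).2 = y₀ := ⟨_, rfl⟩
  have hxy : φ (P.ι p) = (x₀, y₀) := Prod.ext hx₀ hy₀
  have h1 : φ.target ∩ φ.symm ⁻¹' N ∈ 𝓝 (x₀, y₀) := by
    have ht : (x₀, y₀) ∈ φ.target := hxy ▸ φ.map_source hp
    refine inter_mem (φ.open_target.mem_nhds ht) ((φ.continuousAt_symm ht).preimage_mem_nhds ?_)
    rwa [← hxy, φ.left_inv hp]
  obtain ⟨B₀, hB₀, V₀, hV₀, hBV⟩ := mem_nhds_prod_iff.1 h1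
  obtain ⟨ε, hε, hB⟩ := Metric.mem_nhds_iff.1 hB₀
  obtain ⟨V, hVV, hV, hyV⟩ := mem_nhds_iff.1 hV₀
  have hBV' : ∀ x ∈ Metric.ball x₀ ε, ∀ y ∈ V, (x, y) ∈ φ.target ∩ φ.symm ⁻¹' N :=
    fun x hx y hy => hBV (mk_mem_prod (hB hx) (hVV hy))
  have hball : ∀ x : Eu k, x ∈ Metric.ball (0 : Eu k) 1 ↔ ε • x + x₀ ∈ Metric.ball x₀ ε := by
    intro x
    rw [mem_ball_iff_norm, mem_ball_iff_norm, add_sub_cancel_right, norm_smul, sub_zero,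
      Real.norm_of_nonneg hε.le]
    exact (mul_lt_iff_lt_one_right hε).symm
  have hx₀B : x₀ ∈ Metric.ball x₀ ε := Metric.mem_ball_self hε
  rw [hx₀, hy₀]
  let K : Set (Eu l) := {y | y ∈ V ∧ φ.symm (x₀, y) ∈ range P.ι}
  let φ' := FoliatedAtlas.rescaledChart φ x₀ hε.ne' hV
  have himage : φ' '' (φ'.source ∩ range P.ι) = Metric.ball 0 1 ×ˢ K := by
    ext ⟨x, y⟩
    constructor
    · rintro ⟨w, ⟨hw, hwr⟩, h⟩
      rw [FoliatedAtlas.rescaledChart_source] at hw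
      rw [FoliatedAtlas.rescaledChart_apply] at h
      obtain ⟨rfl, rfl⟩ := Prod.ext_iff.1 h
      refine ⟨?_, hw.2.2, ?_⟩
      · rw [hball]
        simpa [smul_smul, mul_inv_cancel₀ hε.ne'] using hw.2.1
      · refine mem_range_of_plaque hφ (convex_ball x₀ ε) (fun x hx => (hBV' x hx _ hw.2.2).1)
          hw.2.1 hx₀B ?_
        simpa [φ.left_inv hw.1] using hwr
    · rintro ⟨hx, hy, hyr⟩
      rw [hball] at hx
      have ht := (hBV' _ hx y hy).1
      refine ⟨φ.symm (ε • x + x₀, y), ⟨⟨φ.map_target ht, ?_⟩, ?_⟩, ?_⟩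
      · change φ (φ.symm (ε • x + x₀, y)) ∈ Metric.ball x₀ ε ×ˢ V
        rw [φ.right_inv ht]
        exact ⟨hx, hy⟩
      · exact mem_range_of_plaque hφ (convex_ball x₀ ε) (fun x hx => (hBV' x hx _ hy).1)
          hx₀B hx hyr
      · rw [FoliatedAtlas.rescaledChart_apply, φ.right_inv ht]
        simp [smul_smul, inv_mul_cancel₀ hε.ne']
  refine ⟨⟨φ', hφ.rescaledChart hε.ne' hV, K, himage⟩, ⟨⟨hp, ?_⟩, ?_⟩, ?_, fun w => rfl, V, hV, hyV,
    fun y hy => (hBV' x₀ hx₀B y hy).1, rfl⟩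
  · change φ (P.ι p) ∈ Metric.ball x₀ ε ×ˢ V
    rw [hxy]
    exact ⟨hx₀B, hyV⟩
  · change ε⁻¹ • ((φ (P.ι p)).1 - x₀) = 0
    simp [hx₀]
  · rintro w ⟨hw, hw'⟩
    refine ⟨hw, ?_⟩
    have := (hBV' _ hw'.1 _ hw'.2).2
    simpa [φ.left_inv hw] using this

theorem exists_flowBox_mem (P : PreSolenoid k l r s S) (p : S) {N : Set S} (hN : N ∈ 𝓝 p) :
    ∃ B : P.FlowBox, p ∈ B.transversal ∧ B.domain ⊆ N := by
  obtain ⟨φ, hφ, hp⟩ := P.foliation.cover (P.ι p)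
  rw [P.isEmbedding.nhds_eq_comap, mem_comap] at hN
  obtain ⟨N', hN', hN⟩ := hN
  obtain ⟨B, hB, hs, -⟩ := exists_flowBox (FoliatedAtlas.isFlowChart_of_mem hφ) hp hN'
  exact ⟨B, hB, fun q hq => hN (hs hq).2⟩

namespace FlowBox

variable (B : P.FlowBox)

theorem isOpen_domain : IsOpen B.domain :=
  B.chart.open_source.preimage P.isEmbedding.continuous

theorem domain_mem_nhds {p : S} (hp : p ∈ B.domain) : B.domain ∈ 𝓝 p :=
  B.isOpen_domain.mem_nhds hp

theorem continuousOn_chart : ContinuousOn (fun p => B.chart (P.ι p)) B.domain :=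
  B.chart.continuousOn.comp P.isEmbedding.continuous.continuousOn fun _ h => h

theorem continuousOn_transCoord : ContinuousOn B.transCoord B.domain :=
  continuous_snd.comp_continuousOn B.continuousOn_chart

theorem continuousOn_leafCoord : ContinuousOn B.leafCoord B.domain :=
  continuous_fst.comp_continuousOn B.continuousOn_chart

variable {B}

theorem coord_mem {p : S} (hp : p ∈ B.domain) :
    B.leafCoord p ∈ Metric.ball (0 : Eu k) 1 ∧ B.transCoord p ∈ B.K := by
  have : B.chart (P.ι p) ∈ Metric.ball (0 : Eu k) 1 ×ˢ B.K := by
    rw [← B.image_eq]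
    exact mem_image_of_mem _ ⟨hp, mem_range_self p⟩
  exact this

theorem eq_of_coord_eq {p q : S} (hp : p ∈ B.domain) (hq : q ∈ B.domain)
    (h₁ : B.leafCoord p = B.leafCoord q) (h₂ : B.transCoord p = B.transCoord q) : p = q :=
  P.isEmbedding.injective (B.chart.injOn hp hq (Prod.ext h₁ h₂))

theorem eq_of_mem_transversal {p q : S} (hp : p ∈ B.transversal) (hq : q ∈ B.transversal)
    (h : B.transCoord p = B.transCoord q) : p = q :=
  eq_of_coord_eq hp.1 hq.1 (hp.2.trans hq.2.symm) h

theorem exists_coord_eq {x : Eu k} {y : Eu l} (hx : x ∈ Metric.ball (0 : Eu k) 1)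
    (hy : y ∈ B.K) : ∃ p ∈ B.domain, B.leafCoord p = x ∧ B.transCoord p = y := by
  have : (x, y) ∈ B.chart '' (B.chart.source ∩ range P.ι) := by
    rw [B.image_eq]; exact ⟨hx, hy⟩
  obtain ⟨_, ⟨hw, p, rfl⟩, h⟩ := this
  exact ⟨p, hw, congr_arg Prod.fst h, congr_arg Prod.snd h⟩

theorem mem_target {x : Eu k} {y : Eu l} (hx : x ∈ Metric.ball (0 : Eu k) 1) (hy : y ∈ B.K) :
    (x, y) ∈ B.chart.target := by
  obtain ⟨p, hp, rfl, rfl⟩ := exists_coord_eq hx hy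
  exact B.chart.map_source hp

variable (B) in
/-- The point of `S` with given coordinates in the flow-box. -/
def point [Nonempty S] (z : Eu k × Eu l) : S := Function.invFun P.ι (B.chart.symm z)

section point

variable [Nonempty S]

theorem point_coord {p : S} (hp : p ∈ B.domain) : B.point (B.leafCoord p, B.transCoord p) = p := by
  have : B.chart.symm (B.leafCoord p, B.transCoord p) = P.ι p := B.chart.left_inv hp
  rw [point, this, Function.leftInverse_invFun P.isEmbedding.injective]

variable {x : Eu k} {y : Eu l}

theorem point_mem (hx : x ∈ Metric.ball (0 : Eu k) 1) (hy : y ∈ B.K) :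
    B.point (x, y) ∈ B.domain := by
  obtain ⟨p, hp, rfl, rfl⟩ := exists_coord_eq hx hy
  rwa [point_coord hp]

theorem leafCoord_point (hx : x ∈ Metric.ball (0 : Eu k) 1) (hy : y ∈ B.K) :
    B.leafCoord (B.point (x, y)) = x := by
  obtain ⟨p, hp, rfl, rfl⟩ := exists_coord_eq hx hy
  rw [point_coord hp]

theorem transCoord_point (hx : x ∈ Metric.ball (0 : Eu k) 1) (hy : y ∈ B.K) :
    B.transCoord (B.point (x, y)) = y := by
  obtain ⟨p, hp, rfl, rfl⟩ := exists_coord_eq hx hy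
  rw [point_coord hp]

theorem ι_point (hx : x ∈ Metric.ball (0 : Eu k) 1) (hy : y ∈ B.K) :
    P.ι (B.point (x, y)) = B.chart.symm (x, y) := by
  obtain ⟨p, hp, rfl, rfl⟩ := exists_coord_eq hx hy
  rw [point_coord hp]
  exact (B.chart.left_inv hp).symm

variable (B) in
theorem continuousOn_point : ContinuousOn B.point (Metric.ball (0 : Eu k) 1 ×ˢ B.K) := by
  rw [P.isEmbedding.isInducing.continuousOn_iff]
  refine (B.chart.continuousOn_symm.mono fun z hz => mem_target hz.1 hz.2).congr fun z hz => ?_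
  exact ι_point hz.1 hz.2

variable (B) in
/-- The projection of the flow-box to its transversal. -/
def proj (p : S) : S := B.point (0, B.transCoord p)

theorem proj_mem {p : S} (hp : p ∈ B.domain) : B.proj p ∈ B.transversal :=
  ⟨point_mem (Metric.mem_ball_self one_pos) (coord_mem hp).2,
    leafCoord_point (Metric.mem_ball_self one_pos) (coord_mem hp).2⟩

theorem transCoord_proj {p : S} (hp : p ∈ B.domain) :
    B.transCoord (B.proj p) = B.transCoord p :=
  transCoord_point (Metric.mem_ball_self one_pos) (coord_mem hp).2

theorem proj_eq_self {p : S} (hp : p ∈ B.transversal) : B.proj p = p := by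
  rw [proj, ← hp.2, point_coord hp.1]

theorem proj_eq_proj_iff {p q : S} (hp : p ∈ B.domain) (hq : q ∈ B.domain) :
    B.proj p = B.proj q ↔ B.transCoord p = B.transCoord q :=
  ⟨fun h => by rw [← transCoord_proj hp, h, transCoord_proj hq], fun h => by rw [proj, h, proj]⟩

end point

/-- Near a point, the transverse coordinates of two flow-boxes determine each other. -/
theorem exists_nhds_transCoord_eq (B B' : P.FlowBox) {p : S} (hp : p ∈ B.domain)
    (hp' : p ∈ B'.domain) : ∃ N ∈ 𝓝 p, ∀ q₁ ∈ N, ∀ q₂ ∈ N,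
      B.transCoord q₁ = B.transCoord q₂ ↔ B'.transCoord q₁ = B'.transCoord q₂ := by
  obtain ⟨N, hN, h⟩ := B.isFlowChart.exists_nhds_snd_eq B'.isFlowChart hp hp'
  obtain ⟨N', hN', h'⟩ := B'.isFlowChart.exists_nhds_snd_eq B.isFlowChart hp' hp
  refine ⟨P.ι ⁻¹' (N ∩ N'), P.isEmbedding.continuous.continuousAt.preimage_mem_nhds
    (inter_mem hN hN'), fun q₁ h₁ q₂ h₂ => ⟨h _ h₁.1 _ h₂.1, h' _ h₁.2 _ h₂.2⟩⟩

end FlowBox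

/-! ### Leafwise differentials -/

section leafDiff

variable {n : ℕ} {M : Type w} [TopologicalSpace M] [ChartedSpace (Eu n) M] {f : S → M}
  {F : P.W → M}

/-- A whole ball of the plaque through `p` lies in `S`; there the extension by a default value
agrees with any extension `F` of `f`, so both have the same leaf derivative. -/
theorem leafDiff_eq (hF : ∀ p, F (P.ι p) = f p) (hφ : P.foliation.IsFlowChart φ) {p : S}
    (hp : P.ι p ∈ φ.source) : P.leafDiff n f φ p =
      leafDeriv (fun z => chartAt (Eu n) (f p) (F (φ.symm z))) (φ (P.ι p)) := by
  refine Filter.EventuallyEq.fderiv_eq ?_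
  obtain ⟨ε, hε, hB⟩ := Metric.mem_nhds_iff.1
    (eventually_leaf_mem φ.open_target (φ.map_source hp))
  filter_upwards [Metric.ball_mem_nhds _ hε] with x hx
  obtain ⟨q, hq⟩ := mem_range_of_plaque hφ (convex_ball _ ε) (fun x hx => hB hx)
    (Metric.mem_ball_self hε) hx (by
      rw [Prod.mk.eta, φ.left_inv hp]; exact mem_range_self p)
  rw [← hq, P.isEmbedding.injective.extend_apply, hF]

variable (n) in
/-- `F` is of class `C^{r,s}` on the open set `U`, in the charts of the foliation. -/
structure _root_.FoliatedAtlas.IsClassCrsMap {W : Type u} [TopologicalSpace W]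
    (A : FoliatedAtlas k l r s W) (U : Set W) (F : W → M) : Prop where
  isOpen : IsOpen U
  continuousOn : ContinuousOn F U
  classCrs : ∀ φ ∈ A.charts, ∀ ψ ∈ atlas (Eu n) M, IsClassCrs r s (fun z => ψ (F (φ.symm z)))
    {z | z ∈ φ.target ∧ φ.symm z ∈ U ∧ F (φ.symm z) ∈ ψ.source}

theorem _root_.FoliatedAtlas.IsClassCrsMap.isOpen_inter {W : Type u} [TopologicalSpace W]
    {A : FoliatedAtlas k l r s W} {U : Set W} {F : W → M} (h : A.IsClassCrsMap n U F)
    {ψ : OpenPartialHomeomorph M (Eu n)} :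
    IsOpen (U ∩ F ⁻¹' ψ.source) := h.continuousOn.isOpen_inter_preimage h.isOpen ψ.open_source

theorem _root_.FoliatedAtlas.IsClassCrsMap.classCrs_of_isFlowChart {W : Type u}
    [TopologicalSpace W] {A : FoliatedAtlas k l r s W} {U : Set W} {F : W → M}
    (h : A.IsClassCrsMap n U F) {φ : OpenPartialHomeomorph W (Eu k × Eu l)} (hφ : A.IsFlowChart φ)
    {ψ : OpenPartialHomeomorph M (Eu n)} (hψ : ψ ∈ atlas (Eu n) M) :
    IsClassCrs r s (fun z => ψ (F (φ.symm z))) (φ.target ∩ φ.symm ⁻¹' (U ∩ F ⁻¹' ψ.source)) := by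
  refine .of_local fun z hz => ?_
  obtain ⟨χ, hχ, hzχ⟩ := A.cover (φ.symm z)
  have h1 := hφ.classCrs_change (FoliatedAtlas.isFlowChart_of_mem hχ) (h := fun w => ψ (F w))
    h.isOpen_inter (h.classCrs χ hχ ψ hψ)
  refine ⟨(φ.symm.trans χ).source, (φ.symm.trans χ).open_source, ⟨hz.1, hzχ⟩, h1.mono ?_⟩
  exact fun z hz => ⟨hz.2, hz.1.2⟩

/-- The leafwise derivatives of a map in two flow charts. -/
theorem _root_.FoliatedAtlas.IsClassCrsMap.leafDeriv_change {W : Type u} (hr : 1 ≤ r)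
    [TopologicalSpace W] {A : FoliatedAtlas k l r s W} {U : Set W} {F : W → M}
    (h : A.IsClassCrsMap n U F) {φ χ : OpenPartialHomeomorph W (Eu k × Eu l)}
    (hφ : A.IsFlowChart φ) (hχ : A.IsFlowChart χ)
    {ψ : OpenPartialHomeomorph M (Eu n)} (hψ : ψ ∈ atlas (Eu n) M) {w : W} (hwU : w ∈ U)
    (hwψ : F w ∈ ψ.source) (hw : w ∈ φ.source) (hwχ : w ∈ χ.source) :
    leafDeriv (fun z => ψ (F (φ.symm z))) (φ w) =
      (leafDeriv (fun z => ψ (F (χ.symm z))) (χ w)).comp (FoliatedAtlas.leafTransition φ χ w) :=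
  hφ.leafDeriv_change hr hχ (h := fun w => ψ (F w)) (h.classCrs_of_isFlowChart hχ hψ)
    ⟨χ.map_source hwχ, by simpa [χ.left_inv hwχ] using ⟨hwU, hwψ⟩⟩ hw hwχ

theorem _root_.contDiffAt_chart_change [IsManifold (𝓡 n) r M]
    {ψ ψ' : OpenPartialHomeomorph M (Eu n)} (hψ : ψ ∈ atlas (Eu n) M)
    (hψ' : ψ' ∈ atlas (Eu n) M) {x : M} (hx : x ∈ ψ.source) (hx' : x ∈ ψ'.source) :
    ContDiffAt ℝ r (fun m => ψ' (ψ.symm m)) (ψ x) := by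
  have h := HasGroupoid.compatible (G := contDiffGroupoid r (𝓡 n)) hψ hψ'
  rw [contDiffGroupoid, mem_groupoid_of_pregroupoid] at h
  have h' : ContDiffOn ℝ r (fun m => ψ' (ψ.symm m)) (ψ.symm.trans ψ').source := by
    simpa [contDiffPregroupoid, Function.comp_def] using h.1
  exact h'.contDiffAt ((ψ.symm.trans ψ').open_source.mem_nhds
    ⟨ψ.map_source hx, by simpa [ψ.left_inv hx] using hx'⟩)

/-- The leafwise derivatives of a map in two charts of the target manifold. -/
theorem _root_.FoliatedAtlas.IsClassCrsMap.leafDeriv_chart {W : Type u} (hr : 1 ≤ r)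
    [TopologicalSpace W] [IsManifold (𝓡 n) r M] {A : FoliatedAtlas k l r s W} {U : Set W}
    {F : W → M} (h : A.IsClassCrsMap n U F) {φ : OpenPartialHomeomorph W (Eu k × Eu l)}
    (hφ : A.IsFlowChart φ) {ψ ψ' : OpenPartialHomeomorph M (Eu n)} (hψ : ψ ∈ atlas (Eu n) M)
    (hψ' : ψ' ∈ atlas (Eu n) M) {w : W} (hwU : w ∈ U)
    (hwψ : F w ∈ ψ.source) (hwψ' : F w ∈ ψ'.source) (hw : w ∈ φ.source) :
    leafDeriv (fun z => ψ' (F (φ.symm z))) (φ w) =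
      (fderiv ℝ (fun m => ψ' (ψ.symm m)) (ψ (F w))).comp
        (leafDeriv (fun z => ψ (F (φ.symm z))) (φ w)) := by
  have hD : φ w ∈ φ.target ∩ φ.symm ⁻¹' (U ∩ F ⁻¹' ψ.source) :=
    ⟨φ.map_source hw, by simpa [φ.left_inv hw] using ⟨hwU, hwψ⟩⟩
  have h1 := (h.classCrs_of_isFlowChart hφ hψ).hasFDerivAt hr hD
  have hFw : F (φ.symm (φ w)) = F w := by rw [φ.left_inv hw]
  have h2 : ContDiffAt ℝ r (fun m => ψ' (ψ.symm m)) (ψ (F w)) :=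
    contDiffAt_chart_change hψ hψ' hwψ hwψ'
  have h5 := (h2.differentiableAt (by rintro rfl; simp at hr)).hasFDerivAt
  rw [← hFw] at h5
  have h6 := HasFDerivAt.comp (g := fun m => ψ' (ψ.symm m))
    (f := fun x => ψ (F (φ.symm (x, (φ w).2)))) (φ w).1 h5 h1
  rw [hFw] at h6
  refine (h6.congr_of_eventuallyEq ?_).fderiv
  have hopen : IsOpen (φ.target ∩ φ.symm ⁻¹' (U ∩ F ⁻¹' ψ.source)) :=
    φ.continuousOn_symm.isOpen_inter_preimage φ.open_target h.isOpen_inter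
  filter_upwards [eventually_leaf_mem hopen hD] with x hx
  simp [ψ.left_inv hx.2.2]

end leafDiff

end PreSolenoid

/-! ### Linear algebra of transversal maps -/

section LinearAlgebra

/-- Concatenation of coordinates as a linear equivalence. -/
def appendEquiv (l₁ l₂ : ℕ) : (Eu l₁ × Eu l₂) ≃L[ℝ] Eu (l₁ + l₂) :=
  LinearEquiv.toContinuousLinearEquiv
    { toFun := fun p => appendCoord p.1 p.2
      invFun := fun y => (WithLp.toLp 2 fun i => y (Fin.castAdd l₂ i),
        WithLp.toLp 2 fun j => y (Fin.natAdd l₁ j))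
      map_add' := fun p q => by
        ext i
        refine Fin.addCases (fun i => ?_) (fun i => ?_) i <;> simp [appendCoord]
      map_smul' := fun c p => by
        ext i
        refine Fin.addCases (fun i => ?_) (fun i => ?_) i <;> simp [appendCoord]
      left_inv := fun p => by
        refine Prod.ext ?_ ?_ <;> ext i <;> simp [appendCoord]
      right_inv := fun y => by
        ext i
        refine Fin.addCases (fun i => ?_) (fun i => ?_) i <;> simp [appendCoord] }

theorem appendEquiv_apply {l₁ l₂ : ℕ} (p : Eu l₁ × Eu l₂) :
    appendEquiv l₁ l₂ p = appendCoord p.1 p.2 := rfl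

theorem appendEquiv_symm_appendCoord {l₁ l₂ : ℕ} (a : Eu l₁) (b : Eu l₂) :
    (appendEquiv l₁ l₂).symm (appendCoord a b) = (a, b) :=
  (appendEquiv l₁ l₂).symm_apply_apply (a, b)

variable {E₁ E₂ G H : Type*} [NormedAddCommGroup E₁] [NormedSpace ℝ E₁] [NormedAddCommGroup E₂]
  [NormedSpace ℝ E₂] [NormedAddCommGroup G] [NormedSpace ℝ G] [NormedAddCommGroup H]
  [NormedSpace ℝ H]

/-- The linear map `(x₁, x₂) ↦ (D₁ x₁ - D₂ x₂, C (x₁, x₂))`. -/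
def jointMap (D₁ : E₁ →L[ℝ] G) (D₂ : E₂ →L[ℝ] G) (C : E₁ × E₂ →L[ℝ] H) : E₁ × E₂ →L[ℝ] G × H :=
  (D₁.comp (.fst ℝ E₁ E₂) - D₂.comp (.snd ℝ E₁ E₂)).prod C

theorem jointMap_apply (D₁ : E₁ →L[ℝ] G) (D₂ : E₂ →L[ℝ] G) (C : E₁ × E₂ →L[ℝ] H) (x : E₁ × E₂) :
    jointMap D₁ D₂ C x = (D₁ x.1 - D₂ x.2, C x) := rfl

theorem surjective_sub_of_range_sup_eq_top {D₁ : E₁ →L[ℝ] G} {D₂ : E₂ →L[ℝ] G}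
    (h : D₁.range ⊔ D₂.range = ⊤) : ∀ g, ∃ x : E₁ × E₂, D₁ x.1 - D₂ x.2 = g := fun g => by
  obtain ⟨_, ⟨x₁, rfl⟩, _, ⟨x₂, rfl⟩, h⟩ := Submodule.mem_sup.1 (h ▸ Submodule.mem_top (x := g))
  exact ⟨(x₁, -x₂), by simpa using h⟩

/-- Invertibility of the joint map is an open condition that implies transversality; this keeps the
points of an adapted chart inside the transversal part of the fibre product. -/
theorem range_sup_eq_top_of_bijective {D₁ : E₁ →L[ℝ] G} {D₂ : E₂ →L[ℝ] G} {C : E₁ × E₂ →L[ℝ] H}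
    (h : Function.Surjective (jointMap D₁ D₂ C)) : D₁.range ⊔ D₂.range = ⊤ := by
  refine eq_top_iff.2 fun g _ => ?_
  obtain ⟨x, hx⟩ := h (g, 0)
  refine Submodule.mem_sup.2 ⟨D₁ x.1, ⟨x.1, rfl⟩, D₂ (-x.2), ⟨-x.2, rfl⟩, ?_⟩
  simpa [jointMap_apply, sub_eq_add_neg] using congr_arg Prod.fst hx

/-- By transversality `(x₁, x₂) ↦ D₁ x₁ - D₂ x₂` is onto, so its kernel has dimension `k₁ + k₂ - n =
k`. For `C` one takes a projection to the kernel followed by an isomorphism with `ℝ^k`. -/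
theorem exists_jointMap_bijective {n k k₁ k₂ : ℕ} (hk : k + n = k₁ + k₂) {D₁ : Eu k₁ →L[ℝ] Eu n}
    {D₂ : Eu k₂ →L[ℝ] Eu n} (h : D₁.range ⊔ D₂.range = ⊤) :
    ∃ C : Eu k₁ × Eu k₂ →L[ℝ] Eu k, Function.Bijective (jointMap D₁ D₂ C) := by
  let L : Eu k₁ × Eu k₂ →ₗ[ℝ] Eu n :=
    (D₁.comp (.fst ℝ _ _) - D₂.comp (.snd ℝ _ _) : Eu k₁ × Eu k₂ →L[ℝ] Eu n)
  have hL : ∀ x, L x = D₁ x.1 - D₂ x.2 := fun x => rfl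
  have hsurj : L.range = ⊤ := LinearMap.range_eq_top.2 (surjective_sub_of_range_sup_eq_top h)
  have hdim := L.finrank_range_add_finrank_ker
  rw [hsurj, finrank_top, Module.finrank_prod] at hdim
  simp only [finrank_euclideanSpace_fin] at hdim
  obtain ⟨π, hπ⟩ := L.ker.subtype.exists_leftInverse_of_injective
    (LinearMap.ker_eq_bot.2 L.ker.subtype_injective)
  have e : L.ker ≃ₗ[ℝ] Eu k := LinearEquiv.ofFinrankEq _ _ (by
    rw [finrank_euclideanSpace_fin]; omega)
  let C : Eu k₁ × Eu k₂ →L[ℝ] Eu k := LinearMap.toContinuousLinearMap (e.toLinearMap ∘ₗ π)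
  have hinj : Function.Injective (jointMap D₁ D₂ C) := by
    rw [injective_iff_map_eq_zero]
    intro x hx
    rw [jointMap_apply] at hx
    obtain ⟨h1, h2⟩ := Prod.ext_iff.1 hx
    have h3 : π x = 0 := e.injective (by simpa [C] using h2)
    have h4 := LinearMap.congr_fun hπ ⟨x, by simpa [hL] using h1⟩
    simp only [LinearMap.comp_apply, Submodule.subtype_apply, LinearMap.id_apply] at h4
    rw [h3] at h4
    exact (congr_arg Subtype.val h4).symm
  refine ⟨C, hinj, ?_⟩
  exact (LinearMap.injective_iff_surjective_of_finrank_eq_finrank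
    (f := (jointMap D₁ D₂ C).toLinearMap) (by
      simp only [Module.finrank_prod, finrank_euclideanSpace_fin]; omega)).1 hinj

theorem isInvertible_of_bijective [FiniteDimensional ℝ E₁] [FiniteDimensional ℝ G]
    {D : E₁ →L[ℝ] G} (h : Function.Bijective D) : D.IsInvertible :=
  ⟨(LinearEquiv.ofBijective D.toLinearMap h).toContinuousLinearEquiv, by ext; rfl⟩

theorem bijective_of_isInvertible {D : E₁ →L[ℝ] G} (h : D.IsInvertible) :
    Function.Bijective D := by
  obtain ⟨e, rfl⟩ := h
  exact e.bijective

end LinearAlgebra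

/-! ### The fibre product of two foliated manifolds over a manifold -/

section FibreProduct

variable {n k k₁ k₂ l₁ l₂ : ℕ} {r s : WithTop ℕ∞} {M : Type w} [TopologicalSpace M]
  [ChartedSpace (Eu n) M] {W₁ : Type u} [TopologicalSpace W₁] {W₂ : Type v} [TopologicalSpace W₂]

/-- The leafwise derivative at `w` of the map `F`, in the charts `φ` and `ψ`. -/
def mapDeriv {k l : ℕ} {W : Type*} [TopologicalSpace W] (F : W → M)
    (φ : OpenPartialHomeomorph W (Eu k × Eu l)) (ψ : OpenPartialHomeomorph M (Eu n)) (w : W) :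
    Eu k →L[ℝ] Eu n :=
  leafDeriv (fun z => ψ (F (φ.symm z))) (φ w)

variable (n) in
/-- The part of the fibre product of two maps of foliated manifolds where they are transversal. -/
def fibreSet (A₁ : FoliatedAtlas k₁ l₁ r s W₁) (A₂ : FoliatedAtlas k₂ l₂ r s W₂) (U₁ : Set W₁)
    (U₂ : Set W₂) (F₁ : W₁ → M) (F₂ : W₂ → M) : Set (W₁ × W₂) :=
  {w | w.1 ∈ U₁ ∧ w.2 ∈ U₂ ∧ F₁ w.1 = F₂ w.2 ∧ ∃ φ₁ φ₂, A₁.IsFlowChart φ₁ ∧ A₂.IsFlowChart φ₂ ∧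
    w.1 ∈ φ₁.source ∧ w.2 ∈ φ₂.source ∧ ∃ ψ ∈ atlas (Eu n) M, F₁ w.1 ∈ ψ.source ∧
      (mapDeriv F₁ φ₁ ψ w.1).range ⊔ (mapDeriv F₂ φ₂ ψ w.2).range = ⊤}

/-- The chart `θ` of (a part `X` of) the fibre product is obtained from the charts `φ₁` and `φ₂` by
solving the equation `F₁ = F₂`, with the linear function `C` of the leaf coordinates as leaf
coordinate. -/
structure IsAdapted (r s : WithTop ℕ∞) {X : Set (W₁ × W₂)} (F₁ : W₁ → M) (F₂ : W₂ → M)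
    (φ₁ : OpenPartialHomeomorph W₁ (Eu k₁ × Eu l₁)) (φ₂ : OpenPartialHomeomorph W₂ (Eu k₂ × Eu l₂))
    (ψ : OpenPartialHomeomorph M (Eu n)) (C : Eu k₁ × Eu k₂ →L[ℝ] Eu k)
    (θ : OpenPartialHomeomorph X (Eu k × Eu (l₁ + l₂))) : Prop where
  mem_fst : ∀ w ∈ θ.source, w.1.1 ∈ φ₁.source
  mem_snd : ∀ w ∈ θ.source, w.1.2 ∈ φ₂.source
  mem_chart : ∀ w ∈ θ.source, F₁ w.1.1 ∈ ψ.source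
  leaf : ∀ w ∈ θ.source, (θ w).1 = C ((φ₁ w.1.1).1, (φ₂ w.1.2).1)
  trans : ∀ w ∈ θ.source, (θ w).2 = appendCoord (φ₁ w.1.1).2 (φ₂ w.1.2).2
  class_fst : IsClassCrs r s (fun z => (φ₁ (θ.symm z).1.1).1) θ.target
  class_snd : IsClassCrs r s (fun z => (φ₂ (θ.symm z).1.2).1) θ.target
  bijective : ∀ w ∈ θ.source,
    Function.Bijective (jointMap (mapDeriv F₁ φ₁ ψ w.1.1) (mapDeriv F₂ φ₂ ψ w.1.2) C)

variable {A₁ : FoliatedAtlas k₁ l₁ r s W₁} {A₂ : FoliatedAtlas k₂ l₂ r s W₂} {U₁ : Set W₁}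
  {U₂ : Set W₂} {F₁ : W₁ → M} {F₂ : W₂ → M}
  {φ₁ φ₁' : OpenPartialHomeomorph W₁ (Eu k₁ × Eu l₁)}
  {φ₂ φ₂' : OpenPartialHomeomorph W₂ (Eu k₂ × Eu l₂)} {ψ ψ' : OpenPartialHomeomorph M (Eu n)}

theorem mapDeriv_range_change (hr : 1 ≤ r) (h₁ : A₁.IsClassCrsMap n U₁ F₁)
    (hφ₁ : A₁.IsFlowChart φ₁) (hφ₁' : A₁.IsFlowChart φ₁') (hψ : ψ ∈ atlas (Eu n) M) {w : W₁}
    (hwU : w ∈ U₁) (hwψ : F₁ w ∈ ψ.source) (hw : w ∈ φ₁.source) (hw' : w ∈ φ₁'.source) :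
    (mapDeriv F₁ φ₁ ψ w).range = (mapDeriv F₁ φ₁' ψ w).range := by
  have h := h₁.leafDeriv_change hr hφ₁ hφ₁' hψ hwU hwψ hw hw'
  have hs := (hφ₁.leafTransition_bijective hr hφ₁' hw hw').2
  ext y
  constructor
  · rintro ⟨x, rfl⟩
    exact ⟨FoliatedAtlas.leafTransition φ₁ φ₁' w x, (DFunLike.congr_fun h x).symm⟩
  · rintro ⟨x, rfl⟩
    obtain ⟨x, rfl⟩ := hs x
    exact ⟨x, DFunLike.congr_fun h x⟩

/-- The implicit function theorem with parameters. In the charts, the fibre product is the zero set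
of `H₁ - H₂`. Completing this equation by the linear function `C` gives a map `G` with invertible
leaf derivative at the point, and the local inverse of `(G, y, z)` parametrizes the zero set by `C`
and `(y, z)`. -/
theorem exists_isAdapted (hr : 1 ≤ r) (hk : k + n = k₁ + k₂) (h₁ : A₁.IsClassCrsMap n U₁ F₁)
    (h₂ : A₂.IsClassCrsMap n U₂ F₂) (hφ₁ : A₁.IsFlowChart φ₁) (hφ₂ : A₂.IsFlowChart φ₂)
    (hψ : ψ ∈ atlas (Eu n) M) (w : fibreSet n A₁ A₂ U₁ U₂ F₁ F₂) (hw₁ : w.1.1 ∈ φ₁.source)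
    (hw₂ : w.1.2 ∈ φ₂.source) (hwψ : F₁ w.1.1 ∈ ψ.source)
    (htr : (mapDeriv F₁ φ₁ ψ w.1.1).range ⊔ (mapDeriv F₂ φ₂ ψ w.1.2).range = ⊤) :
    ∃ (C : Eu k₁ × Eu k₂ →L[ℝ] Eu k)
      (θ : OpenPartialHomeomorph (fibreSet n A₁ A₂ U₁ U₂ F₁ F₂) (Eu k × Eu (l₁ + l₂))),
      IsAdapted r s F₁ F₂ φ₁ φ₂ ψ C θ ∧ w ∈ θ.source := by
  obtain ⟨C, hC⟩ := exists_jointMap_bijective hk htr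
  let Ω₁ := φ₁.target ∩ φ₁.symm ⁻¹' (U₁ ∩ F₁ ⁻¹' ψ.source)
  let Ω₂ := φ₂.target ∩ φ₂.symm ⁻¹' (U₂ ∩ F₂ ⁻¹' ψ.source)
  have hΩ₁ : IsOpen Ω₁ := φ₁.continuousOn_symm.isOpen_inter_preimage φ₁.open_target h₁.isOpen_inter
  have hΩ₂ : IsOpen Ω₂ := φ₂.continuousOn_symm.isOpen_inter_preimage φ₂.open_target h₂.isOpen_inter
  let H₁ : Eu k₁ × Eu l₁ → Eu n := fun z => ψ (F₁ (φ₁.symm z))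
  let H₂ : Eu k₂ × Eu l₂ → Eu n := fun z => ψ (F₂ (φ₂.symm z))
  have hH₁ : IsClassCrs r s H₁ Ω₁ := h₁.classCrs_of_isFlowChart hφ₁ hψ
  have hH₂ : IsClassCrs r s H₂ Ω₂ := h₂.classCrs_of_isFlowChart hφ₂ hψ
  let Ω : Set ((Eu k₁ × Eu k₂) × (Eu l₁ × Eu l₂)) :=
    {z | (z.1.1, z.2.1) ∈ Ω₁ ∧ (z.1.2, z.2.2) ∈ Ω₂}
  have hΩ : IsOpen Ω := (hΩ₁.preimage (by fun_prop)).inter (hΩ₂.preimage (by fun_prop))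
  let G : (Eu k₁ × Eu k₂) × (Eu l₁ × Eu l₂) → Eu n × Eu k := fun z =>
    (H₁ (z.1.1, z.2.1) - H₂ (z.1.2, z.2.2), C z.1)
  have hG : IsClassCrs r s G Ω := by
    refine .prodMk hΩ ?_ (.of_leaf hΩ C.contDiff)
    refine IsClassCrs.clm_comp (ContinuousLinearMap.fst ℝ (Eu n) (Eu n) - .snd ℝ (Eu n) (Eu n))
      hΩ (.prodMk hΩ ?_ ?_)
    · exact hH₁.comp (g := fun z => z.1.1) (Y := Prod.fst) hΩ
        (.of_leaf (α := Prod.fst) hΩ contDiff_fst)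
        (contDiff_fst.comp contDiff_snd).contDiffOn fun z hz => hz.1
    · exact hH₂.comp (g := fun z => z.1.2) (Y := Prod.snd) hΩ
        (.of_leaf (α := Prod.snd) hΩ contDiff_snd)
        (contDiff_snd.comp contDiff_snd).contDiffOn fun z hz => hz.2
  have hG' : ∀ z ∈ Ω, leafDeriv G z =
      jointMap (leafDeriv H₁ (z.1.1, z.2.1)) (leafDeriv H₂ (z.1.2, z.2.2)) C := fun z hz => by
    have e1 := HasFDerivAt.comp (g := fun x => H₁ (x, z.2.1)) (f := Prod.fst) z.1
      (hH₁.hasFDerivAt hr hz.1) hasFDerivAt_fst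
    have e2 := HasFDerivAt.comp (g := fun x => H₂ (x, z.2.2)) (f := Prod.snd) z.1
      (hH₂.hasFDerivAt hr hz.2) hasFDerivAt_snd
    exact ((e1.sub e2).prodMk C.hasFDerivAt).fderiv
  let J : W₁ × W₂ → (Eu k₁ × Eu k₂) × (Eu l₁ × Eu l₂) := fun w =>
    (((φ₁ w.1).1, (φ₂ w.2).1), ((φ₁ w.1).2, (φ₂ w.2).2))
  have hJΩ : J w.1 ∈ Ω :=
    ⟨⟨φ₁.map_source hw₁, by simpa [J, φ₁.left_inv hw₁] using ⟨w.2.1, hwψ⟩⟩,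
      ⟨φ₂.map_source hw₂, by simpa [J, φ₂.left_inv hw₂, ← w.2.2.2.1] using ⟨w.2.2.1, hwψ⟩⟩⟩
  obtain ⟨e, hwe, heΩ, he, hinv⟩ := exists_openPartialHomeomorph_of_leafDeriv hΩ hG.continuousOn
    (fun z hz => hG.differentiableAt hr hz) (hG.continuousOn_leafDeriv hr) hJΩ (by
      rw [hG' _ hJΩ]
      exact isInvertible_of_bijective hC)
  have hes := (hG.mono heΩ).inverse hr (fun z _ => he z) hinv
  let J' : (Eu k₁ × Eu k₂) × (Eu l₁ × Eu l₂) → W₁ × W₂ := fun z =>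
    (φ₁.symm (z.1.1, z.2.1), φ₂.symm (z.1.2, z.2.2))
  have hJJ' : ∀ z ∈ Ω, J (J' z) = z := fun z hz => by
    simp [J, J', φ₁.right_inv hz.1.1, φ₂.right_inv hz.2.1]
  have hJ'J : ∀ w : W₁ × W₂, w.1 ∈ φ₁.source → w.2 ∈ φ₂.source → J' (J w) = w := fun w h h' => by
    simp [J, J', φ₁.left_inv h, φ₂.left_inv h']
  -- The points of the fibre product correspond to those values of `(G, y, z)` whose first component
  -- is `0`; `a` inserts this zero.
  let a : Eu k × Eu (l₁ + l₂) → (Eu n × Eu k) × (Eu l₁ × Eu l₂) := fun z =>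
    ((0, z.1), (appendEquiv l₁ l₂).symm z.2)
  have ha : Continuous a := by fun_prop
  have hea : ∀ z, a z ∈ e.target → G (e.symm (a z)) = (0, z.1) ∧
      (e.symm (a z)).2 = (appendEquiv l₁ l₂).symm z.2 := fun z hz => by
    have := e.right_inv hz
    rw [he] at this
    exact Prod.ext_iff.1 this
  -- The first component of `G` vanishes and `ψ` is injective, hence `F₁ = F₂`; transversality
  -- persists because the leaf derivative of `G` is invertible on the whole source of `e`.
  have hX : ∀ z, a z ∈ e.target → J' (e.symm (a z)) ∈ fibreSet n A₁ A₂ U₁ U₂ F₁ F₂ := by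
    intro z hz
    have hm := heΩ (e.map_target hz)
    have hi := hinv _ (e.map_target hz)
    rw [hG' _ hm] at hi
    have h0 := congr_arg Prod.fst (hea z hz).1
    refine ⟨hm.1.2.1, hm.2.2.1, ψ.injOn hm.1.2.2 hm.2.2.2 (sub_eq_zero.1 h0), φ₁, φ₂, hφ₁, hφ₂,
      φ₁.map_target hm.1.1, φ₂.map_target hm.2.1, ψ, hψ, hm.1.2.2, ?_⟩
    simp only [mapDeriv, J', φ₁.right_inv hm.1.1, φ₂.right_inv hm.2.1]
    exact range_sup_eq_top_of_bijective (bijective_of_isInvertible hi).2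
  have hJG : ∀ w : fibreSet n A₁ A₂ U₁ U₂ F₁ F₂, w.1.1 ∈ φ₁.source → w.1.2 ∈ φ₂.source →
      e (J w.1) = a (C ((φ₁ w.1.1).1, (φ₂ w.1.2).1), appendCoord (φ₁ w.1.1).2 (φ₂ w.1.2).2) := by
    intro w h h'
    rw [he]
    simp [a, G, H₁, H₂, J, φ₁.left_inv h, φ₂.left_inv h', w.2.2.2.1, appendEquiv_symm_appendCoord]
  have hJc : ContinuousOn (fun w : fibreSet n A₁ A₂ U₁ U₂ F₁ F₂ => J w.1)
      {w | w.1.1 ∈ φ₁.source ∧ w.1.2 ∈ φ₂.source} := by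
    have c1 : ContinuousOn (fun w : fibreSet n A₁ A₂ U₁ U₂ F₁ F₂ => φ₁ w.1.1)
        {w | w.1.1 ∈ φ₁.source ∧ w.1.2 ∈ φ₂.source} :=
      φ₁.continuousOn.comp (continuous_fst.comp continuous_subtype_val).continuousOn fun w h => h.1
    have c2 : ContinuousOn (fun w : fibreSet n A₁ A₂ U₁ U₂ F₁ F₂ => φ₂ w.1.2)
        {w | w.1.1 ∈ φ₁.source ∧ w.1.2 ∈ φ₂.source} :=
      φ₂.continuousOn.comp (continuous_snd.comp continuous_subtype_val).continuousOn fun w h => h.2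
    exact (c1.fst.prodMk c2.fst).prodMk (c1.snd.prodMk c2.snd)
  classical
  let θ : OpenPartialHomeomorph (fibreSet n A₁ A₂ U₁ U₂ F₁ F₂) (Eu k × Eu (l₁ + l₂)) :=
    { toFun := fun w =>
        (C ((φ₁ w.1.1).1, (φ₂ w.1.2).1), appendCoord (φ₁ w.1.1).2 (φ₂ w.1.2).2)
      -- Outside of the target the value is irrelevant, and the base point `w` serves as default.
      invFun := fun z => if h : a z ∈ e.target then ⟨J' (e.symm (a z)), hX z h⟩ else w
      source := {w | w.1.1 ∈ φ₁.source ∧ w.1.2 ∈ φ₂.source} ∩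
        (fun w : fibreSet n A₁ A₂ U₁ U₂ F₁ F₂ => J w.1) ⁻¹' e.source
      target := a ⁻¹' e.target
      map_source' := fun w hw => by
        rw [mem_preimage, ← hJG w hw.1.1 hw.1.2]
        exact e.map_source hw.2
      map_target' := fun z hz => by
        have hz' : a z ∈ e.target := hz
        have hm := heΩ (e.map_target hz')
        rw [dif_pos hz']
        refine ⟨⟨φ₁.map_target hm.1.1, φ₂.map_target hm.2.1⟩, ?_⟩
        rw [mem_preimage, hJJ' _ hm]
        exact e.map_target hz'
      left_inv' := fun w hw => by
        have h := hJG w hw.1.1 hw.1.2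
        have h' := e.map_source hw.2
        simp only at h'
        rw [h] at h'
        rw [dif_pos h']
        refine Subtype.ext ?_
        change J' (e.symm _) = w.1
        rw [← h, e.left_inv hw.2, hJ'J _ hw.1.1 hw.1.2]
      right_inv' := fun z hz => by
        have hz' : a z ∈ e.target := hz
        have hm := heΩ (e.map_target hz')
        rw [dif_pos hz']
        have h1 := φ₁.right_inv hm.1.1
        have h2 := φ₂.right_inv hm.2.1
        obtain ⟨h3, h4⟩ := hea z hz'
        simp only [J', h1, h2]
        refine Prod.ext (congr_arg Prod.snd h3) ?_
        change appendEquiv l₁ l₂ (e.symm (a z)).2 = z.2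
        rw [h4, ContinuousLinearEquiv.apply_symm_apply]
      open_source := by
        refine hJc.isOpen_inter_preimage ?_ e.open_source
        exact (φ₁.open_source.preimage (continuous_fst.comp continuous_subtype_val)).inter
          (φ₂.open_source.preimage (continuous_snd.comp continuous_subtype_val))
      open_target := e.open_target.preimage ha
      continuousOn_toFun := by
        refine ContinuousOn.mono (s := {w | w.1.1 ∈ φ₁.source ∧ w.1.2 ∈ φ₂.source}) ?_
          inter_subset_left
        exact (C.continuous.comp_continuousOn hJc.fst).prodMk
          ((appendEquiv l₁ l₂).continuous.comp_continuousOn hJc.snd)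
      continuousOn_invFun := by
        rw [IsInducing.subtypeVal.continuousOn_iff]
        have hc : ContinuousOn (fun z => e.symm (a z)) (a ⁻¹' e.target) :=
          e.continuousOn_symm.comp ha.continuousOn fun z hz => hz
        have hc1 : ContinuousOn (fun z => J' (e.symm (a z))) (a ⁻¹' e.target) :=
          (φ₁.continuousOn_symm.comp (hc.fst.fst.prodMk hc.snd.fst)
            fun z hz => (heΩ (e.map_target hz)).1.1).prodMk
          (φ₂.continuousOn_symm.comp (hc.fst.snd.prodMk hc.snd.snd)
            fun z hz => (heΩ (e.map_target hz)).2.1)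
        refine hc1.congr fun z hz => ?_
        have hz' : a z ∈ e.target := hz
        simp only [Function.comp_apply, dif_pos hz'] }
  have hθs : ∀ z ∈ θ.target, (θ.symm z).1 = J' (e.symm (a z)) := fun z hz => by
    have hz' : a z ∈ e.target := hz
    have : θ.symm z = ⟨J' (e.symm (a z)), hX z hz'⟩ := dif_pos hz'
    rw [this]
  have hcl : IsClassCrs r s (fun z : Eu k × Eu (l₁ + l₂) => (e.symm (a z)).1) θ.target := by
    refine hes.comp (g := fun z => (0, z.1)) (Y := (appendEquiv l₁ l₂).symm) θ.open_target ?_ ?_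
      fun z hz => hz
    · exact .of_leaf (α := fun x => ((0 : Eu n), x)) θ.open_target (by fun_prop)
    · exact ((appendEquiv l₁ l₂).symm.contDiff.comp contDiff_snd).contDiffOn
  refine ⟨C, θ, ⟨fun w hw => hw.1.1, fun w hw => hw.1.2, fun w hw => ?_, fun w hw => rfl,
    fun w hw => rfl, ?_, ?_, fun w hw => ?_⟩, ⟨⟨hw₁, hw₂⟩, hwe⟩⟩
  · have := (heΩ hw.2).1.2.2
    simpa [J, φ₁.left_inv hw.1.1] using this
  · refine (hcl.clm_comp (.fst ℝ (Eu k₁) (Eu k₂)) θ.open_target).congr θ.open_target fun z hz => ?_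
    have hm := heΩ (e.map_target (show a z ∈ e.target from hz))
    simp only [hθs z hz, J', φ₁.right_inv hm.1.1]
    rfl
  · refine (hcl.clm_comp (.snd ℝ (Eu k₁) (Eu k₂)) θ.open_target).congr θ.open_target fun z hz => ?_
    have hm := heΩ (e.map_target (show a z ∈ e.target from hz))
    simp only [hθs z hz, J', φ₂.right_inv hm.2.1]
    rfl
  · have hi := hinv _ hw.2
    rw [hG' _ (heΩ hw.2)] at hi
    exact bijective_of_isInvertible hi

end FibreProduct

/-! ### Changes between adapted charts, and leaf paths of the fibre product -/

section FibreAtlas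

variable {n k k₁ k₂ l₁ l₂ : ℕ} {r s : WithTop ℕ∞} {M : Type w} [TopologicalSpace M]
  [ChartedSpace (Eu n) M] {W₁ : Type u} [TopologicalSpace W₁] {W₂ : Type v} [TopologicalSpace W₂]
  {A₁ : FoliatedAtlas k₁ l₁ r s W₁} {A₂ : FoliatedAtlas k₂ l₂ r s W₂} {U₁ : Set W₁}
  {U₂ : Set W₂} {F₁ : W₁ → M} {F₂ : W₂ → M}
  {φ₁ φ₁' : OpenPartialHomeomorph W₁ (Eu k₁ × Eu l₁)}
  {φ₂ φ₂' : OpenPartialHomeomorph W₂ (Eu k₂ × Eu l₂)} {ψ ψ' : OpenPartialHomeomorph M (Eu n)}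

namespace IsAdapted

variable {X : Set (W₁ × W₂)} {C C' : Eu k₁ × Eu k₂ →L[ℝ] Eu k}
  {θ θ' : OpenPartialHomeomorph X (Eu k × Eu (l₁ + l₂))}

theorem snd_eq (h : IsAdapted r s F₁ F₂ φ₁ φ₂ ψ C θ) {z : Eu k × Eu (l₁ + l₂)}
    (hz : z ∈ θ.target) : (appendEquiv l₁ l₂).symm z.2 =
      ((φ₁ (θ.symm z).1.1).2, (φ₂ (θ.symm z).1.2).2) := by
  have := h.trans _ (θ.map_target hz)
  rw [θ.right_inv hz] at this
  rw [this, appendEquiv_symm_appendCoord]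

theorem continuousOn_fst (h : IsAdapted r s F₁ F₂ φ₁ φ₂ ψ C θ) :
    ContinuousOn (fun z => φ₁ (θ.symm z).1.1) θ.target :=
  φ₁.continuousOn.comp ((continuous_fst.comp continuous_subtype_val).comp_continuousOn
    θ.continuousOn_symm) fun _ hz => h.mem_fst _ (θ.map_target hz)

theorem continuousOn_snd (h : IsAdapted r s F₁ F₂ φ₁ φ₂ ψ C θ) :
    ContinuousOn (fun z => φ₂ (θ.symm z).1.2) θ.target :=
  φ₂.continuousOn.comp ((continuous_snd.comp continuous_subtype_val).comp_continuousOn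
    θ.continuousOn_symm) fun _ hz => h.mem_snd _ (θ.map_target hz)

theorem class_comp_fst (h : IsAdapted r s F₁ F₂ φ₁ φ₂ ψ C θ) {G : Type} [NormedAddCommGroup G]
    [NormedSpace ℝ G] {g : Eu k₁ × Eu l₁ → G} {O : Set (Eu k₁ × Eu l₁)} (hg : IsClassCrs r s g O)
    {U : Set (Eu k × Eu (l₁ + l₂))} (hU : IsOpen U) (hUθ : U ⊆ θ.target)
    (hO : ∀ z ∈ U, φ₁ (θ.symm z).1.1 ∈ O) :
    IsClassCrs r s (fun z => g (φ₁ (θ.symm z).1.1)) U := by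
  have e : ∀ z ∈ U, ((φ₁ (θ.symm z).1.1).1, ((appendEquiv l₁ l₂).symm z.2).1) =
      φ₁ (θ.symm z).1.1 := fun z hz => by rw [h.snd_eq (hUθ hz)]
  refine (hg.comp (Y := fun y => ((appendEquiv l₁ l₂).symm y).1) hU (h.class_fst.mono hUθ) ?_
    fun z hz => ?_).congr hU fun z hz => ?_
  · exact ((contDiff_fst.comp (appendEquiv l₁ l₂).symm.contDiff).comp contDiff_snd).contDiffOn
  · rw [e z hz]
    exact hO z hz
  · simp only [e z hz]

theorem class_comp_snd (h : IsAdapted r s F₁ F₂ φ₁ φ₂ ψ C θ) {G : Type} [NormedAddCommGroup G]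
    [NormedSpace ℝ G] {g : Eu k₂ × Eu l₂ → G} {O : Set (Eu k₂ × Eu l₂)} (hg : IsClassCrs r s g O)
    {U : Set (Eu k × Eu (l₁ + l₂))} (hU : IsOpen U) (hUθ : U ⊆ θ.target)
    (hO : ∀ z ∈ U, φ₂ (θ.symm z).1.2 ∈ O) :
    IsClassCrs r s (fun z => g (φ₂ (θ.symm z).1.2)) U := by
  have e : ∀ z ∈ U, ((φ₂ (θ.symm z).1.2).1, ((appendEquiv l₁ l₂).symm z.2).2) =
      φ₂ (θ.symm z).1.2 := fun z hz => by rw [h.snd_eq (hUθ hz)]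
  refine (hg.comp (Y := fun y => ((appendEquiv l₁ l₂).symm y).2) hU (h.class_snd.mono hUθ) ?_
    fun z hz => ?_).congr hU fun z hz => ?_
  · exact ((contDiff_snd.comp (appendEquiv l₁ l₂).symm.contDiff).comp contDiff_snd).contDiffOn
  · rw [e z hz]
    exact hO z hz
  · simp only [e z hz]

/-- The inverse of `θ` has components of class `C^{r,s}` in the charts `φ₁`, `φ₂`; the changes of
charts in the factors are foliated, and the new leaf coordinate is the linear map `C'` of the
resulting leaf coordinates. The transverse part is the product of the transverse parts of the
factors. -/
theorem isFoliatedOn (h : IsAdapted r s F₁ F₂ φ₁ φ₂ ψ C θ)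
    (h' : IsAdapted r s F₁ F₂ φ₁' φ₂' ψ' C' θ') {U : Set (Eu k × Eu (l₁ + l₂))} (hU : IsOpen U)
    (hUθ : U ⊆ (θ.symm.trans θ').source) {O₁ : Set (Eu k₁ × Eu l₁)} {O₂ : Set (Eu k₂ × Eu l₂)}
    (h₁ : IsFoliatedOn r s (φ₁.symm.trans φ₁') O₁) (h₂ : IsFoliatedOn r s (φ₂.symm.trans φ₂') O₂)
    (hO₁ : ∀ z ∈ U, φ₁ (θ.symm z).1.1 ∈ O₁) (hO₂ : ∀ z ∈ U, φ₂ (θ.symm z).1.2 ∈ O₂) :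
    IsFoliatedOn r s (θ.symm.trans θ') U := by
  obtain ⟨X₁, Y₁, hX₁, hY₁, hg₁⟩ := h₁
  obtain ⟨X₂, Y₂, hX₂, hY₂, hg₂⟩ := h₂
  have hUt : U ⊆ θ.target := fun z hz => (hUθ hz).1
  have hm : ∀ z ∈ U, θ.symm z ∈ θ'.source := fun z hz => (hUθ hz).2
  have e₁ : ∀ z ∈ U, φ₁' (θ.symm z).1.1 =
      (X₁ (φ₁ (θ.symm z).1.1), Y₁ (φ₁ (θ.symm z).1.1).2) := fun z hz => by
    rw [← hg₁ _ (hO₁ z hz)]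
    simp [φ₁.left_inv (h.mem_fst _ (θ.map_target (hUt hz)))]
  have e₂ : ∀ z ∈ U, φ₂' (θ.symm z).1.2 =
      (X₂ (φ₂ (θ.symm z).1.2), Y₂ (φ₂ (θ.symm z).1.2).2) := fun z hz => by
    rw [← hg₂ _ (hO₂ z hz)]
    simp [φ₂.left_inv (h.mem_snd _ (θ.map_target (hUt hz)))]
  refine ⟨fun z => C' (X₁ (φ₁ (θ.symm z).1.1), X₂ (φ₂ (θ.symm z).1.2)),
    fun y => appendEquiv l₁ l₂ (Y₁ ((appendEquiv l₁ l₂).symm y).1,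
      Y₂ ((appendEquiv l₁ l₂).symm y).2), ?_, ?_, fun z hz => ?_⟩
  · exact ((h.class_comp_fst hX₁ hU hUt hO₁).prodMk hU
      (h.class_comp_snd hX₂ hU hUt hO₂)).clm_comp C' hU
  · refine (appendEquiv l₁ l₂).contDiff.comp_contDiffOn (.prodMk ?_ ?_)
    · refine hY₁.comp (contDiff_fst.comp (appendEquiv l₁ l₂).symm.contDiff).contDiffOn ?_
      rintro _ ⟨z, hz, rfl⟩
      exact ⟨_, hO₁ z hz, by simp only [h.snd_eq (hUt hz)]⟩
    · refine hY₂.comp (contDiff_snd.comp (appendEquiv l₁ l₂).symm.contDiff).contDiffOn ?_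
      rintro _ ⟨z, hz, rfl⟩
      exact ⟨_, hO₂ z hz, by simp only [h.snd_eq (hUt hz)]⟩
  · refine Prod.ext ?_ ?_
    · refine (h'.leaf _ (hm z hz)).trans ?_
      rw [e₁ z hz, e₂ z hz]
    · refine (h'.trans _ (hm z hz)).trans ?_
      simp only [e₁ z hz, e₂ z hz, h.snd_eq (hUt hz), appendEquiv_apply]

theorem isLocallyFoliatedOn (h : IsAdapted r s F₁ F₂ φ₁ φ₂ ψ C θ)
    (h' : IsAdapted r s F₁ F₂ φ₁' φ₂' ψ' C' θ') (hφ₁ : A₁.IsFlowChart φ₁)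
    (hφ₁' : A₁.IsFlowChart φ₁') (hφ₂ : A₂.IsFlowChart φ₂) (hφ₂' : A₂.IsFlowChart φ₂') :
    IsLocallyFoliatedOn r s (θ.symm.trans θ') (θ.symm.trans θ').source := by
  have hO₁ : ∀ z ∈ (θ.symm.trans θ').source,
      φ₁ (θ.symm z).1.1 ∈ (φ₁.symm.trans φ₁').source := fun z hz => by
    have h1 := h.mem_fst _ (θ.map_target hz.1)
    exact ⟨φ₁.map_source h1, by simpa [φ₁.left_inv h1] using h'.mem_fst _ hz.2⟩
  have hO₂ : ∀ z ∈ (θ.symm.trans θ').source,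
      φ₂ (θ.symm z).1.2 ∈ (φ₂.symm.trans φ₂').source := fun z hz => by
    have h1 := h.mem_snd _ (θ.map_target hz.1)
    exact ⟨φ₂.map_source h1, by simpa [φ₂.left_inv h1] using h'.mem_snd _ hz.2⟩
  intro z hz
  obtain ⟨V₁, hV₁, hzV₁, h₁⟩ := hφ₁.locallyFoliated hφ₁' _ (hO₁ z hz)
  obtain ⟨V₂, hV₂, hzV₂, h₂⟩ := hφ₂.locallyFoliated hφ₂' _ (hO₂ z hz)
  have ho := (θ.symm.trans θ').open_source
  have hst : (θ.symm.trans θ').source ⊆ θ.target := fun z hz => hz.1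
  refine ⟨_, ((h.continuousOn_fst.mono hst).isOpen_inter_preimage ho hV₁).inter
    ((h.continuousOn_snd.mono hst).isOpen_inter_preimage ho hV₂), ⟨⟨hz, hzV₁⟩, hz, hzV₂⟩, ?_⟩
  refine h.isFoliatedOn h' (ho.inter (((h.continuousOn_fst.mono hst).isOpen_inter_preimage ho
    hV₁).inter ((h.continuousOn_snd.mono hst).isOpen_inter_preimage ho hV₂)))
    inter_subset_left h₁ h₂ (fun z hz => ⟨hO₁ z hz.1, hz.2.1.2⟩)
    fun z hz => ⟨hO₂ z hz.1, hz.2.2.2⟩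

end IsAdapted

/-- The foliated atlas of the fibre product. -/
def fibreAtlas (hr : 1 ≤ r) (hk : k + n = k₁ + k₂) (h₁ : A₁.IsClassCrsMap n U₁ F₁)
    (h₂ : A₂.IsClassCrsMap n U₂ F₂) :
    FoliatedAtlas k (l₁ + l₂) r s (fibreSet n A₁ A₂ U₁ U₂ F₁ F₂) where
  charts := {θ | ∃ φ₁ ∈ A₁.charts, ∃ φ₂ ∈ A₂.charts, ∃ ψ ∈ atlas (Eu n) M, ∃ C,
    IsAdapted r s F₁ F₂ φ₁ φ₂ ψ C θ}
  cover := fun w => by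
    obtain ⟨hU₁, hU₂, -, φ₁, φ₂, hφ₁, hφ₂, hw₁, hw₂, ψ, hψ, hwψ, htr⟩ := w.2
    have hwψ₂ : F₂ w.1.2 ∈ ψ.source := by rwa [← w.2.2.2.1]
    obtain ⟨χ₁, hχ₁, hwχ₁⟩ := A₁.cover w.1.1
    obtain ⟨χ₂, hχ₂, hwχ₂⟩ := A₂.cover w.1.2
    have hχ₁' := FoliatedAtlas.isFlowChart_of_mem hχ₁
    have hχ₂' := FoliatedAtlas.isFlowChart_of_mem hχ₂
    rw [mapDeriv_range_change hr h₁ hφ₁ hχ₁' hψ hU₁ hwψ hw₁ hwχ₁,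
      mapDeriv_range_change hr h₂ hφ₂ hχ₂' hψ hU₂ hwψ₂ hw₂ hwχ₂] at htr
    obtain ⟨C, θ, hθ, hwθ⟩ := exists_isAdapted hr hk h₁ h₂ hχ₁' hχ₂' hψ w hwχ₁ hwχ₂ hwψ htr
    exact ⟨θ, ⟨χ₁, hχ₁, χ₂, hχ₂, ψ, hψ, C, hθ⟩, hwθ⟩
  compat := by
    rintro θ ⟨φ₁, hφ₁, φ₂, hφ₂, ψ, hψ, C, hθ⟩ θ' ⟨φ₁', hφ₁', φ₂', hφ₂', ψ', hψ', C', hθ'⟩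
    refine hθ.isFoliatedOn hθ' (θ.symm.trans θ').open_source subset_rfl
      (A₁.compat φ₁ hφ₁ φ₁' hφ₁') (A₂.compat φ₂ hφ₂ φ₂' hφ₂') (fun z hz => ?_) fun z hz => ?_
    · have h1 := hθ.mem_fst _ (θ.map_target hz.1)
      exact ⟨φ₁.map_source h1, by simpa [φ₁.left_inv h1] using hθ'.mem_fst _ hz.2⟩
    · have h1 := hθ.mem_snd _ (θ.map_target hz.1)
      exact ⟨φ₂.map_source h1, by simpa [φ₂.left_inv h1] using hθ'.mem_snd _ hz.2⟩

variable (hr : 1 ≤ r) (hk : k + n = k₁ + k₂) (h₁ : A₁.IsClassCrsMap n U₁ F₁)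
  (h₂ : A₂.IsClassCrsMap n U₂ F₂)

theorem IsAdapted.isFlowChart {C : Eu k₁ × Eu k₂ →L[ℝ] Eu k}
    {θ : OpenPartialHomeomorph (fibreSet n A₁ A₂ U₁ U₂ F₁ F₂) (Eu k × Eu (l₁ + l₂))}
    (h : IsAdapted r s F₁ F₂ φ₁ φ₂ ψ C θ) (hφ₁ : A₁.IsFlowChart φ₁) (hφ₂ : A₂.IsFlowChart φ₂) :
    (fibreAtlas hr hk h₁ h₂).IsFlowChart θ := by
  rintro θ' ⟨φ₁', hφ₁', φ₂', hφ₂', ψ', hψ', C', hθ'⟩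
  have hφ₁' := FoliatedAtlas.isFlowChart_of_mem hφ₁'
  have hφ₂' := FoliatedAtlas.isFlowChart_of_mem hφ₂'
  exact ⟨h.isLocallyFoliatedOn hθ' hφ₁ hφ₁' hφ₂ hφ₂', hθ'.isLocallyFoliatedOn h hφ₁' hφ₁ hφ₂' hφ₂⟩

/-- The transverse coordinate of an adapted chart is the pair of transverse coordinates of the
factors, so it is locally constant along a path only if both of them are. -/
theorem isLeafPath_fibre {γ : I → fibreSet n A₁ A₂ U₁ U₂ F₁ F₂}
    (hγ : (fibreAtlas hr hk h₁ h₂).IsLeafPath γ) :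
    A₁.IsLeafPath (fun t => (γ t).1.1) ∧ A₂.IsLeafPath (fun t => (γ t).1.2) := by
  have key : ∀ t, ∃ φ₁ ∈ A₁.charts, ∃ φ₂ ∈ A₂.charts, (γ t).1.1 ∈ φ₁.source ∧
      (γ t).1.2 ∈ φ₂.source ∧ ∀ᶠ t' in 𝓝 t, (φ₁ (γ t').1.1).2 = (φ₁ (γ t).1.1).2 ∧
        (φ₂ (γ t').1.2).2 = (φ₂ (γ t).1.2).2 := by
    intro t
    obtain ⟨θ, hθ, htθ⟩ := (fibreAtlas hr hk h₁ h₂).cover (γ t)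
    have hev := hγ.2 θ hθ t htθ
    obtain ⟨φ₁, hφ₁, φ₂, hφ₂, ψ, hψ, C, hθ⟩ := hθ
    refine ⟨φ₁, hφ₁, φ₂, hφ₂, hθ.mem_fst _ htθ, hθ.mem_snd _ htθ, ?_⟩
    filter_upwards [hev, hγ.1.continuousAt.preimage_mem_nhds (θ.open_source.mem_nhds htθ)]
      with t' h1 h2
    rw [hθ.trans _ htθ, hθ.trans _ h2] at h1
    have h3 := congr_arg (appendEquiv l₁ l₂).symm h1
    rw [appendEquiv_symm_appendCoord, appendEquiv_symm_appendCoord] at h3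
    exact Prod.ext_iff.1 h3
  constructor
  · refine FoliatedAtlas.isLeafPath_of_eventually_eq
      ((continuous_fst.comp continuous_subtype_val).comp hγ.1) fun t => ?_
    obtain ⟨φ₁, hφ₁, _, _, h1, _, h⟩ := key t
    exact ⟨φ₁, FoliatedAtlas.isFlowChart_of_mem hφ₁, h1, h.mono fun _ h => h.1⟩
  · refine FoliatedAtlas.isLeafPath_of_eventually_eq
      ((continuous_snd.comp continuous_subtype_val).comp hγ.1) fun t => ?_
    obtain ⟨_, _, φ₂, hφ₂, _, h1, h⟩ := key t
    exact ⟨φ₂, FoliatedAtlas.isFlowChart_of_mem hφ₂, h1, h.mono fun _ h => h.2⟩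

end FibreAtlas

/-! ### The solenoid structure of the fibre product -/

section FibreDerivative

variable {n k k₁ k₂ l₁ l₂ : ℕ} {r s : WithTop ℕ∞} {M : Type w} [TopologicalSpace M]
  [ChartedSpace (Eu n) M] {W₁ : Type u} [TopologicalSpace W₁] {W₂ : Type v} [TopologicalSpace W₂]
  {A₁ : FoliatedAtlas k₁ l₁ r s W₁} {A₂ : FoliatedAtlas k₂ l₂ r s W₂} {U₁ : Set W₁}
  {U₂ : Set W₂} {F₁ : W₁ → M} {F₂ : W₂ → M}
  {φ₁ : OpenPartialHomeomorph W₁ (Eu k₁ × Eu l₁)}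
  {φ₂ : OpenPartialHomeomorph W₂ (Eu k₂ × Eu l₂)} {ψ ψ' : OpenPartialHomeomorph M (Eu n)}

namespace IsAdapted

variable {X : Set (W₁ × W₂)} {C : Eu k₁ × Eu k₂ →L[ℝ] Eu k}
  {θ : OpenPartialHomeomorph X (Eu k × Eu (l₁ + l₂))}

theorem leafDeriv_fst (h : IsAdapted r s F₁ F₂ φ₁ φ₂ ψ C θ) (hr : 1 ≤ r) {G : Type}
    [NormedAddCommGroup G] [NormedSpace ℝ G] {g : W₁ → G} {O : Set (Eu k₁ × Eu l₁)}
    (hg : IsClassCrs r s (fun z => g (φ₁.symm z)) O) {w : X} (hw : w ∈ θ.source)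
    (hO : φ₁ w.1.1 ∈ O) : leafDeriv (fun z => g (θ.symm z).1.1) (θ w) =
      (leafDeriv (fun z => g (φ₁.symm z)) (φ₁ w.1.1)).comp
        (leafDeriv (fun z => (φ₁ (θ.symm z).1.1).1) (θ w)) := by
  have hθw := θ.map_source hw
  have e : ∀ z ∈ θ.target, ((φ₁ (θ.symm z).1.1).1, ((appendEquiv l₁ l₂).symm z.2).1) =
      φ₁ (θ.symm z).1.1 := fun z hz => by rw [h.snd_eq hz]
  have hew := e _ hθw
  rw [θ.left_inv hw] at hew
  have := leafDeriv_comp (Y := fun y => ((appendEquiv l₁ l₂).symm y).1) hr hg h.class_fst hθw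
    (by rw [θ.left_inv hw, hew]; exact hO)
  rw [θ.left_inv hw, hew] at this
  rw [← this]
  refine leafDeriv_congr θ.open_target (fun z hz => ?_) hθw
  simp only [e z hz, φ₁.left_inv (h.mem_fst _ (θ.map_target hz))]

theorem leafDeriv_snd (h : IsAdapted r s F₁ F₂ φ₁ φ₂ ψ C θ) (hr : 1 ≤ r) {G : Type}
    [NormedAddCommGroup G] [NormedSpace ℝ G] {g : W₂ → G} {O : Set (Eu k₂ × Eu l₂)}
    (hg : IsClassCrs r s (fun z => g (φ₂.symm z)) O) {w : X} (hw : w ∈ θ.source)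
    (hO : φ₂ w.1.2 ∈ O) : leafDeriv (fun z => g (θ.symm z).1.2) (θ w) =
      (leafDeriv (fun z => g (φ₂.symm z)) (φ₂ w.1.2)).comp
        (leafDeriv (fun z => (φ₂ (θ.symm z).1.2).1) (θ w)) := by
  have hθw := θ.map_source hw
  have e : ∀ z ∈ θ.target, ((φ₂ (θ.symm z).1.2).1, ((appendEquiv l₁ l₂).symm z.2).2) =
      φ₂ (θ.symm z).1.2 := fun z hz => by rw [h.snd_eq hz]
  have hew := e _ hθw
  rw [θ.left_inv hw] at hew
  have := leafDeriv_comp (Y := fun y => ((appendEquiv l₁ l₂).symm y).2) hr hg h.class_snd hθw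
    (by rw [θ.left_inv hw, hew]; exact hO)
  rw [θ.left_inv hw, hew] at this
  rw [← this]
  refine leafDeriv_congr θ.open_target (fun z hz => ?_) hθw
  simp only [e z hz, φ₂.left_inv (h.mem_snd _ (θ.map_target hz))]

theorem mapDeriv_fst (h : IsAdapted r s F₁ F₂ φ₁ φ₂ ψ C θ) (hr : 1 ≤ r)
    (h₁ : A₁.IsClassCrsMap n U₁ F₁) (hφ₁ : A₁.IsFlowChart φ₁) (hψ' : ψ' ∈ atlas (Eu n) M)
    {w : X} (hw : w ∈ θ.source) (hwU : w.1.1 ∈ U₁) (hwψ : F₁ w.1.1 ∈ ψ'.source) :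
    mapDeriv (fun w : X => F₁ w.1.1) θ ψ' w = (mapDeriv F₁ φ₁ ψ' w.1.1).comp
      (leafDeriv (fun z => (φ₁ (θ.symm z).1.1).1) (θ w)) := by
  have h1 := h.mem_fst w hw
  exact h.leafDeriv_fst hr (g := fun w => ψ' (F₁ w)) (h₁.classCrs_of_isFlowChart hφ₁ hψ') hw
    ⟨φ₁.map_source h1, by simpa [φ₁.left_inv h1] using ⟨hwU, hwψ⟩⟩

theorem mapDeriv_snd (h : IsAdapted r s F₁ F₂ φ₁ φ₂ ψ C θ) (hr : 1 ≤ r)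
    (h₂ : A₂.IsClassCrsMap n U₂ F₂) (hφ₂ : A₂.IsFlowChart φ₂) (hψ' : ψ' ∈ atlas (Eu n) M)
    {w : X} (hw : w ∈ θ.source) (hwU : w.1.2 ∈ U₂) (hwψ : F₂ w.1.2 ∈ ψ'.source) :
    mapDeriv (fun w : X => F₂ w.1.2) θ ψ' w = (mapDeriv F₂ φ₂ ψ' w.1.2).comp
      (leafDeriv (fun z => (φ₂ (θ.symm z).1.2).1) (θ w)) := by
  have h1 := h.mem_snd w hw
  exact h.leafDeriv_snd hr (g := fun w => ψ' (F₂ w)) (h₂.classCrs_of_isFlowChart hφ₂ hψ') hw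
    ⟨φ₂.map_source h1, by simpa [φ₂.left_inv h1] using ⟨hwU, hwψ⟩⟩

/-- The leafwise derivative of a change between adapted charts. -/
theorem leafTransition_apply (h : IsAdapted r s F₁ F₂ φ₁ φ₂ ψ C θ) (hr : 1 ≤ r)
    {φ₁' : OpenPartialHomeomorph W₁ (Eu k₁ × Eu l₁)}
    {φ₂' : OpenPartialHomeomorph W₂ (Eu k₂ × Eu l₂)} {C' : Eu k₁ × Eu k₂ →L[ℝ] Eu k}
    {θ' : OpenPartialHomeomorph X (Eu k × Eu (l₁ + l₂))}
    (h' : IsAdapted r s F₁ F₂ φ₁' φ₂' ψ' C' θ') (hφ₁ : A₁.IsFlowChart φ₁)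
    (hφ₁' : A₁.IsFlowChart φ₁') (hφ₂ : A₂.IsFlowChart φ₂) (hφ₂' : A₂.IsFlowChart φ₂')
    {w : X} (hw : w ∈ θ.source) (hw' : w ∈ θ'.source) (x : Eu k) :
    FoliatedAtlas.leafTransition θ θ' w x = C'
      (FoliatedAtlas.leafTransition φ₁ φ₁' w.1.1
        (leafDeriv (fun z => (φ₁ (θ.symm z).1.1).1) (θ w) x),
      FoliatedAtlas.leafTransition φ₂ φ₂' w.1.2
        (leafDeriv (fun z => (φ₂ (θ.symm z).1.2).1) (θ w) x)) := by
  have hU := (θ.symm.trans θ').open_source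
  have hUw : θ w ∈ (θ.symm.trans θ').source :=
    ⟨θ.map_source hw, by simpa [θ.left_inv hw] using hw'⟩
  have hO₁ : ∀ z ∈ (θ.symm.trans θ').source,
      φ₁ (θ.symm z).1.1 ∈ (φ₁.symm.trans φ₁').source := fun z hz => by
    have h1 := h.mem_fst _ (θ.map_target hz.1)
    exact ⟨φ₁.map_source h1, by simpa [φ₁.left_inv h1] using h'.mem_fst _ hz.2⟩
  have hO₂ : ∀ z ∈ (θ.symm.trans θ').source,
      φ₂ (θ.symm z).1.2 ∈ (φ₂.symm.trans φ₂').source := fun z hz => by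
    have h1 := h.mem_snd _ (θ.map_target hz.1)
    exact ⟨φ₂.map_source h1, by simpa [φ₂.left_inv h1] using h'.mem_snd _ hz.2⟩
  have hc₁ := (h.class_comp_fst (hφ₁.classCrs_fst hφ₁') hU (fun z hz => hz.1) hO₁).congr hU
    (g := fun z => (φ₁' (θ.symm z).1.1).1) fun z hz => by
      simp only [φ₁.left_inv (h.mem_fst _ (θ.map_target hz.1))]
  have hc₂ := (h.class_comp_snd (hφ₂.classCrs_fst hφ₂') hU (fun z hz => hz.1) hO₂).congr hU
    (g := fun z => (φ₂' (θ.symm z).1.2).1) fun z hz => by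
      simp only [φ₂.left_inv (h.mem_snd _ (θ.map_target hz.1))]
  have hO₁w := hO₁ _ hUw
  have hO₂w := hO₂ _ hUw
  rw [θ.left_inv hw] at hO₁w hO₂w
  have e₁ := h.leafDeriv_fst hr (g := fun w => (φ₁' w).1) (hφ₁.classCrs_fst hφ₁') hw hO₁w
  have e₂ := h.leafDeriv_snd hr (g := fun w => (φ₂' w).1) (hφ₂.classCrs_fst hφ₂') hw hO₂w
  have hd := C'.hasFDerivAt.comp (θ w).1 ((hc₁.hasFDerivAt hr hUw).prodMk (hc₂.hasFDerivAt hr hUw))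
  rw [e₁, e₂] at hd
  have e₃ : EqOn (fun z => (θ' (θ.symm z)).1)
      (fun z => C' ((φ₁' (θ.symm z).1.1).1, (φ₂' (θ.symm z).1.2).1)) (θ.symm.trans θ').source :=
    fun z hz => h'.leaf _ hz.2
  rw [FoliatedAtlas.leafTransition, leafDeriv_congr hU e₃ hUw]
  exact DFunLike.congr_fun hd.fderiv x

/-- The leaf coordinate of `θ` is `C` of the leaf coordinates of the factors; differentiate this
identity along the plaque. -/
theorem leafDeriv_leaf (h : IsAdapted r s F₁ F₂ φ₁ φ₂ ψ C θ) (hr : 1 ≤ r)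
    {w : X} (hw : w ∈ θ.source) (x : Eu k) :
    C (leafDeriv (fun z => (φ₁ (θ.symm z).1.1).1) (θ w) x,
      leafDeriv (fun z => (φ₂ (θ.symm z).1.2).1) (θ w) x) = x := by
  have hθw := θ.map_source hw
  have h1 := C.hasFDerivAt.comp (θ w).1 ((h.class_fst.hasFDerivAt hr hθw).prodMk
    (h.class_snd.hasFDerivAt hr hθw))
  have h2 : HasFDerivAt (fun x : Eu k => x) (C.comp
      ((leafDeriv (fun z => (φ₁ (θ.symm z).1.1).1) (θ w)).prod
        (leafDeriv (fun z => (φ₂ (θ.symm z).1.2).1) (θ w)))) (θ w).1 := by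
    refine h1.congr_of_eventuallyEq ?_
    filter_upwards [eventually_leaf_mem θ.open_target hθw] with x hx
    have := h.leaf _ (θ.map_target hx)
    rw [θ.right_inv hx] at this
    exact this
  exact DFunLike.congr_fun (h2.unique (hasFDerivAt_id (𝕜 := ℝ) (θ w).1)) x

end IsAdapted

end FibreDerivative

/-! ### The fibre product as an immersed solenoid with the induced flow-boxes -/

section FibreSolenoid

variable (n : ℕ) {k k₁ k₂ l l₁ l₂ : ℕ} {r s : WithTop ℕ∞}
  {M : Type w} [TopologicalSpace M] [ChartedSpace (Eu n) M]
  {S : Type u} [TopologicalSpace S] {S₁ : Type u} [TopologicalSpace S₁] {S₂ : Type v}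
  [TopologicalSpace S₂] {f₁ : S₁ → M} {f₂ : S₂ → M}

/-- An extension of class `C^{r,s}` of a map of a solenoid to a neighbourhood in the ambient
foliated manifold. -/
structure PreSolenoid.Extension (P : PreSolenoid k l r s S) (f : S → M) where
  U : Set P.W
  F : P.W → M
  isClassCrsMap : P.foliation.IsClassCrsMap n U F
  mem : ∀ p, P.ι p ∈ U
  eq : ∀ p, F (P.ι p) = f p

variable {n}

theorem PreSolenoid.IsImmersion.exists_extension {P : PreSolenoid k l r s S} {f : S → M}
    (h : P.IsImmersion n f) : Nonempty (P.Extension n f) := by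
  obtain ⟨⟨U, F, hU, hr, hF, hc, hcl⟩, -⟩ := h
  exact ⟨⟨U, F, ⟨hU, hc, hcl⟩, fun p => hr (mem_range_self p), hF⟩⟩

namespace PreSolenoid.Extension

variable {P : PreSolenoid k l r s S} {f : S → M}

theorem continuous (E : P.Extension n f) : Continuous f := by
  have : f = E.F ∘ P.ι := funext fun p => (E.eq p).symm
  rw [this]
  exact E.isClassCrsMap.continuousOn.comp_continuous P.isEmbedding.continuous E.mem

theorem leafDiff_eq (E : P.Extension n f) {φ : OpenPartialHomeomorph P.W (Eu k × Eu l)}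
    (hφ : P.foliation.IsFlowChart φ) {p : S} (hp : P.ι p ∈ φ.source) :
    P.leafDiff n f φ p = mapDeriv E.F φ (chartAt (Eu n) (f p)) (P.ι p) :=
  P.leafDiff_eq E.eq hφ hp

end PreSolenoid.Extension

variable {P₁ : PreSolenoid k₁ l₁ r s S₁} {P₂ : PreSolenoid k₂ l₂ r s S₂}
  (E₁ : P₁.Extension n f₁) (E₂ : P₂.Extension n f₂)

/-- Transversality is given in the charts of the atlases; a change to other flow charts composes the
differentials with bijections and does not affect their ranges. -/
theorem range_mapDeriv_sup_eq_top (hr : 1 ≤ r) (htr : IntersectTransversally n P₁ P₂ f₁ f₂)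
    (p : f₁.Pullback f₂) {φ₁ : OpenPartialHomeomorph P₁.W (Eu k₁ × Eu l₁)}
    {φ₂ : OpenPartialHomeomorph P₂.W (Eu k₂ × Eu l₂)} (hφ₁ : P₁.foliation.IsFlowChart φ₁)
    (hφ₂ : P₂.foliation.IsFlowChart φ₂) (hp₁ : P₁.ι p.1.1 ∈ φ₁.source)
    (hp₂ : P₂.ι p.1.2 ∈ φ₂.source) :
    (mapDeriv E₁.F φ₁ (chartAt (Eu n) (f₁ p.1.1)) (P₁.ι p.1.1)).range ⊔
      (mapDeriv E₂.F φ₂ (chartAt (Eu n) (f₁ p.1.1)) (P₂.ι p.1.2)).range = ⊤ := by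
  obtain ⟨χ₁, hχ₁, hpχ₁⟩ := P₁.foliation.cover (P₁.ι p.1.1)
  obtain ⟨χ₂, hχ₂, hpχ₂⟩ := P₂.foliation.cover (P₂.ι p.1.2)
  have hχ₁' := FoliatedAtlas.isFlowChart_of_mem hχ₁
  have hχ₂' := FoliatedAtlas.isFlowChart_of_mem hχ₂
  have hpp : f₁ p.1.1 = f₂ p.1.2 := p.2
  rw [mapDeriv_range_change hr E₁.isClassCrsMap hφ₁ hχ₁' (chart_mem_atlas _ _) (E₁.mem _)
      (by rw [E₁.eq]; exact mem_chart_source _ _) hp₁ hpχ₁,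
    mapDeriv_range_change hr E₂.isClassCrsMap hφ₂ hχ₂' (chart_mem_atlas _ _) (E₂.mem _)
      (by rw [E₂.eq, hpp]; exact mem_chart_source _ _) hp₂ hpχ₂, ← E₁.leafDiff_eq hχ₁' hpχ₁]
  have h2 := E₂.leafDiff_eq hχ₂' hpχ₂
  rw [← hpp] at h2
  rw [← h2]
  exact htr _ _ hpp χ₁ hχ₁ hpχ₁ χ₂ hχ₂ hpχ₂

theorem mem_fibreSet (hr : 1 ≤ r) (htr : IntersectTransversally n P₁ P₂ f₁ f₂)
    (p : f₁.Pullback f₂) : (P₁.ι p.1.1, P₂.ι p.1.2) ∈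
      fibreSet n P₁.foliation P₂.foliation E₁.U E₂.U E₁.F E₂.F := by
  obtain ⟨χ₁, hχ₁, hpχ₁⟩ := P₁.foliation.cover (P₁.ι p.1.1)
  obtain ⟨χ₂, hχ₂, hpχ₂⟩ := P₂.foliation.cover (P₂.ι p.1.2)
  have hχ₁' := FoliatedAtlas.isFlowChart_of_mem hχ₁
  have hχ₂' := FoliatedAtlas.isFlowChart_of_mem hχ₂
  refine ⟨E₁.mem _, E₂.mem _, ?_, χ₁, χ₂, hχ₁', hχ₂', hpχ₁, hpχ₂, chartAt (Eu n) (f₁ p.1.1),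
    chart_mem_atlas _ _, ?_, range_mapDeriv_sup_eq_top E₁ E₂ hr htr p hχ₁' hχ₂' hpχ₁ hpχ₂⟩
  · rw [E₁.eq, E₂.eq]
    exact p.2
  · rw [E₁.eq]
    exact mem_chart_source _ _

variable [T2Space M]

/-- The fibre product of two transversal solenoids. -/
def fibreSolenoid (hr : 1 ≤ r) (hk : k + n = k₁ + k₂)
    (htr : IntersectTransversally n P₁ P₂ f₁ f₂) :
    PreSolenoid k (l₁ + l₂) r s (f₁.Pullback f₂) where
  W := fibreSet n P₁.foliation P₂.foliation E₁.U E₂.U E₁.F E₂.F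
  foliation := fibreAtlas hr hk E₁.isClassCrsMap E₂.isClassCrsMap
  ι := fun p => ⟨(P₁.ι p.1.1, P₂.ι p.1.2), mem_fibreSet E₁ E₂ hr htr p⟩
  isEmbedding := by
    have h : IsEmbedding (fun p : f₁.Pullback f₂ => (P₁.ι p.1.1, P₂.ι p.1.2)) :=
      (P₁.isEmbedding.prodMap P₂.isEmbedding).comp IsEmbedding.subtypeVal
    exact h.codRestrict _ (mem_fibreSet E₁ E₂ hr htr)
  compact := by
    have := P₁.compact
    have := P₂.compact
    have hc : IsClosed {p : S₁ × S₂ | f₁ p.1 = f₂ p.2} :=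
      isClosed_eq (E₁.continuous.comp continuous_fst) (E₂.continuous.comp continuous_snd)
    exact isCompact_iff_compactSpace.1 hc.isCompact
  saturated := by
    rintro γ hγ ⟨p, hp⟩
    obtain ⟨h₁, h₂⟩ := isLeafPath_fibre hr hk E₁.isClassCrsMap E₂.isClassCrsMap hγ
    obtain ⟨q₁, hq₁⟩ := P₁.saturated _ h₁ ⟨p.1.1, by rw [← hp]⟩
    obtain ⟨q₂, hq₂⟩ := P₂.saturated _ h₂ ⟨p.1.2, by rw [← hp]⟩
    -- Saturation of the factors gives the two components of the end point; the equation between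
    -- them holds at every point of the ambient fibre set.
    have h : f₁ q₁ = f₂ q₂ := by
      rw [← E₁.eq, ← E₂.eq, hq₁, hq₂]
      exact (γ 1).2.2.2.1
    exact ⟨⟨(q₁, q₂), h⟩, Subtype.ext (Prod.ext hq₁ hq₂)⟩

variable (hr : 1 ≤ r) (hk : k + n = k₁ + k₂) (htr : IntersectTransversally n P₁ P₂ f₁ f₂)

theorem fibreSolenoid_ι (p : f₁.Pullback f₂) :
    ((fibreSolenoid E₁ E₂ hr hk htr).ι p).1 = (P₁.ι p.1.1, P₂.ι p.1.2) := rfl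

theorem commonMap_eq_snd (p : f₁.Pullback f₂) : commonMap f₁ f₂ p = f₂ p.1.2 := p.2

/-- The extension of the map of the fibre product. -/
def fibreExtension : (fibreSolenoid E₁ E₂ hr hk htr).Extension n (commonMap f₁ f₂) where
  U := univ
  F := fun w => E₁.F w.1.1
  isClassCrsMap :=
    { isOpen := isOpen_univ
      continuousOn := E₁.isClassCrsMap.continuousOn.comp
        (continuous_fst.comp continuous_subtype_val).continuousOn fun w _ => w.2.1
      classCrs := by
        rintro θ ⟨φ₁, hφ₁, φ₂, hφ₂, ψ, hψ, C, hθ⟩ ψ' hψ'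
        have hφ₁' := FoliatedAtlas.isFlowChart_of_mem hφ₁
        have hO : IsOpen (θ.target ∩ (fun z => φ₁ (θ.symm z).1.1) ⁻¹'
            (φ₁.target ∩ φ₁.symm ⁻¹' (E₁.U ∩ E₁.F ⁻¹' ψ'.source))) :=
          hθ.continuousOn_fst.isOpen_inter_preimage θ.open_target
            (φ₁.continuousOn_symm.isOpen_inter_preimage φ₁.open_target
              E₁.isClassCrsMap.isOpen_inter)
        have := hθ.class_comp_fst (E₁.isClassCrsMap.classCrs_of_isFlowChart hφ₁' hψ') hO
          inter_subset_left fun z hz => hz.2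
        refine (this.congr hO fun z hz => ?_).mono fun z hz => ?_
        · change ψ' (E₁.F (φ₁.symm (φ₁ (θ.symm z).1.1))) = _
          rw [φ₁.left_inv (hθ.mem_fst _ (θ.map_target hz.1))]
        · have h1 := hθ.mem_fst _ (θ.map_target hz.1)
          refine ⟨hz.1, φ₁.map_source h1, ?_⟩
          rw [mem_preimage, φ₁.left_inv h1]
          exact ⟨(θ.symm z).2.1, hz.2.2⟩ }
  mem := fun _ => mem_univ _
  eq := fun p => E₁.eq _

/-- The leafwise differentials of the fibre product and its factors, in an adapted chart. -/
theorem leafDiff_fibre {φ₁ : OpenPartialHomeomorph P₁.W (Eu k₁ × Eu l₁)}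
    {φ₂ : OpenPartialHomeomorph P₂.W (Eu k₂ × Eu l₂)} (hφ₁ : P₁.foliation.IsFlowChart φ₁)
    (hφ₂ : P₂.foliation.IsFlowChart φ₂) {ψ : OpenPartialHomeomorph M (Eu n)}
    {C : Eu k₁ × Eu k₂ →L[ℝ] Eu k}
    {θ : OpenPartialHomeomorph (fibreSet n P₁.foliation P₂.foliation E₁.U E₂.U E₁.F E₂.F)
      (Eu k × Eu (l₁ + l₂))}
    (hθ : IsAdapted r s E₁.F E₂.F φ₁ φ₂ ψ C θ) {p : f₁.Pullback f₂}
    (hp : (fibreSolenoid E₁ E₂ hr hk htr).ι p ∈ θ.source) :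
    ∃ (B₁ : Eu k →L[ℝ] Eu k₁) (B₂ : Eu k →L[ℝ] Eu k₂),
      (fibreSolenoid E₁ E₂ hr hk htr).leafDiff n (commonMap f₁ f₂) θ p =
        (P₁.leafDiff n f₁ φ₁ p.1.1).comp B₁ ∧
      (fibreSolenoid E₁ E₂ hr hk htr).leafDiff n (commonMap f₁ f₂) θ p =
        (P₂.leafDiff n f₂ φ₂ p.1.2).comp B₂ ∧ ∀ x, C (B₁ x, B₂ x) = x := by
  refine ⟨_, _, ?_, ?_, fun x => hθ.leafDeriv_leaf hr hp x⟩
  · rw [(fibreExtension E₁ E₂ hr hk htr).leafDiff_eq (hθ.isFlowChart hr hk E₁.isClassCrsMap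
      E₂.isClassCrsMap hφ₁ hφ₂) hp, E₁.leafDiff_eq hφ₁ (hθ.mem_fst _ hp)]
    refine hθ.mapDeriv_fst hr E₁.isClassCrsMap hφ₁ (chart_mem_atlas _ _) hp (E₁.mem _) ?_
    rw [fibreSolenoid_ι, E₁.eq]
    exact mem_chart_source _ _
  · rw [(fibreExtension E₁ E₂ hr hk htr).leafDiff_eq (hθ.isFlowChart hr hk E₁.isClassCrsMap
      E₂.isClassCrsMap hφ₁ hφ₂) hp, E₂.leafDiff_eq hφ₂ (hθ.mem_snd _ hp)]
    have hF : (fibreExtension E₁ E₂ hr hk htr).F = fun w => E₂.F w.1.2 :=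
      funext fun w => w.2.2.2.1
    rw [hF, commonMap_eq_snd]
    refine hθ.mapDeriv_snd hr E₂.isClassCrsMap hφ₂ (chart_mem_atlas _ _) hp (E₂.mem _) ?_
    rw [fibreSolenoid_ι, E₂.eq]
    exact mem_chart_source _ _

/-- A leaf vector `x` has components `B₁ x` and `B₂ x` in the leaves of the factors, and `C`
recovers `x` from them. If the differential kills `x`, injectivity of the two given differentials
kills both components. -/
theorem fibreSolenoid_isImmersion (hf₁ : P₁.IsImmersion n f₁) (hf₂ : P₂.IsImmersion n f₂) :
    (fibreSolenoid E₁ E₂ hr hk htr).IsImmersion n (commonMap f₁ f₂) := by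
  let E := fibreExtension E₁ E₂ hr hk htr
  refine ⟨⟨E.U, E.F, E.isClassCrsMap.isOpen, fun _ _ => mem_univ _, E.eq,
    E.isClassCrsMap.continuousOn, E.isClassCrsMap.classCrs⟩, ?_⟩
  rintro p θ ⟨φ₁, hφ₁, φ₂, hφ₂, ψ, hψ, C, hθ⟩ hp
  obtain ⟨B₁, B₂, h1, h2, hC⟩ := leafDiff_fibre E₁ E₂ hr hk htr
    (FoliatedAtlas.isFlowChart_of_mem hφ₁) (FoliatedAtlas.isFlowChart_of_mem hφ₂) hθ hp
  rw [injective_iff_map_eq_zero]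
  intro x hx
  have hx' := hx
  rw [h1] at hx
  rw [h2] at hx'
  have e1 : B₁ x = 0 := hf₁.2 p.1.1 φ₁ hφ₁ (hθ.mem_fst _ hp) (by simpa using hx)
  have e2 : B₂ x = 0 := hf₂.2 p.1.2 φ₂ hφ₂ (hθ.mem_snd _ hp) (by simpa using hx')
  rw [← hC x, e1, e2]
  exact map_zero C

/-- The induced flow-boxes, with transverse spaces as large as possible. -/
def IsStronglyInduced (P₁ : PreSolenoid k₁ l₁ r s S₁) (P₂ : PreSolenoid k₂ l₂ r s S₂)
    (P : PreSolenoid k (l₁ + l₂) r s (f₁.Pullback f₂)) : Prop :=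
  ∀ (p : f₁.Pullback f₂) (B₁ : P₁.FlowBox) (B₂ : P₂.FlowBox),
    p.1.1 ∈ B₁.domain → p.1.2 ∈ B₂.domain →
    ∃ B : P.FlowBox, p ∈ B.transversal ∧ (∀ q ∈ B.domain,
      q.1.1 ∈ B₁.domain ∧ q.1.2 ∈ B₂.domain ∧
      B.transCoord q = appendCoord (B₁.transCoord q.1.1) (B₂.transCoord q.1.2)) ∧
      ∃ V₁ ∈ 𝓝 (B₁.transCoord p.1.1), ∃ V₂ ∈ 𝓝 (B₂.transCoord p.1.2),
        ∀ y ∈ V₁, y ∈ B₁.K → ∀ z ∈ V₂, z ∈ B₂.K → appendCoord y z ∈ B.K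

theorem IsStronglyInduced.isInducedStructure {P : PreSolenoid k (l₁ + l₂) r s (f₁.Pullback f₂)}
    (h : IsStronglyInduced P₁ P₂ P) : IsInducedStructure P₁ P₂ P := fun p B₁ B₂ h₁ h₂ =>
  let ⟨B, hB, hq, _⟩ := h p B₁ B₂ h₁ h₂
  ⟨B, hB.1, hq⟩

/-- A flow-box cut out of an adapted chart over `B₁` and `B₂` has the right transverse coordinate.
For `(y, z)` near the coordinates of `p`, the centre of the plaque over `(y, z)` projects into the
unit balls of `B₁` and `B₂`; if `y ∈ B₁.K` and `z ∈ B₂.K`, both projections are points of the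
solenoids, so the centre belongs to the fibre product and `(y, z)` to its transverse space. -/
theorem fibreSolenoid_isStronglyInduced :
    IsStronglyInduced P₁ P₂ (fibreSolenoid E₁ E₂ hr hk htr) := by
  intro p B₁ B₂ hp₁ hp₂
  set P := fibreSolenoid E₁ E₂ hr hk htr
  obtain ⟨C, θ, hθ, hpθ⟩ := exists_isAdapted hr hk E₁.isClassCrsMap E₂.isClassCrsMap
    B₁.isFlowChart B₂.isFlowChart (chart_mem_atlas (Eu n) (f₁ p.1.1))
    ⟨(P₁.ι p.1.1, P₂.ι p.1.2), mem_fibreSet E₁ E₂ hr htr p⟩ hp₁ hp₂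
    (by simp only [E₁.eq]; exact mem_chart_source _ _)
    (range_mapDeriv_sup_eq_top E₁ E₂ hr htr p B₁.isFlowChart B₂.isFlowChart hp₁ hp₂)
  have hfl : P.foliation.IsFlowChart θ :=
    hθ.isFlowChart hr hk E₁.isClassCrsMap E₂.isClassCrsMap B₁.isFlowChart B₂.isFlowChart
  have hpθ' : P.ι p ∈ θ.source := hpθ
  obtain ⟨B, hpB, hBθ, hB2, V, hV, hpV, hVt, hBK⟩ := P.exists_flowBox hfl hpθ' univ_mem
  have htrans : ∀ q, P.ι q ∈ θ.source →
      (θ (P.ι q)).2 = appendCoord (B₁.transCoord q.1.1) (B₂.transCoord q.1.2) :=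
    fun q hq => hθ.trans _ hq
  refine ⟨B, hpB, fun q hq => ⟨hθ.mem_fst _ (hBθ hq).1, hθ.mem_snd _ (hBθ hq).1, ?_⟩, ?_⟩
  · exact (hB2 _).trans (htrans q (hBθ hq).1)
  obtain ⟨x₀, hx₀⟩ : ∃ x₀, (θ (P.ι p)).1 = x₀ := ⟨_, rfl⟩
  have hz₀ : θ (P.ι p) = (x₀, appendCoord (B₁.transCoord p.1.1) (B₂.transCoord p.1.2)) :=
    Prod.ext hx₀ (htrans p hpθ')
  replace hVt : ∀ y ∈ V, (x₀, y) ∈ θ.target := fun y hy =>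
    Eq.subst (motive := fun x => (x, y) ∈ θ.target) hx₀ (hVt y hy)
  replace hBK : B.K = {y | y ∈ V ∧ θ.symm (x₀, y) ∈ range P.ι} :=
    Eq.subst (motive := fun x => B.K = {y | y ∈ V ∧ θ.symm (x, y) ∈ range P.ι}) hx₀ hBK
  replace hpV : appendCoord (B₁.transCoord p.1.1) (B₂.transCoord p.1.2) ∈ V :=
    Eq.subst (motive := fun y => y ∈ V) (htrans p hpθ') hpV
  let y₀ := (B₁.transCoord p.1.1, B₂.transCoord p.1.2)
  have hz₀t : (x₀, appendCoord (B₁.transCoord p.1.1) (B₂.transCoord p.1.2)) ∈ θ.target :=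
    hz₀ ▸ θ.map_source hpθ'
  have hθ₀ : θ.symm (x₀, appendCoord (B₁.transCoord p.1.1) (B₂.transCoord p.1.2)) = P.ι p := by
    rw [← hz₀, θ.left_inv hpθ']
  have hcont : Continuous fun y : Eu l₁ × Eu l₂ => (x₀, appendCoord y.1 y.2) :=
    continuous_const.prodMk (appendEquiv l₁ l₂).continuous
  -- For nearby transverse values the leaf coordinates of the two projections stay in the unit
  -- balls, where the flow-boxes of the factors are full products.
  have ev₁ : ∀ᶠ y in 𝓝 y₀, (B₁.chart (θ.symm (x₀, appendCoord y.1 y.2)).1.1).1 ∈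
      Metric.ball (0 : Eu k₁) 1 := by
    have h1 : ContinuousAt (fun z => (B₁.chart (θ.symm z).1.1).1)
        (x₀, appendCoord (B₁.transCoord p.1.1) (B₂.transCoord p.1.2)) :=
      (hθ.continuousOn_fst.continuousAt (θ.open_target.mem_nhds hz₀t)).fst
    have h2 := ContinuousAt.comp (f := fun y : Eu l₁ × Eu l₂ => (x₀, appendCoord y.1 y.2))
      (x := y₀) h1 hcont.continuousAt
    refine h2.eventually_mem (Metric.isOpen_ball.mem_nhds ?_)
    simp only [Function.comp_apply, y₀, hθ₀]
    exact (PreSolenoid.FlowBox.coord_mem hp₁).1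
  have ev₂ : ∀ᶠ y in 𝓝 y₀, (B₂.chart (θ.symm (x₀, appendCoord y.1 y.2)).1.2).1 ∈
      Metric.ball (0 : Eu k₂) 1 := by
    have h1 : ContinuousAt (fun z => (B₂.chart (θ.symm z).1.2).1)
        (x₀, appendCoord (B₁.transCoord p.1.1) (B₂.transCoord p.1.2)) :=
      (hθ.continuousOn_snd.continuousAt (θ.open_target.mem_nhds hz₀t)).fst
    have h2 := ContinuousAt.comp (f := fun y : Eu l₁ × Eu l₂ => (x₀, appendCoord y.1 y.2))
      (x := y₀) h1 hcont.continuousAt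
    refine h2.eventually_mem (Metric.isOpen_ball.mem_nhds ?_)
    simp only [Function.comp_apply, y₀, hθ₀]
    exact (PreSolenoid.FlowBox.coord_mem hp₂).1
  have ev₃ : ∀ᶠ y in 𝓝 y₀, appendCoord y.1 y.2 ∈ V :=
    (appendEquiv l₁ l₂).continuous.continuousAt.eventually_mem (hV.mem_nhds hpV)
  obtain ⟨V₁, hV₁, V₂, hV₂, hVV⟩ := mem_nhds_prod_iff.1 (ev₁.and (ev₂.and ev₃))
  refine ⟨V₁, hV₁, V₂, hV₂, fun y hy hyK z hz hzK => ?_⟩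
  obtain ⟨hb₁, hb₂, hyV⟩ := hVV (mk_mem_prod hy hz)
  simp only at hb₁ hb₂ hyV
  have ht := hVt _ hyV
  have hs := hθ.snd_eq ht
  rw [appendEquiv_symm_appendCoord] at hs
  obtain ⟨hs₁, hs₂⟩ := Prod.ext_iff.1 hs
  set τ := θ.symm (x₀, appendCoord y z) with hτ
  obtain ⟨q₁, hq₁, hq₁x, hq₁y⟩ := B₁.exists_coord_eq hb₁ hyK
  obtain ⟨q₂, hq₂, hq₂x, hq₂y⟩ := B₂.exists_coord_eq hb₂ hzK
  have hm := θ.map_target ht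
  have e₁ : P₁.ι q₁ = τ.1.1 := B₁.chart.injOn hq₁ (hθ.mem_fst _ hm)
    (Prod.ext hq₁x (hq₁y.trans hs₁))
  have e₂ : P₂.ι q₂ = τ.1.2 := B₂.chart.injOn hq₂ (hθ.mem_snd _ hm)
    (Prod.ext hq₂x (hq₂y.trans hs₂))
  have hq : f₁ q₁ = f₂ q₂ := by
    rw [← E₁.eq, ← E₂.eq, e₁, e₂]
    exact τ.2.2.2.1
  rw [hBK]
  exact ⟨hyV, ⟨(q₁, q₂), hq⟩, Subtype.ext (Prod.ext e₁ e₂)⟩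

end FibreSolenoid

/-! ### Determinants and frames -/

section Determinants

theorem det_prod_of_triangular {E F : Type*} [AddCommGroup E] [Module ℝ E] [Module.Finite ℝ E]
    [AddCommGroup F] [Module ℝ F] [Module.Finite ℝ F] (T : E × F →ₗ[ℝ] E × F) (P : E →ₗ[ℝ] E)
    (Q : F →ₗ[ℝ] F) (h₁ : ∀ x, (T x).1 = P x.1) (h₂ : ∀ b, (T (0, b)).2 = Q b) :
    LinearMap.det T = LinearMap.det P * LinearMap.det Q := by
  classical
  let b := Module.Free.chooseBasis ℝ E
  let b' := Module.Free.chooseBasis ℝ F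
  have : LinearMap.toMatrix (b.prod b') (b.prod b') T = Matrix.fromBlocks
      (LinearMap.toMatrix b b P) 0
      (LinearMap.toMatrix b b' (LinearMap.snd ℝ E F ∘ₗ T ∘ₗ LinearMap.inl ℝ E F))
      (LinearMap.toMatrix b' b' Q) := by
    ext (i | i) (j | j) <;> simp [LinearMap.toMatrix_apply, h₁, h₂]
  rw [← LinearMap.det_toMatrix (b.prod b'), this, Matrix.det_fromBlocks_zero₁₂,
    LinearMap.det_toMatrix, LinearMap.det_toMatrix]

/-- The standard basis of `ℝ^d`. -/
def stdBasis (d : ℕ) : Module.Basis (Fin d) ℝ (Eu d) := (EuclideanSpace.basisFun (Fin d) ℝ).toBasis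

/-- The linear map that maps the standard basis to the frame `e`. -/
def frameMap {d : ℕ} (e : Fin d → Eu d) : Eu d →ₗ[ℝ] Eu d := (stdBasis d).constr ℝ e

theorem frameMap_basis {d : ℕ} (e : Fin d → Eu d) (i : Fin d) :
    frameMap e (stdBasis d i) = e i := (stdBasis d).constr_basis ℝ e i

theorem det_frameMap {d : ℕ} (e : Fin d → Eu d) : LinearMap.det (frameMap e) = frameDet e := by
  rw [← LinearMap.det_toMatrix (stdBasis d), frameDet]
  congr 1
  ext i j
  rw [LinearMap.toMatrix_apply, frameMap_basis]
  rfl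

variable {n k k₁ k₂ : ℕ}

/-- The linear map that relates the coordinates of a frame of the tangent space of a manifold
adapted to two transversal submanifolds to the coordinates of their frames. -/
def jointFrame (n k k₁ k₂ : ℕ) (h₁ : k ≤ k₁) (h₂ : k ≤ k₂) (hk : k + n = k₁ + k₂) :
    Eu n × Eu k →ₗ[ℝ] Eu k₁ × Eu k₂ :=
  LinearMap.coprod
    ((stdBasis n).constr ℝ fun i =>
      -- Second components enter `jointMap` with a minus sign, compensated here. The last case has
      -- index at least `k` in `ℝ^{k₂}`, so it runs over exactly the vectors of the second frame
      -- outside the intersection.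
      if hi : i.val < k then (0, -stdBasis k₂ ⟨i, by omega⟩)
      else if hi : i.val < k₁ then (stdBasis k₁ ⟨i, hi⟩, 0)
      else (0, -stdBasis k₂ ⟨i.val - k₁ + k, by omega⟩))
    ((stdBasis k).constr ℝ fun i => (stdBasis k₁ ⟨i, by omega⟩, stdBasis k₂ ⟨i, by omega⟩))

section jointFrame

variable (h₁ : k ≤ k₁) (h₂ : k ≤ k₂) (hk : k + n = k₁ + k₂)

theorem jointFrame_inl (i : Fin n) : jointFrame n k k₁ k₂ h₁ h₂ hk (stdBasis n i, 0) =
      if hi : i.val < k then (0, -stdBasis k₂ ⟨i, by omega⟩)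
      else if hi : i.val < k₁ then (stdBasis k₁ ⟨i, hi⟩, 0)
      else (0, -stdBasis k₂ ⟨i.val - k₁ + k, by omega⟩) := by
  rw [jointFrame, LinearMap.coprod_apply, map_zero, add_zero, Module.Basis.constr_basis]

theorem jointFrame_inr (i : Fin k) : jointFrame n k k₁ k₂ h₁ h₂ hk (0, stdBasis k i) =
      (stdBasis k₁ ⟨i, by omega⟩, stdBasis k₂ ⟨i, by omega⟩) := by
  rw [jointFrame, LinearMap.coprod_apply, map_zero, zero_add, Module.Basis.constr_basis]

theorem jointFrame_bijective : Function.Bijective (jointFrame n k k₁ k₂ h₁ h₂ hk) := by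
  set N := jointFrame n k k₁ k₂ h₁ h₂ hk with hN
  have hr₂ : ∀ j, ((0, stdBasis k₂ j) : Eu k₁ × Eu k₂) ∈ N.range := fun j => by
    by_cases hj : j.val < k
    · refine ⟨-(stdBasis n ⟨j, by omega⟩, 0), ?_⟩
      rw [map_neg, hN, jointFrame_inl, dif_pos hj]
      simp
    · refine ⟨-(stdBasis n ⟨j - k + k₁, by omega⟩, 0), ?_⟩
      rw [map_neg, hN, jointFrame_inl, dif_neg (by simp only; omega), dif_neg (by simp)]
      have : (⟨j.val - k + k, by omega⟩ : Fin k₂) = j := Fin.ext (by simp only; omega)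
      simp [this]
  have hr₁ : ∀ i, ((stdBasis k₁ i, 0) : Eu k₁ × Eu k₂) ∈ N.range := fun i => by
    by_cases hi : i.val < k
    · have := N.range.sub_mem ⟨(0, stdBasis k ⟨i, hi⟩), rfl⟩ (hr₂ ⟨i, by omega⟩)
      rw [hN, jointFrame_inr, ← hN] at this
      simpa using this
    · refine ⟨(stdBasis n ⟨i, by omega⟩, 0), ?_⟩
      rw [hN, jointFrame_inl, dif_neg hi, dif_pos i.2]
  have htop : N.range = ⊤ := by
    rw [eq_top_iff, ← ((stdBasis k₁).prod (stdBasis k₂)).span_eq, Submodule.span_le]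
    rintro _ ⟨i | i, rfl⟩
    · simpa [Module.Basis.prod_apply] using hr₁ i
    · simpa [Module.Basis.prod_apply] using hr₂ i
  have hsurj := LinearMap.range_eq_top.1 htop
  exact ⟨(LinearMap.injective_iff_surjective_of_finrank_eq_finrank (by
    simp only [Module.finrank_prod, finrank_euclideanSpace_fin]; omega)).2 hsurj, hsurj⟩

/-- `jointFrame` as a continuous linear equivalence. -/
def jointFrameEquiv : (Eu n × Eu k) ≃L[ℝ] (Eu k₁ × Eu k₂) :=
  (LinearEquiv.ofBijective _ (jointFrame_bijective h₁ h₂ hk)).toContinuousLinearEquiv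

/-- The determinant of a linear map `ℝ^{k₁} × ℝ^{k₂} → ℝ^n × ℝ^k`, `k + n = k₁ + k₂`. -/
def jointDet (D : Eu k₁ × Eu k₂ →L[ℝ] Eu n × Eu k) : ℝ :=
  ((jointFrameEquiv h₁ h₂ hk : (Eu n × Eu k) →L[ℝ] (Eu k₁ × Eu k₂)).comp D).det

theorem jointDet_ne_zero {D : Eu k₁ × Eu k₂ →L[ℝ] Eu n × Eu k} (hD : Function.Bijective D) :
    jointDet h₁ h₂ hk D ≠ 0 := by
  rw [jointDet, ContinuousLinearMap.det, ← isUnit_iff_ne_zero, ← LinearMap.isUnit_iff_isUnit_det,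
    LinearMap.isUnit_iff_ker_eq_bot, LinearMap.ker_eq_bot]
  exact (jointFrameEquiv h₁ h₂ hk).injective.comp hD.1

theorem continuous_jointDet : Continuous (jointDet (n := n) h₁ h₂ hk) :=
  ContinuousLinearMap.continuous_det.comp (continuous_const.clm_comp continuous_id)

/-- The endomorphism `D' ∘ (L₁ × L₂) ∘ D⁻¹` of `ℝ^n × ℝ^k` is block triangular with diagonal blocks
`Q` and `L`, and conjugation by the identification `jointFrameEquiv` preserves its determinant. Only
the diagonal matters, so `L` is prescribed only where the first component of `D` vanishes. -/
theorem jointDet_change {D D' : Eu k₁ × Eu k₂ →L[ℝ] Eu n × Eu k} (hD : Function.Bijective D)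
    {L₁ : Eu k₁ →L[ℝ] Eu k₁} {L₂ : Eu k₂ →L[ℝ] Eu k₂} {Q : Eu n →L[ℝ] Eu n} {L : Eu k →L[ℝ] Eu k}
    (hQ : ∀ x, (D' (L₁ x.1, L₂ x.2)).1 = Q (D x).1)
    (hL : ∀ x, (D x).1 = 0 → (D' (L₁ x.1, L₂ x.2)).2 = L (D x).2) :
    jointDet h₁ h₂ hk D' * (L₁.det * L₂.det) = Q.det * L.det * jointDet h₁ h₂ hk D := by
  let e := LinearEquiv.ofBijective D.toLinearMap hD
  let N := (jointFrameEquiv (n := n) h₁ h₂ hk).toLinearEquiv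
  let T : Eu n × Eu k →ₗ[ℝ] Eu n × Eu k :=
    D'.toLinearMap ∘ₗ (L₁.toLinearMap.prodMap L₂.toLinearMap) ∘ₗ e.symm.toLinearMap
  have he : ∀ x, D (e.symm x) = x := fun x => e.apply_symm_apply x
  have hT : LinearMap.det T = Q.det * L.det := by
    refine det_prod_of_triangular T _ _ (fun x => ?_) fun b => ?_
    · refine (hQ (e.symm x)).trans ?_
      rw [he]; rfl
    · have h0 := he (0, b)
      refine (hL (e.symm (0, b)) (by rw [h0])).trans ?_
      rw [h0]; rfl
  have e₁ : jointDet h₁ h₂ hk D' * (L₁.det * L₂.det) =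
      LinearMap.det ((N.toLinearMap ∘ₗ D'.toLinearMap) ∘ₗ
        (L₁.toLinearMap.prodMap L₂.toLinearMap)) := by
    rw [LinearMap.det_comp, LinearMap.det_prodMap]
    rfl
  have e₂ : (N.toLinearMap ∘ₗ D'.toLinearMap) ∘ₗ (L₁.toLinearMap.prodMap L₂.toLinearMap) =
      (N.toLinearMap ∘ₗ T ∘ₗ N.symm.toLinearMap) ∘ₗ (N.toLinearMap ∘ₗ D.toLinearMap) := by
    refine LinearMap.ext fun x => ?_
    have h : e.symm (D x) = x := e.symm_apply_apply x
    change N (D' (L₁ x.1, L₂ x.2)) = N (T (N.symm (N (D x))))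
    rw [N.symm_apply_apply]
    change _ = N (D' (L₁ (e.symm (D x)).1, L₂ (e.symm (D x)).2))
    rw [h]
  rw [e₁, e₂, LinearMap.det_comp, LinearMap.det_conj, hT]
  rfl

/-- The determinants of frames of two subspaces, of their intersection and of their sum. -/
theorem jointDet_frame {D₁ : Eu k₁ →L[ℝ] Eu n} {D₂ : Eu k₂ →L[ℝ] Eu n}
    {C : Eu k₁ × Eu k₂ →L[ℝ] Eu k} {e : Fin k → Eu k} {u : Fin k₁ → Eu k₁} {v : Fin k₂ → Eu k₂}
    (huv : ∀ (i₁ : Fin k₁) (i₂ : Fin k₂), i₁.val = i₂.val → i₁.val < k → D₁ (u i₁) = D₂ (v i₂))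
    (hC : ∀ i : Fin k, C (u ⟨i, by omega⟩, v ⟨i, by omega⟩) = e i) :
    jointDet h₁ h₂ hk (jointMap D₁ D₂ C) * (frameDet u * frameDet v) =
      frameDet (fun i : Fin n => if h : i.val < k₁ then D₁ (u ⟨i.val, h⟩)
        else D₂ (v ⟨i.val - k₁ + k, by omega⟩)) * frameDet e := by
  set w : Fin n → Eu n := fun i : Fin n => if h : i.val < k₁ then D₁ (u ⟨i.val, h⟩)
        else D₂ (v ⟨i.val - k₁ + k, by omega⟩) with hw
  let N := (jointFrameEquiv (n := n) h₁ h₂ hk).toLinearEquiv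
  -- The frames are fed into the joint map through `jointFrame`. The standard vectors of `ℝ^k` go to
  -- `(0, e i)`, and those of `ℝ^n` to vectors with first component `w i`, so `T` is block
  -- triangular with the frames `w` and `e` on the diagonal.
  let T : Eu n × Eu k →ₗ[ℝ] Eu n × Eu k := (jointMap D₁ D₂ C).toLinearMap ∘ₗ
    ((frameMap u).prodMap (frameMap v)) ∘ₗ N.toLinearMap
  have hN : ∀ x, N x = jointFrame n k k₁ k₂ h₁ h₂ hk x := fun x => rfl
  have hTa : ∀ x, T x = jointMap D₁ D₂ C (frameMap u (N x).1, frameMap v (N x).2) := fun x => rfl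
  have hTr : ∀ b, T (0, b) = (0, frameMap e b) := by
    have : T ∘ₗ LinearMap.inr ℝ _ _ = LinearMap.inr ℝ _ _ ∘ₗ frameMap e := by
      refine (stdBasis k).ext fun i => ?_
      simp only [LinearMap.comp_apply, LinearMap.inr_apply]
      rw [hTa, hN, jointFrame_inr, frameMap_basis, frameMap_basis, frameMap_basis, jointMap_apply,
        hC, huv ⟨i, by omega⟩ ⟨i, by omega⟩ rfl i.2, sub_self]
    exact fun b => LinearMap.congr_fun this b
  have hTl : ∀ a, (T (a, 0)).1 = frameMap w a := by
    have : LinearMap.fst ℝ _ _ ∘ₗ T ∘ₗ LinearMap.inl ℝ _ _ = frameMap w := by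
      refine (stdBasis n).ext fun i => ?_
      simp only [LinearMap.comp_apply, LinearMap.inl_apply, LinearMap.fst_apply]
      rw [hTa, hN, jointFrame_inl, frameMap_basis, jointMap_apply, hw]
      by_cases hi : i.val < k
      · have hi' : i.val < k₁ := by omega
        simp only [dif_pos hi, dif_pos hi', map_zero, map_neg, frameMap_basis]
        rw [huv ⟨i, hi'⟩ ⟨i, by omega⟩ rfl hi]
        simp
      · by_cases hi' : i.val < k₁
        · simp only [dif_neg hi, dif_pos hi', map_zero, frameMap_basis, sub_zero]
        · simp only [dif_neg hi, dif_neg hi', map_zero, map_neg, frameMap_basis]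
          simp
    exact fun a => LinearMap.congr_fun this a
  have hT : LinearMap.det T = frameDet w * frameDet e := by
    rw [← det_frameMap, ← det_frameMap]
    refine det_prod_of_triangular T _ _ (fun x => ?_) fun b => by rw [hTr]
    have : x = (x.1, 0) + (0, x.2) := by simp
    rw [this, map_add, Prod.fst_add, hTl, hTr]
    simp
  have e₁ : jointDet h₁ h₂ hk (jointMap D₁ D₂ C) * (frameDet u * frameDet v) =
      LinearMap.det ((N.toLinearMap ∘ₗ (jointMap D₁ D₂ C).toLinearMap) ∘ₗ
        ((frameMap u).prodMap (frameMap v))) := by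
    rw [LinearMap.det_comp, LinearMap.det_prodMap, det_frameMap, det_frameMap]
    rfl
  have e₂ : (N.toLinearMap ∘ₗ (jointMap D₁ D₂ C).toLinearMap) ∘ₗ
      ((frameMap u).prodMap (frameMap v)) = N.toLinearMap ∘ₗ T ∘ₗ N.symm.toLinearMap := by
    ext x <;> simp [T]
  rw [e₁, e₂, LinearMap.det_conj, hT]

end jointFrame

end Determinants

/-! ### The orientation of the fibre product -/

section Signs

/-- The sign of a non-zero real number. -/
def signOf (x : ℝ) : ℤˣ := if 0 < x then 1 else -1

theorem signOf_of_pos {x : ℝ} (hx : 0 < x) : signOf x = 1 := if_pos hx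

theorem signOf_of_neg {x : ℝ} (hx : x < 0) : signOf x = -1 := if_neg hx.not_gt

theorem signOf_mul {x y : ℝ} (hx : x ≠ 0) (hy : y ≠ 0) : signOf (x * y) = signOf x * signOf y := by
  rcases lt_or_gt_of_ne hx with hx | hx <;> rcases lt_or_gt_of_ne hy with hy | hy
  · simp [signOf_of_neg hx, signOf_of_neg hy, signOf_of_pos (mul_pos_of_neg_of_neg hx hy)]
  · simp [signOf_of_neg hx, signOf_of_pos hy, signOf_of_neg (mul_neg_of_neg_of_pos hx hy)]
  · simp [signOf_of_pos hx, signOf_of_neg hy, signOf_of_neg (mul_neg_of_pos_of_neg hx hy)]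
  · simp [signOf_of_pos hx, signOf_of_pos hy, signOf_of_pos (mul_pos hx hy)]

/-- Converts the positivity conditions in the definitions of orientations into a non-vanishing and
an identity in `{±1}`, which can be multiplied together. -/
theorem units_mul_pos_iff {ε : ℤˣ} {x : ℝ} :
    0 < ((ε : ℤ) : ℝ) * x ↔ x ≠ 0 ∧ signOf x = ε := by
  rcases lt_trichotomy x 0 with hx | rfl | hx
  · rcases Int.units_eq_one_or ε with rfl | rfl
    · simp [signOf_of_neg hx, hx.le]
    · simpa [signOf_of_neg hx, hx.ne] using hx
  · simp
  · rcases Int.units_eq_one_or ε with rfl | rfl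
    · simpa [signOf_of_pos hx, hx.ne'] using hx
    · simp [signOf_of_pos hx, hx.le]

theorem eventually_signOf_eq {x : ℝ} (hx : x ≠ 0) : ∀ᶠ y in 𝓝 x, signOf y = signOf x := by
  rcases lt_or_gt_of_ne hx with hx | hx
  · filter_upwards [Iio_mem_nhds hx] with y hy
    rw [signOf_of_neg hx, signOf_of_neg hy]
  · filter_upwards [Ioi_mem_nhds hx] with y hy
    rw [signOf_of_pos hx, signOf_of_pos hy]

theorem frameDet_ne_zero {d : ℕ} {e : Fin d → Eu d} (he : LinearIndependent ℝ e) :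
    frameDet e ≠ 0 := by
  have := (Module.Basis.is_basis_iff_det (stdBasis d)).1
    ⟨he, he.span_eq_top_of_card_eq_finrank' (by simp)⟩
  exact this.ne_zero

end Signs

/-- Injectivity pulls back through injective changes of the leaf coordinates, and equal dimensions
do the rest. It transfers the invertibility known for an adapted chart to other charts of the
factors. -/
theorem bijective_of_change {n k k₁ k₂ : ℕ} (hk : k + n = k₁ + k₂)
    {D D' : Eu k₁ × Eu k₂ →L[ℝ] Eu n × Eu k} (hD : Function.Injective D) {L₁ : Eu k₁ →L[ℝ] Eu k₁}
    {L₂ : Eu k₂ →L[ℝ] Eu k₂} {Q : Eu n →L[ℝ] Eu n} (hL₁ : Function.Injective L₁)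
    (hL₂ : Function.Injective L₂) (hQ : ∀ x, (D (L₁ x.1, L₂ x.2)).1 = Q (D' x).1)
    (hC : ∀ x, (D (L₁ x.1, L₂ x.2)).2 = (D' x).2) : Function.Bijective D' := by
  have hinj : Function.Injective D'.toLinearMap := by
    rw [injective_iff_map_eq_zero]
    intro x hx
    have hx' : D' x = 0 := hx
    have h0 : D (L₁ x.1, L₂ x.2) = D 0 := by
      rw [map_zero]
      refine Prod.ext ?_ ?_
      · rw [hQ, hx']
        exact map_zero _
      · rw [hC, hx']
    have h1 := Prod.ext_iff.1 (hD h0)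
    exact Prod.ext (hL₁ (h1.1.trans (map_zero _).symm)) (hL₂ (h1.2.trans (map_zero _).symm))
  exact ⟨hinj, (LinearMap.injective_iff_surjective_of_finrank_eq_finrank (by
    simp only [Module.finrank_prod, finrank_euclideanSpace_fin]; omega)).1 hinj⟩

theorem continuousAt_jointMap {X E₁ E₂ G H : Type*} [TopologicalSpace X] [NormedAddCommGroup E₁]
    [NormedSpace ℝ E₁] [NormedAddCommGroup E₂] [NormedSpace ℝ E₂] [NormedAddCommGroup G]
    [NormedSpace ℝ G] [NormedAddCommGroup H] [NormedSpace ℝ H] {D₁ : X → E₁ →L[ℝ] G}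
    {D₂ : X → E₂ →L[ℝ] G} (C : E₁ × E₂ →L[ℝ] H) {p : X} (h₁ : ContinuousAt D₁ p)
    (h₂ : ContinuousAt D₂ p) : ContinuousAt (fun q => jointMap (D₁ q) (D₂ q) C) p := by
  have : (fun q => jointMap (D₁ q) (D₂ q) C) = fun q =>
      (ContinuousLinearMap.inl ℝ G H).comp
        ((D₁ q).comp (.fst ℝ E₁ E₂) - (D₂ q).comp (.snd ℝ E₁ E₂)) +
      (ContinuousLinearMap.inr ℝ G H).comp C := by
    funext q
    ext x <;> simp [jointMap]
  rw [this]
  exact (continuousAt_const.clm_comp ((h₁.clm_comp continuousAt_const).sub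
    (h₂.clm_comp continuousAt_const))).add continuousAt_const

section FibreOrientation

variable {n k k₁ k₂ l l₁ l₂ : ℕ} {r s : WithTop ℕ∞}
  {M : Type w} [TopologicalSpace M] [T2Space M] [ChartedSpace (Eu n) M]
  {S : Type u} [TopologicalSpace S] {S₁ : Type u} [TopologicalSpace S₁] {S₂ : Type v}
  [TopologicalSpace S₂] {f : S → M} {f₁ : S₁ → M} {f₂ : S₂ → M}

namespace PreSolenoid.Extension

variable {P : PreSolenoid k l r s S} (E : P.Extension n f)
  {φ φ' : OpenPartialHomeomorph P.W (Eu k × Eu l)} {ψ ψ' : OpenPartialHomeomorph M (Eu n)} {p : S}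

theorem continuousAt_mapDeriv (hr : 1 ≤ r) (hφ : P.foliation.IsFlowChart φ)
    (hψ : ψ ∈ atlas (Eu n) M)
    (hp : P.ι p ∈ φ.source) (hpψ : f p ∈ ψ.source) :
    ContinuousAt (fun q => mapDeriv E.F φ ψ (P.ι q)) p := by
  have hc := (E.isClassCrsMap.classCrs_of_isFlowChart hφ hψ).continuousOn_leafDeriv hr
  have ho : IsOpen (φ.target ∩ φ.symm ⁻¹' (E.U ∩ E.F ⁻¹' ψ.source)) :=
    φ.continuousOn_symm.isOpen_inter_preimage φ.open_target E.isClassCrsMap.isOpen_inter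
  refine ContinuousAt.comp (f := fun q => φ (P.ι q))
    (hc.continuousAt (ho.mem_nhds ⟨φ.map_source hp, ?_⟩))
    ((φ.continuousAt hp).comp P.isEmbedding.continuous.continuousAt)
  rw [mem_preimage, φ.left_inv hp]
  exact ⟨E.mem p, by rwa [mem_preimage, E.eq]⟩

theorem mapDeriv_change (hr : 1 ≤ r) (hφ : P.foliation.IsFlowChart φ)
    (hφ' : P.foliation.IsFlowChart φ')
    [IsManifold (𝓡 n) r M] (hψ : ψ ∈ atlas (Eu n) M) (hψ' : ψ' ∈ atlas (Eu n) M)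
    (hp : P.ι p ∈ φ.source) (hp' : P.ι p ∈ φ'.source) (hpψ : f p ∈ ψ.source)
    (hpψ' : f p ∈ ψ'.source) (x : Eu k) :
    mapDeriv E.F φ' ψ' (P.ι p) (FoliatedAtlas.leafTransition φ φ' (P.ι p) x) =
      fderiv ℝ (fun m => ψ' (ψ.symm m)) (ψ (f p)) (mapDeriv E.F φ ψ (P.ι p) x) := by
  rw [← E.eq] at hpψ hpψ'
  have h1 := E.isClassCrsMap.leafDeriv_change hr hφ hφ' hψ' (E.mem p) hpψ' hp hp'
  have h2 := E.isClassCrsMap.leafDeriv_chart hr hφ hψ hψ' (E.mem p) hpψ hpψ' hp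
  rw [h1, E.eq] at h2
  exact DFunLike.congr_fun h2 x

end PreSolenoid.Extension

variable {P₁ : PreSolenoid k₁ l₁ r s S₁} {P₂ : PreSolenoid k₂ l₂ r s S₂}
  (E₁ : P₁.Extension n f₁) (E₂ : P₂.Extension n f₂)
  {φ₁ φ₁' : OpenPartialHomeomorph P₁.W (Eu k₁ × Eu l₁)}
  {φ₂ φ₂' : OpenPartialHomeomorph P₂.W (Eu k₂ × Eu l₂)}
  {ψ ψ' : OpenPartialHomeomorph M (Eu n)} {C C' : Eu k₁ × Eu k₂ →L[ℝ] Eu k}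

/-- The derivative of the equation `F₁ = F₂` and of the leaf coordinate `C` of an adapted chart. -/
def fibreDeriv (φ₁ : OpenPartialHomeomorph P₁.W (Eu k₁ × Eu l₁))
    (φ₂ : OpenPartialHomeomorph P₂.W (Eu k₂ × Eu l₂)) (ψ : OpenPartialHomeomorph M (Eu n))
    (C : Eu k₁ × Eu k₂ →L[ℝ] Eu k) (p : f₁.Pullback f₂) : Eu k₁ × Eu k₂ →L[ℝ] Eu n × Eu k :=
  jointMap (mapDeriv E₁.F φ₁ ψ (P₁.ι p.1.1)) (mapDeriv E₂.F φ₂ ψ (P₂.ι p.1.2)) C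

theorem fibreDeriv_change [IsManifold (𝓡 n) r M] (hr : 1 ≤ r) {p : f₁.Pullback f₂}
    (hφ₁ : P₁.foliation.IsFlowChart φ₁) (hφ₁' : P₁.foliation.IsFlowChart φ₁')
    (hφ₂ : P₂.foliation.IsFlowChart φ₂) (hφ₂' : P₂.foliation.IsFlowChart φ₂')
    (hψ : ψ ∈ atlas (Eu n) M) (hψ' : ψ' ∈ atlas (Eu n) M)
    (h₁ : P₁.ι p.1.1 ∈ φ₁.source) (h₁' : P₁.ι p.1.1 ∈ φ₁'.source) (h₂ : P₂.ι p.1.2 ∈ φ₂.source)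
    (h₂' : P₂.ι p.1.2 ∈ φ₂'.source) (hp : commonMap f₁ f₂ p ∈ ψ.source)
    (hp' : commonMap f₁ f₂ p ∈ ψ'.source) (x : Eu k₁ × Eu k₂) :
    (fibreDeriv E₁ E₂ φ₁' φ₂' ψ' C' p (FoliatedAtlas.leafTransition φ₁ φ₁' (P₁.ι p.1.1) x.1,
        FoliatedAtlas.leafTransition φ₂ φ₂' (P₂.ι p.1.2) x.2)).1 =
      fderiv ℝ (fun m => ψ' (ψ.symm m)) (ψ (commonMap f₁ f₂ p))
        (fibreDeriv E₁ E₂ φ₁ φ₂ ψ C p x).1 := by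
  have e₁ := E₁.mapDeriv_change hr hφ₁ hφ₁' hψ hψ' h₁ h₁' hp hp' x.1
  have e₂ := E₂.mapDeriv_change hr hφ₂ hφ₂' hψ hψ' h₂ h₂' (by rwa [commonMap_eq_snd] at hp)
    (by rwa [commonMap_eq_snd] at hp') x.2
  rw [← commonMap_eq_snd p] at e₂
  simp only [fibreDeriv, jointMap_apply]
  rw [e₁, e₂, map_sub]
  rfl

variable (h₁ : k ≤ k₁) (h₂ : k ≤ k₂) (hk : k + n = k₁ + k₂) (oM : ManifoldOrientation n M)
  (o₁ : P₁.LeafOrientation) (o₂ : P₂.LeafOrientation)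

/-- The sign of the intersection orientation in an adapted chart. -/
def fibreSign (φ₁ : OpenPartialHomeomorph P₁.W (Eu k₁ × Eu l₁))
    (φ₂ : OpenPartialHomeomorph P₂.W (Eu k₂ × Eu l₂)) (ψ : OpenPartialHomeomorph M (Eu n))
    (C : Eu k₁ × Eu k₂ →L[ℝ] Eu k) (p : f₁.Pullback f₂) : ℤˣ :=
  signOf (jointDet h₁ h₂ hk (fibreDeriv E₁ E₂ φ₁ φ₂ ψ C p)) * o₁.sign φ₁ p.1.1 *
    o₂.sign φ₂ p.1.2 * oM.sign ψ (commonMap f₁ f₂ p)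

theorem eventually_fibreSign_eq (hr : 1 ≤ r) {p : f₁.Pullback f₂} (hφ₁ : φ₁ ∈ P₁.foliation.charts)
    (hφ₂ : φ₂ ∈ P₂.foliation.charts) (hψ : ψ ∈ atlas (Eu n) M) (hp₁ : P₁.ι p.1.1 ∈ φ₁.source)
    (hp₂ : P₂.ι p.1.2 ∈ φ₂.source) (hp : commonMap f₁ f₂ p ∈ ψ.source)
    (hD : Function.Bijective (fibreDeriv E₁ E₂ φ₁ φ₂ ψ C p)) :
    ∀ᶠ q in 𝓝 p, fibreSign E₁ E₂ h₁ h₂ hk oM o₁ o₂ φ₁ φ₂ ψ C q =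
      fibreSign E₁ E₂ h₁ h₂ hk oM o₁ o₂ φ₁ φ₂ ψ C p := by
  have c₁ : Continuous fun q : f₁.Pullback f₂ => q.1.1 :=
    continuous_fst.comp continuous_subtype_val
  have c₂ : Continuous fun q : f₁.Pullback f₂ => q.1.2 :=
    continuous_snd.comp continuous_subtype_val
  have d₁ : ContinuousAt (fun q : f₁.Pullback f₂ => mapDeriv E₁.F φ₁ ψ (P₁.ι q.1.1)) p :=
    (E₁.continuousAt_mapDeriv hr (FoliatedAtlas.isFlowChart_of_mem hφ₁) hψ hp₁ hp).comp
      (f := fun q : f₁.Pullback f₂ => q.1.1) c₁.continuousAt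
  have d₂ : ContinuousAt (fun q : f₁.Pullback f₂ => mapDeriv E₂.F φ₂ ψ (P₂.ι q.1.2)) p :=
    (E₂.continuousAt_mapDeriv hr (FoliatedAtlas.isFlowChart_of_mem hφ₂) hψ hp₂
      (by rwa [commonMap_eq_snd] at hp)).comp (f := fun q : f₁.Pullback f₂ => q.1.2) c₂.continuousAt
  have hd := ((continuous_jointDet h₁ h₂ hk).continuousAt.comp
    (continuousAt_jointMap C d₁ d₂)).eventually
      (eventually_signOf_eq (jointDet_ne_zero h₁ h₂ hk hD))
  filter_upwards [hd, c₁.continuousAt.eventually (o₁.locally_const _ hφ₁ _ hp₁),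
    c₂.continuousAt.eventually (o₂.locally_const _ hφ₂ _ hp₂),
    (E₁.continuous.comp c₁).continuousAt.eventually (oM.locally_const _ hψ _ hp)] with q e e₁ e₂ e₃
  have e' : signOf (jointDet h₁ h₂ hk (fibreDeriv E₁ E₂ φ₁ φ₂ ψ C q)) =
    signOf (jointDet h₁ h₂ hk (fibreDeriv E₁ E₂ φ₁ φ₂ ψ C p)) := e
  have e₃' : oM.sign ψ (commonMap f₁ f₂ q) = oM.sign ψ (commonMap f₁ f₂ p) := e₃
  rw [fibreSign, fibreSign, e', e₁, e₂, e₃']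

/-- The orientations of the factors and of `M` determine the signs of the leaf transitions and of
the change of charts of `M`; taking signs in `jointDet_change` then leaves the sign of `L.det`. It
is used with the transition between adapted charts, for compatibility, and with `L` the identity, to
change the auxiliary charts. -/
theorem signOf_mul_fibreSign [IsManifold (𝓡 n) r M] (hr : 1 ≤ r) {p : f₁.Pullback f₂}
    (hφ₁ : φ₁ ∈ P₁.foliation.charts) (hφ₁' : φ₁' ∈ P₁.foliation.charts)
    (hφ₂ : φ₂ ∈ P₂.foliation.charts) (hφ₂' : φ₂' ∈ P₂.foliation.charts)
    (hψ : ψ ∈ atlas (Eu n) M) (hψ' : ψ' ∈ atlas (Eu n) M)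
    (hp₁ : P₁.ι p.1.1 ∈ φ₁.source) (hp₁' : P₁.ι p.1.1 ∈ φ₁'.source)
    (hp₂ : P₂.ι p.1.2 ∈ φ₂.source) (hp₂' : P₂.ι p.1.2 ∈ φ₂'.source)
    (hp : commonMap f₁ f₂ p ∈ ψ.source) (hp' : commonMap f₁ f₂ p ∈ ψ'.source)
    (hD : Function.Bijective (fibreDeriv E₁ E₂ φ₁ φ₂ ψ C p))
    (hD' : Function.Bijective (fibreDeriv E₁ E₂ φ₁' φ₂' ψ' C' p)) {L : Eu k →L[ℝ] Eu k}
    (hL : ∀ x, (fibreDeriv E₁ E₂ φ₁ φ₂ ψ C p x).1 = 0 →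
      C' (FoliatedAtlas.leafTransition φ₁ φ₁' (P₁.ι p.1.1) x.1,
        FoliatedAtlas.leafTransition φ₂ φ₂' (P₂.ι p.1.2) x.2) = L (C x)) :
    L.det ≠ 0 ∧ signOf L.det = fibreSign E₁ E₂ h₁ h₂ hk oM o₁ o₂ φ₁ φ₂ ψ C p *
      fibreSign E₁ E₂ h₁ h₂ hk oM o₁ o₂ φ₁' φ₂' ψ' C' p := by
  have key := jointDet_change h₁ h₂ hk hD (fibreDeriv_change E₁ E₂ (C := C) (C' := C') hr
    (FoliatedAtlas.isFlowChart_of_mem hφ₁) (FoliatedAtlas.isFlowChart_of_mem hφ₁')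
    (FoliatedAtlas.isFlowChart_of_mem hφ₂) (FoliatedAtlas.isFlowChart_of_mem hφ₂') hψ hψ'
    hp₁ hp₁' hp₂ hp₂' hp hp') hL
  obtain ⟨x0, sx⟩ := units_mul_pos_iff.1 (o₁.compat _ hφ₁ _ hφ₁' _ hp₁ hp₁')
  obtain ⟨y0, sy⟩ := units_mul_pos_iff.1 (o₂.compat _ hφ₂ _ hφ₂' _ hp₂ hp₂')
  obtain ⟨q0, sq⟩ := units_mul_pos_iff.1 (oM.compat _ hψ _ hψ' _ hp hp')
  change (FoliatedAtlas.leafTransition φ₁ φ₁' (P₁.ι p.1.1)).det ≠ 0 at x0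
  change (FoliatedAtlas.leafTransition φ₂ φ₂' (P₂.ι p.1.2)).det ≠ 0 at y0
  change signOf (FoliatedAtlas.leafTransition φ₁ φ₁' (P₁.ι p.1.1)).det = _ at sx
  change signOf (FoliatedAtlas.leafTransition φ₂ φ₂' (P₂.ι p.1.2)).det = _ at sy
  have d0 := jointDet_ne_zero h₁ h₂ hk hD
  have d0' := jointDet_ne_zero h₁ h₂ hk hD'
  have l0 : L.det ≠ 0 := fun h => by
    rw [h, mul_zero, zero_mul] at key
    exact mul_ne_zero d0' (mul_ne_zero x0 y0) key
  refine ⟨l0, ?_⟩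
  have hs := congr_arg signOf key
  rw [signOf_mul d0' (mul_ne_zero x0 y0), signOf_mul x0 y0, signOf_mul (mul_ne_zero q0 l0) d0,
    signOf_mul q0 l0, sx, sy, sq] at hs
  simp only [fibreSign]
  generalize signOf (jointDet h₁ h₂ hk (fibreDeriv E₁ E₂ φ₁ φ₂ ψ C p)) = d at hs ⊢
  generalize signOf (jointDet h₁ h₂ hk (fibreDeriv E₁ E₂ φ₁' φ₂' ψ' C' p)) = d' at hs ⊢
  generalize signOf L.det = ε at hs ⊢
  generalize oM.sign ψ (commonMap f₁ f₂ p) = m at hs ⊢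
  generalize oM.sign ψ' (commonMap f₁ f₂ p) = m' at hs ⊢
  generalize o₁.sign φ₁ p.1.1 = a at hs ⊢
  generalize o₁.sign φ₁' p.1.1 = a' at hs ⊢
  generalize o₂.sign φ₂ p.1.2 = b at hs ⊢
  generalize o₂.sign φ₂' p.1.2 = b' at hs ⊢
  calc ε = (m * m) * (m' * m') * (d * d) * ε := by simp [Int.units_mul_self]
    _ = (m * m' * ε * d) * (m * m' * d) := by ac_rfl
    _ = d' * (a * a' * (b * b')) * (m * m' * d) := by rw [hs]
    _ = _ := by ac_rfl

variable (hr : 1 ≤ r) (htr : IntersectTransversally n P₁ P₂ f₁ f₂)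

/-- The kernel of the linearized equation is the tangent space of the leaf of the fibre product: a
vector `x` in it is the pair of components of the leaf vector `C x`. On such vectors the transition
of adapted charts is computed through the transitions of the factors. -/
theorem fibreSolenoid_leafTransition
    {θ θ' : OpenPartialHomeomorph (fibreSet n P₁.foliation P₂.foliation E₁.U E₂.U E₁.F E₂.F)
      (Eu k × Eu (l₁ + l₂))} (hφ₁ : P₁.foliation.IsFlowChart φ₁)
    (hφ₁' : P₁.foliation.IsFlowChart φ₁') (hφ₂ : P₂.foliation.IsFlowChart φ₂)
    (hφ₂' : P₂.foliation.IsFlowChart φ₂') (hψ : ψ ∈ atlas (Eu n) M)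
    (hθ : IsAdapted r s E₁.F E₂.F φ₁ φ₂ ψ C θ)
    (hθ' : IsAdapted r s E₁.F E₂.F φ₁' φ₂' ψ' C' θ') {p : f₁.Pullback f₂}
    (hp : (fibreSolenoid E₁ E₂ hr hk htr).ι p ∈ θ.source)
    (hp' : (fibreSolenoid E₁ E₂ hr hk htr).ι p ∈ θ'.source) (x : Eu k₁ × Eu k₂)
    (hx : (fibreDeriv E₁ E₂ φ₁ φ₂ ψ C p x).1 = 0) :
    C' (FoliatedAtlas.leafTransition φ₁ φ₁' (P₁.ι p.1.1) x.1,
        FoliatedAtlas.leafTransition φ₂ φ₂' (P₂.ι p.1.2) x.2) =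
      FoliatedAtlas.leafTransition θ θ' ((fibreSolenoid E₁ E₂ hr hk htr).ι p) (C x) := by
  set w : fibreSet n P₁.foliation P₂.foliation E₁.U E₂.U E₁.F E₂.F :=
    (fibreSolenoid E₁ E₂ hr hk htr).ι p with hw
  have hF : (fun w : fibreSet n P₁.foliation P₂.foliation E₁.U E₂.U E₁.F E₂.F => E₁.F w.1.1) =
      fun w => E₂.F w.1.2 := funext fun w => w.2.2.2.1
  have hψp := hθ.mem_chart w hp
  have d₁ := hθ.mapDeriv_fst hr E₁.isClassCrsMap hφ₁ hψ hp w.2.1 hψp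
  have d₂ := hθ.mapDeriv_snd hr E₂.isClassCrsMap hφ₂ hψ hp w.2.2.1 (w.2.2.2.1 ▸ hψp)
  rw [← hF, d₁] at d₂
  have hb : x = (leafDeriv (fun z => (φ₁ (θ.symm z).1.1).1) (θ w) (C x),
      leafDeriv (fun z => (φ₂ (θ.symm z).1.2).1) (θ w) (C x)) := by
    refine (hθ.bijective w hp).1 (Prod.ext ?_ ?_)
    · refine Eq.trans hx ?_
      rw [jointMap_apply]
      exact (sub_eq_zero.2 (DFunLike.congr_fun d₂ (C x))).symm
    · exact (hθ.leafDeriv_leaf hr hp (C x)).symm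
  rw [hθ.leafTransition_apply hr hθ' hφ₁ hφ₁' hφ₂ hφ₂' hp hp']
  conv_lhs => rw [hb]
  rfl

theorem bijective_fibreDeriv
    {θ : OpenPartialHomeomorph (fibreSet n P₁.foliation P₂.foliation E₁.U E₂.U E₁.F E₂.F)
      (Eu k × Eu (l₁ + l₂))} (hθ : IsAdapted r s E₁.F E₂.F φ₁ φ₂ ψ C θ) {p : f₁.Pullback f₂}
    (hp : (fibreSolenoid E₁ E₂ hr hk htr).ι p ∈ θ.source) :
    Function.Bijective (fibreDeriv E₁ E₂ φ₁ φ₂ ψ C p) :=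
  hθ.bijective ⟨(P₁.ι p.1.1, P₂.ι p.1.2), mem_fibreSet E₁ E₂ hr htr p⟩ hp

theorem commonMap_mem_source
    {θ : OpenPartialHomeomorph (fibreSet n P₁.foliation P₂.foliation E₁.U E₂.U E₁.F E₂.F)
      (Eu k × Eu (l₁ + l₂))} (hθ : IsAdapted r s E₁.F E₂.F φ₁ φ₂ ψ C θ) {p : f₁.Pullback f₂}
    (hp : (fibreSolenoid E₁ E₂ hr hk htr).ι p ∈ θ.source) : commonMap f₁ f₂ p ∈ ψ.source := by
  have := hθ.mem_chart _ hp
  rwa [fibreSolenoid_ι, E₁.eq] at this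

/-- The intersection orientation satisfies its characterization by frames. -/
theorem fibreSign_frame [IsManifold (𝓡 n) r M] (hf₁ : P₁.IsImmersion n f₁)
    (hf₂ : P₂.IsImmersion n f₂) {p : f₁.Pullback f₂}
    {θ : OpenPartialHomeomorph (fibreSet n P₁.foliation P₂.foliation E₁.U E₂.U E₁.F E₂.F)
      (Eu k × Eu (l₁ + l₂))}
    (hφ₁ : φ₁ ∈ P₁.foliation.charts) (hφ₁' : φ₁' ∈ P₁.foliation.charts)
    (hφ₂ : φ₂ ∈ P₂.foliation.charts) (hφ₂' : φ₂' ∈ P₂.foliation.charts)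
    (hψ : ψ ∈ atlas (Eu n) M) (hθ : IsAdapted r s E₁.F E₂.F φ₁ φ₂ ψ C θ)
    (hp : (fibreSolenoid E₁ E₂ hr hk htr).ι p ∈ θ.source)
    (hp₁' : P₁.ι p.1.1 ∈ φ₁'.source) (hp₂' : P₂.ι p.1.2 ∈ φ₂'.source)
    {e : Fin k → Eu k} {u : Fin k₁ → Eu k₁} {v : Fin k₂ → Eu k₂}
    (hu : LinearIndependent ℝ u) (hv : LinearIndependent ℝ v)
    (huv : ∀ (i : Fin k) (i₁ : Fin k₁) (i₂ : Fin k₂), i₁.val = i.val → i₂.val = i.val →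
        P₁.leafDiff n f₁ φ₁' p.1.1 (u i₁) =
          (fibreSolenoid E₁ E₂ hr hk htr).leafDiff n (commonMap f₁ f₂) θ p (e i) ∧
        P₂.leafDiff n f₂ φ₂' p.1.2 (v i₂) =
          (fibreSolenoid E₁ E₂ hr hk htr).leafDiff n (commonMap f₁ f₂) θ p (e i)) :
    0 < (((fibreSign E₁ E₂ h₁ h₂ hk oM o₁ o₂ φ₁ φ₂ ψ C p * o₁.sign φ₁' p.1.1 *
          o₂.sign φ₂' p.1.2 *
          oM.sign (chartAt (Eu n) (commonMap f₁ f₂ p)) (commonMap f₁ f₂ p) : ℤˣ) : ℤ) : ℝ) *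
        (frameDet e * frameDet u * frameDet v *
          frameDet fun i : Fin n =>
            if h : i.val < k₁ then P₁.leafDiff n f₁ φ₁' p.1.1 (u ⟨i.val, h⟩)
            else P₂.leafDiff n f₂ φ₂' p.1.2 (v ⟨i.val - k₁ + k, by have := i.isLt; omega⟩)) := by
  have hfl₁ := FoliatedAtlas.isFlowChart_of_mem hφ₁
  have hfl₁' := FoliatedAtlas.isFlowChart_of_mem hφ₁'
  have hfl₂ := FoliatedAtlas.isFlowChart_of_mem hφ₂
  have hfl₂' := FoliatedAtlas.isFlowChart_of_mem hφ₂'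
  have hp₁ : P₁.ι p.1.1 ∈ φ₁.source := hθ.mem_fst _ hp
  have hp₂ : P₂.ι p.1.2 ∈ φ₂.source := hθ.mem_snd _ hp
  have hpψ : commonMap f₁ f₂ p ∈ ψ.source :=
    commonMap_mem_source E₁ E₂ hk hr htr hθ hp
  obtain ⟨c, hc⟩ : ∃ c, c = chartAt (Eu n) (commonMap f₁ f₂ p) := ⟨_, rfl⟩
  have hca : c ∈ atlas (Eu n) M := hc ▸ chart_mem_atlas _ _
  have hpc : commonMap f₁ f₂ p ∈ c.source := hc ▸ mem_chart_source _ _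
  have hd₁ : ∀ {φ : OpenPartialHomeomorph P₁.W (Eu k₁ × Eu l₁)}, φ ∈ P₁.foliation.charts →
      P₁.ι p.1.1 ∈ φ.source → P₁.leafDiff n f₁ φ p.1.1 = mapDeriv E₁.F φ c (P₁.ι p.1.1) :=
    fun hφ hpφ => by rw [hc, E₁.leafDiff_eq (FoliatedAtlas.isFlowChart_of_mem hφ) hpφ]; rfl
  have hd₂ : ∀ {φ : OpenPartialHomeomorph P₂.W (Eu k₂ × Eu l₂)}, φ ∈ P₂.foliation.charts →
      P₂.ι p.1.2 ∈ φ.source → P₂.leafDiff n f₂ φ p.1.2 = mapDeriv E₂.F φ c (P₂.ι p.1.2) :=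
    fun hφ hpφ => by
      rw [hc, E₂.leafDiff_eq (FoliatedAtlas.isFlowChart_of_mem hφ) hpφ, ← commonMap_eq_snd p]
  obtain ⟨L₁, hL₁d⟩ : ∃ L, L = FoliatedAtlas.leafTransition φ₁' φ₁ (P₁.ι p.1.1) := ⟨_, rfl⟩
  obtain ⟨L₂, hL₂d⟩ : ∃ L, L = FoliatedAtlas.leafTransition φ₂' φ₂ (P₂.ι p.1.2) := ⟨_, rfl⟩
  have hL₁ : Function.Injective L₁ :=
    hL₁d ▸ (hfl₁'.leafTransition_bijective hr hfl₁ hp₁' hp₁).1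
  have hL₂ : Function.Injective L₂ :=
    hL₂d ▸ (hfl₂'.leafTransition_bijective hr hfl₂ hp₂' hp₂).1
  -- `C` rewritten in the leaf coordinates of `φ₁'` and `φ₂'`: the leaf coordinate of the fibre
  -- product is unchanged, so the comparison of signs below has the identity as `L`.
  obtain ⟨C', hC'⟩ : ∃ C' : Eu k₁ × Eu k₂ →L[ℝ] Eu k, ∀ x, C (L₁ x.1, L₂ x.2) = C' x :=
    ⟨C.comp (L₁.prodMap L₂), fun _ => rfl⟩
  have hD : Function.Bijective (fibreDeriv E₁ E₂ φ₁ φ₂ ψ C p) :=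
    bijective_fibreDeriv E₁ E₂ hk hr htr hθ hp
  have hch := fibreDeriv_change E₁ E₂ (C := C') (C' := C) hr hfl₁' hfl₁ hfl₂' hfl₂ hca hψ hp₁' hp₁
    hp₂' hp₂ hpc hpψ
  rw [← hL₁d, ← hL₂d] at hch
  have hD' : Function.Bijective (fibreDeriv E₁ E₂ φ₁' φ₂' c C' p) :=
    bijective_of_change hk hD.1 hL₁ hL₂ hch hC'
  obtain ⟨-, hs⟩ := signOf_mul_fibreSign E₁ E₂ h₁ h₂ hk oM o₁ o₂ hr hφ₁' hφ₁ hφ₂' hφ₂ hca hψ hp₁'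
    hp₁ hp₂' hp₂ hpc hpψ hD' hD (L := .id ℝ (Eu k)) fun x _ => by
      rw [← hL₁d, ← hL₂d]; exact hC' x
  have hid : (ContinuousLinearMap.id ℝ (Eu k)).det = 1 := LinearMap.det_id
  rw [hid, signOf_of_pos one_pos] at hs
  obtain ⟨B₁, B₂, hB₁, hB₂, hB⟩ := leafDiff_fibre E₁ E₂ hr hk htr hfl₁ hfl₂ hθ hp
  -- `u i` and `e i` have the same image in the tangent space of `M`; injectivity of the
  -- differential of `f₁` turns this into an equality in the leaf of `S₁`. With the analogue for
  -- `v`, the map `C'` sends the pair to `e i`.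
  have hu' : ∀ i : Fin k, L₁ (u ⟨i, by omega⟩) = B₁ (e i) := fun i => by
    refine hf₁.2 p.1.1 φ₁ hφ₁ hp₁ ?_
    have h3 := (huv i ⟨i, by omega⟩ ⟨i, by omega⟩ rfl rfl).1
    rw [hB₁, hd₁ hφ₁' hp₁', hd₁ hφ₁ hp₁] at h3
    rw [hd₁ hφ₁ hp₁]
    refine Eq.trans ?_ h3
    rw [hL₁d]
    exact (DFunLike.congr_fun (E₁.isClassCrsMap.leafDeriv_change hr hfl₁' hfl₁ hca (E₁.mem _)
      (by rw [E₁.eq]; exact hpc) hp₁' hp₁) _).symm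
  have hv' : ∀ i : Fin k, L₂ (v ⟨i, by omega⟩) = B₂ (e i) := fun i => by
    refine hf₂.2 p.1.2 φ₂ hφ₂ hp₂ ?_
    have h3 := (huv i ⟨i, by omega⟩ ⟨i, by omega⟩ rfl rfl).2
    rw [hB₂, hd₂ hφ₂' hp₂', hd₂ hφ₂ hp₂] at h3
    rw [hd₂ hφ₂ hp₂]
    refine Eq.trans ?_ h3
    rw [hL₂d]
    exact (DFunLike.congr_fun (E₂.isClassCrsMap.leafDeriv_change hr hfl₂' hfl₂ hca (E₂.mem _)
      (by rw [E₂.eq, ← commonMap_eq_snd p]; exact hpc) hp₂' hp₂) _).symm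
  have hframe := jointDet_frame h₁ h₂ hk (D₁ := mapDeriv E₁.F φ₁' c (P₁.ι p.1.1))
    (D₂ := mapDeriv E₂.F φ₂' c (P₂.ι p.1.2)) (C := C') (e := e) (u := u) (v := v)
    (fun i₁ i₂ hi hik => by
      obtain ⟨h3, h4⟩ := huv ⟨i₁, hik⟩ i₁ i₂ rfl hi.symm
      rw [← hd₁ hφ₁' hp₁', ← hd₂ hφ₂' hp₂', h3, h4])
    (fun i => by
      rw [← hC', hu' i, hv' i, hB])
  rw [← hd₁ hφ₁' hp₁', ← hd₂ hφ₂' hp₂'] at hframe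
  change jointDet h₁ h₂ hk (jointMap (P₁.leafDiff n f₁ φ₁' p.1.1)
    (P₂.leafDiff n f₂ φ₂' p.1.2) C') * _ = _ at hframe
  have hDl : fibreDeriv E₁ E₂ φ₁' φ₂' c C' p = jointMap (P₁.leafDiff n f₁ φ₁' p.1.1)
    (P₂.leafDiff n f₂ φ₂' p.1.2) C' := by rw [fibreDeriv, hd₁ hφ₁' hp₁', hd₂ hφ₂' hp₂']
  rw [← hDl] at hframe
  rw [← hc]
  generalize (frameDet fun i : Fin n =>
            if h : i.val < k₁ then P₁.leafDiff n f₁ φ₁' p.1.1 (u ⟨i.val, h⟩)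
            else P₂.leafDiff n f₂ φ₂' p.1.2 (v ⟨i.val - k₁ + k, by have := i.isLt; omega⟩)) = y
    at hframe ⊢
  have d0 := jointDet_ne_zero h₁ h₂ hk hD'
  have u0 := frameDet_ne_zero hu
  have v0 := frameDet_ne_zero hv
  -- That `e` and the composed frame of `M` are bases is not assumed; it follows from the
  -- determinant identity, whose other side has non-zero factors.
  have ye0 : y * frameDet e ≠ 0 := hframe ▸ mul_ne_zero d0 (mul_ne_zero u0 v0)
  have y0 := left_ne_zero_of_mul ye0
  have e0 := right_ne_zero_of_mul ye0
  refine units_mul_pos_iff.2 ⟨mul_ne_zero (mul_ne_zero (mul_ne_zero e0 u0) v0) y0, ?_⟩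
  rw [signOf_mul (mul_ne_zero (mul_ne_zero e0 u0) v0) y0, signOf_mul (mul_ne_zero e0 u0) v0,
    signOf_mul e0 u0]
  have hs2 := congr_arg signOf hframe
  rw [signOf_mul d0 (mul_ne_zero u0 v0), signOf_mul u0 v0, signOf_mul y0 e0] at hs2
  generalize fibreSign E₁ E₂ h₁ h₂ hk oM o₁ o₂ φ₁ φ₂ ψ C p = τ at hs ⊢
  simp only [fibreSign] at hs
  generalize signOf (jointDet h₁ h₂ hk (fibreDeriv E₁ E₂ φ₁' φ₂' c C' p)) = d at hs hs2
  generalize oM.sign c (commonMap f₁ f₂ p) = m at hs ⊢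
  generalize o₁.sign φ₁' p.1.1 = a at hs ⊢
  generalize o₂.sign φ₂' p.1.2 = b at hs ⊢
  generalize signOf (frameDet e) = se at hs2 ⊢
  generalize signOf (frameDet u) = su at hs2 ⊢
  generalize signOf (frameDet v) = sv at hs2 ⊢
  generalize signOf y = sy at hs2 ⊢
  calc se * su * sv * sy = (sy * se) * (su * sv) * 1 := by rw [mul_one]; ac_rfl
    _ = d * (su * su) * (sv * sv) * (d * a * b * m * τ) := by rw [← hs2, ← hs]; ac_rfl
    _ = (d * d) * (τ * a * b * m) := by
      rw [Int.units_mul_self su, Int.units_mul_self sv]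
      simp only [mul_one]
      ac_rfl
    _ = _ := by rw [Int.units_mul_self, one_mul]
/-- The intersection orientation of the fibre product. -/
theorem exists_inducedOrientation [IsManifold (𝓡 n) r M] (hf₁ : P₁.IsImmersion n f₁)
    (hf₂ : P₂.IsImmersion n f₂) (hn₁ : k ≤ k₁) (hn₂ : k ≤ k₂) :
    ∃ o : (fibreSolenoid E₁ E₂ hr hk htr).LeafOrientation,
      IsInducedOrientation hk P₁ P₂ (fibreSolenoid E₁ E₂ hr hk htr) oM o₁ o₂ o := by
  -- A sign is to be attached to the chart alone, while it may be adapted to several data `φ₁`,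
  -- `φ₂`, `ψ`, `C`; one choice is made for each chart. Outside of the atlas the value `1` is a
  -- dummy.
  have hex : ∀ θ : OpenPartialHomeomorph
      (fibreSet n P₁.foliation P₂.foliation E₁.U E₂.U E₁.F E₂.F) (Eu k × Eu (l₁ + l₂)),
      ∃ g : f₁.Pullback f₂ → ℤˣ, θ ∈ (fibreAtlas hr hk E₁.isClassCrsMap E₂.isClassCrsMap).charts →
        ∃ φ₁ ∈ P₁.foliation.charts, ∃ φ₂ ∈ P₂.foliation.charts, ∃ ψ ∈ atlas (Eu n) M, ∃ C,
          IsAdapted r s E₁.F E₂.F φ₁ φ₂ ψ C θ ∧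
            g = fibreSign E₁ E₂ hn₁ hn₂ hk oM o₁ o₂ φ₁ φ₂ ψ C := fun θ => by
    by_cases h : θ ∈ (fibreAtlas hr hk E₁.isClassCrsMap E₂.isClassCrsMap).charts
    · obtain ⟨φ₁, hφ₁, φ₂, hφ₂, ψ, hψ, C, hθ⟩ := h
      exact ⟨_, fun _ => ⟨φ₁, hφ₁, φ₂, hφ₂, ψ, hψ, C, hθ, rfl⟩⟩
    · exact ⟨1, fun h' => absurd h' h⟩
  choose g hg using hex
  refine ⟨⟨g, fun θ hθ p hp => ?_, fun θ hθ θ' hθ' p hp hp' => ?_⟩, ?_⟩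
  · obtain ⟨φ₁, hφ₁, φ₂, hφ₂, ψ, hψ, C, h, hgθ⟩ := hg θ hθ
    rw [hgθ]
    exact eventually_fibreSign_eq E₁ E₂ hn₁ hn₂ hk oM o₁ o₂ hr hφ₁ hφ₂ hψ (h.mem_fst _ hp)
      (h.mem_snd _ hp) (commonMap_mem_source E₁ E₂ hk hr htr h hp)
      (bijective_fibreDeriv E₁ E₂ hk hr htr h hp)
  · obtain ⟨φ₁, hφ₁, φ₂, hφ₂, ψ, hψ, C, h, hgθ⟩ := hg θ hθ
    obtain ⟨φ₁', hφ₁', φ₂', hφ₂', ψ', hψ', C', h', hgθ'⟩ := hg θ' hθ'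
    rw [hgθ, hgθ']
    exact units_mul_pos_iff.2 (signOf_mul_fibreSign E₁ E₂ hn₁ hn₂ hk oM o₁ o₂ hr hφ₁ hφ₁' hφ₂ hφ₂'
      hψ hψ' (h.mem_fst _ hp) (h'.mem_fst _ hp') (h.mem_snd _ hp) (h'.mem_snd _ hp')
      (commonMap_mem_source E₁ E₂ hk hr htr h hp) (commonMap_mem_source E₁ E₂ hk hr htr h' hp')
      (bijective_fibreDeriv E₁ E₂ hk hr htr h hp) (bijective_fibreDeriv E₁ E₂ hk hr htr h' hp')
      (fibreSolenoid_leafTransition E₁ E₂ hk hr htr (FoliatedAtlas.isFlowChart_of_mem hφ₁)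
        (FoliatedAtlas.isFlowChart_of_mem hφ₁') (FoliatedAtlas.isFlowChart_of_mem hφ₂)
        (FoliatedAtlas.isFlowChart_of_mem hφ₂') hψ h h' hp hp'))
  · intro p φ₁' hφ₁' hp₁' φ₂' hφ₂' hp₂' θ hθ hp e u v hu hv huv
    obtain ⟨φ₁, hφ₁, φ₂, hφ₂, ψ, hψ, C, h, hgθ⟩ := hg θ hθ
    simp only
    rw [hgθ]
    exact fibreSign_frame E₁ E₂ hn₁ hn₂ hk oM o₁ o₂ hr htr hf₁ hf₂ hφ₁ hφ₁' hφ₂ hφ₂' hψ h hp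
      hp₁' hp₂'
      hu hv huv

end FibreOrientation

/-! ### Images of measurable sets under locally defined injections -/

section PullMeasure

variable {X Y : Type*} [TopologicalSpace X] [PolishSpace X] [MeasurableSpace X] [BorelSpace X]
  [TopologicalSpace Y] [T2Space Y] [SecondCountableTopology Y] [MeasurableSpace Y] [BorelSpace Y]
  {A : Set X} {g : X → Y}

/-- The measure `E ↦ ν (g (E ∩ A))`, if `g` is continuous and injective on `A`. -/
def pullMeasure (ν : Measure Y) (g : X → Y) (A : Set X) : Measure X :=
  (ν.comap fun x : A => g x).map Subtype.val

/-- By the Lusin–Souslin theorem a continuous injection of a Borel subset of a Polish space is a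
measurable embedding. -/
theorem pullMeasure_apply (ν : Measure Y) (hA : MeasurableSet A) (hg : ContinuousOn g A)
    (hi : InjOn g A) {E : Set X} (hE : MeasurableSet E) :
    pullMeasure ν g A E = ν (g '' (E ∩ A)) := by
  have := hA.standardBorel
  have he : MeasurableEmbedding (fun x : A => g x) :=
    (continuousOn_iff_continuous_domRestrict.1 hg).measurable.measurableEmbedding
      (injOn_iff_injective.1 hi)
  rw [pullMeasure, Measure.map_apply measurable_subtype_coe hE, he.comap_apply, inter_comm E A,
    ← Subtype.image_preimage_coe A E, image_image]

/-- Second countability reduces the given neighbourhoods to countably many, and measures that agree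
on each piece of a countable cover agree on the union. No finiteness is needed. -/
theorem measure_eq_of_locally {m m' : Measure X} (hA : MeasurableSet A)
    (h : ∀ q ∈ A, ∃ U ∈ 𝓝 q, ∀ E ⊆ A ∩ U, MeasurableSet E → m E = m' E) : m A = m' A := by
  choose! U hU h using h
  obtain ⟨t, htA, htc, ht⟩ := TopologicalSpace.countable_cover_nhdsWithin (f := fun q =>
    A ∩ interior (U q)) (s := A) fun q hq => inter_mem self_mem_nhdsWithin
      (nhdsWithin_le_nhds (interior_mem_nhds.2 (hU q hq)))
  have e : A = ⋃ q ∈ t, A ∩ interior (U q) :=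
    ht.antisymm (iUnion₂_subset fun q _ => inter_subset_left)
  have hr : m.restrict (⋃ q ∈ t, A ∩ interior (U q)) =
      m'.restrict (⋃ q ∈ t, A ∩ interior (U q)) := by
    rw [Measure.restrict_biUnion_congr htc]
    intro q hq
    ext E hE
    rw [Measure.restrict_apply hE, Measure.restrict_apply hE]
    exact h q (htA hq) _ (inter_subset_right.trans (inter_subset_inter_right _ interior_subset))
      (hE.inter (hA.inter isOpen_interior.measurableSet))
  rw [← e] at hr
  rw [← Measure.restrict_apply_self m, hr, Measure.restrict_apply_self]

theorem measure_image_eq_of_locally {Y' : Type*} [TopologicalSpace Y'] [T2Space Y']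
    [SecondCountableTopology Y'] [MeasurableSpace Y'] [BorelSpace Y'] {g' : X → Y'}
    {ν : Measure Y} {ν' : Measure Y'} (hA : MeasurableSet A) (hg : ContinuousOn g A)
    (hi : InjOn g A) (hg' : ContinuousOn g' A) (hi' : InjOn g' A)
    (h : ∀ q ∈ A, ∃ U ∈ 𝓝 q, ∀ E ⊆ A ∩ U, MeasurableSet E → ν (g '' E) = ν' (g' '' E)) :
    ν (g '' A) = ν' (g' '' A) := by
  have := measure_eq_of_locally (m := pullMeasure ν g A) (m' := pullMeasure ν' g' A) hA
    fun q hq => by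
      obtain ⟨U, hU, h⟩ := h q hq
      refine ⟨U, hU, fun E hE hEm => ?_⟩
      rw [pullMeasure_apply ν hA hg hi hEm, pullMeasure_apply ν' hA hg' hi' hEm,
        inter_eq_left.2 (hE.trans inter_subset_left)]
      exact h E hE hEm
  rwa [pullMeasure_apply ν hA hg hi hA, pullMeasure_apply ν' hA hg' hi' hA, inter_self] at this

end PullMeasure

/-! ### Transversal measures in the transverse coordinates of flow-boxes -/

namespace PreSolenoid

variable {k l : ℕ} {r s : WithTop ℕ∞} {S : Type u} [TopologicalSpace S]
  {P : PreSolenoid k l r s S}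

theorem polishSpace (P : PreSolenoid k l r s S) : PolishSpace S := by
  have := P.compact
  have := P.isEmbedding.t2Space
  have := P.isEmbedding.secondCountableTopology
  let _ := TopologicalSpace.metrizableSpaceMetric S
  infer_instance

namespace FlowBox

open Classical in
/-- The transverse coordinate, extended by `0`. -/
def coord (B : P.FlowBox) : S → Eu l := B.domain.piecewise B.transCoord 0

open Classical in
theorem coord_eq {B : P.FlowBox} {p : S} (hp : p ∈ B.domain) : B.coord p = B.transCoord p :=
  piecewise_eq_of_mem _ _ _ hp

section Measurable

variable [MeasurableSpace S] [BorelSpace S]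

theorem measurableSet_domain (B : P.FlowBox) : MeasurableSet B.domain :=
  B.isOpen_domain.measurableSet

theorem measurableSet_transversal (B : P.FlowBox) : MeasurableSet B.transversal := by
  have h : B.transversal = B.domain \ (B.domain ∩ B.leafCoord ⁻¹' {0}ᶜ) := by
    ext p
    simp [transversal]
  rw [h]
  exact B.measurableSet_domain.diff (B.continuousOn_leafCoord.isOpen_inter_preimage B.isOpen_domain
    isOpen_compl_singleton).measurableSet

open Classical in
theorem measurable_coord (B : P.FlowBox) : Measurable B.coord :=
  B.continuousOn_transCoord.measurable_piecewise continuousOn_const B.measurableSet_domain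

end Measurable

/-- The transversal of a flow-box projects injectively to that of the flow-box `B`. -/
structure IsSub (B' B : P.FlowBox) : Prop where
  nonempty : B'.transversal.Nonempty
  subset : B'.transversal ⊆ B.domain
  injOn : InjOn B.transCoord B'.transversal

theorem isSub_self {B : P.FlowBox} (h : B.transversal.Nonempty) : B.IsSub B :=
  ⟨h, fun _ hp => hp.1, fun _ hp _ hq => eq_of_mem_transversal hp hq⟩

theorem transversal_nonempty {B : P.FlowBox} (h : B.domain.Nonempty) : B.transversal.Nonempty :=
  let ⟨p, hp⟩ := h
  have : Nonempty S := ⟨p⟩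
  ⟨_, proj_mem hp⟩

theorem isLocalTransversal {B : P.FlowBox} (h : B.transversal.Nonempty) :
    P.IsLocalTransversal B.transversal := ⟨h, B, rfl⟩

theorem IsSub.nonempty_right {B' B : P.FlowBox} (h : B'.IsSub B) : B.transversal.Nonempty :=
  transversal_nonempty (h.nonempty.mono h.subset)

/-- Each point slides radially along its plaque of `B` to the centre of the plaque. The end map is
injective because distinct points of the transversal of `B'` lie in distinct plaques of `B`. -/
theorem IsSub.isHolonomyMap [Nonempty S] {B' B : P.FlowBox} (h : B'.IsSub B) :
    P.IsHolonomyMap B'.transversal B.transversal B'.transversal B.proj := by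
  have hm : ∀ q ∈ B'.transversal, ∀ t : I, ((1 - (t : ℝ)) • B.leafCoord q, B.transCoord q) ∈
      Metric.ball (0 : Eu k) 1 ×ˢ B.K := fun q hq t => by
    have h1 := coord_mem (h.subset hq)
    refine ⟨?_, h1.2⟩
    have h2 := h1.1
    rw [mem_ball_zero_iff] at h2 ⊢
    rw [norm_smul, Real.norm_of_nonneg (sub_nonneg.2 t.2.2)]
    exact (mul_le_of_le_one_left (norm_nonneg _) (by linarith [t.2.1])).trans_lt h2
  refine ⟨⟨univ, isOpen_univ, (inter_univ _).symm⟩, fun p hp q hq hpq => h.injOn hp hq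
    ((proj_eq_proj_iff (h.subset hp) (h.subset hq)).1 hpq), fun q hq => proj_mem (h.subset hq),
    fun z => B.point ((1 - (z.2 : ℝ)) • B.leafCoord z.1, B.transCoord z.1), ?_, fun q hq =>
      ⟨?_, ?_, ?_⟩⟩
  · refine B.continuousOn_point.comp ?_ fun z hz => hm _ hz.1 _
    have h1 : ContinuousOn (fun z : S × I => B.leafCoord z.1) (B'.transversal ×ˢ univ) :=
      B.continuousOn_leafCoord.comp continuousOn_fst fun z hz => h.subset hz.1
    have h2 : ContinuousOn (fun z : S × I => B.transCoord z.1) (B'.transversal ×ˢ univ) :=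
      B.continuousOn_transCoord.comp continuousOn_fst fun z hz => h.subset hz.1
    exact (ContinuousOn.smul (f := fun z : S × I => 1 - (z.2 : ℝ)) (by fun_prop) h1).prodMk h2
  · have h1 := B.isFlowChart.isLeafPath_plaque
      (x := fun t : I => (1 - (t : ℝ)) • B.leafCoord q) (y := B.transCoord q) (by fun_prop)
      fun t => mem_target (hm q hq t).1 (hm q hq t).2
    unfold IsLeafPath
    convert h1 using 2 with t
    exact ι_point (hm q hq t).1 (hm q hq t).2
  · simp [point_coord (h.subset hq)]
  · simp [proj]

end FlowBox

end PreSolenoid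

namespace PreSolenoid

variable {k l : ℕ} {r s : WithTop ℕ∞} {S : Type u} [TopologicalSpace S]
  {P : PreSolenoid k l r s S}

namespace FlowBox

/-- The flow-box `B'` is contained in `B`, and the plaques of `B'` are contained in distinct plaques
of `B`. -/
structure Refines (B' B : P.FlowBox) : Prop where
  subset : B'.domain ⊆ B.domain
  transCoord_eq_iff : ∀ p ∈ B'.domain, ∀ q ∈ B'.domain,
    B'.transCoord p = B'.transCoord q ↔ B.transCoord p = B.transCoord q

theorem Refines.isSub {B' B : P.FlowBox} (h : B'.Refines B) (hB : B'.transversal.Nonempty) :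
    B'.IsSub B :=
  ⟨hB, fun _ hp => h.subset hp.1, fun _ hp _ hq hpq =>
    eq_of_mem_transversal hp hq ((h.transCoord_eq_iff _ hp.1 _ hq.1).2 hpq)⟩

theorem Refines.transCoord_mem {B' B : P.FlowBox} (h : B'.Refines B) {p : S}
    (hp : p ∈ B'.domain) : B.transCoord p ∈ B.transCoord '' B'.transversal := by
  have : Nonempty S := ⟨p⟩
  exact ⟨B'.proj p, proj_mem hp, (h.transCoord_eq_iff _ (proj_mem hp).1 _ hp).1
    (transCoord_proj hp)⟩

/-- Keep the transverse coordinate of `B` and shrink until those of `B` and `B'` determine each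
other on the new flow-box. -/
theorem exists_refines (B B' : P.FlowBox) {p : S} (hp : p ∈ B.domain) (hp' : p ∈ B'.domain)
    {N : Set S} (hN : N ∈ 𝓝 p) : ∃ B'' : P.FlowBox, p ∈ B''.transversal ∧ B''.domain ⊆ N ∧
      B''.Refines B ∧ B''.Refines B' := by
  obtain ⟨N', hN', h⟩ := exists_nhds_transCoord_eq B B' hp hp'
  have hm := inter_mem (inter_mem hN hN') (B'.domain_mem_nhds hp')
  rw [P.isEmbedding.nhds_eq_comap, mem_comap] at hm
  obtain ⟨O, hO, hm⟩ := hm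
  obtain ⟨B'', hpB, hB, hB2, -⟩ := P.exists_flowBox B.isFlowChart hp hO
  have e : ∀ q, B''.transCoord q = B.transCoord q := fun q => hB2 _
  refine ⟨B'', hpB, fun q hq => (hm (hB hq).2).1.1, ⟨fun q hq => (hB hq).1, fun q _ q' _ => ?_⟩,
    ⟨fun q hq => (hm (hB hq).2).2, fun q hq q' hq' => ?_⟩⟩
  · rw [e, e]
  · rw [e, e]
    exact h _ (hm (hB hq).2).1.2 _ (hm (hB hq').2).1.2

end FlowBox

namespace TransversalMeasure

variable [MeasurableSpace S] (μ : P.TransversalMeasure)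

theorem measure_inter {T : Set S} (hT : P.IsLocalTransversal T) (E : Set S) :
    μ.measure T (E ∩ T) = μ.measure T E := measure_inter_conull (μ.supported T hT)

/-- Countably many neighbourhoods of finite measure cover `T`, and its complement is null. Products
of these measures are then well behaved. -/
theorem sigmaFinite {T : Set S} (hT : P.IsLocalTransversal T) : SigmaFinite (μ.measure T) := by
  have := P.isEmbedding.secondCountableTopology
  choose! V hV hfin using μ.locallyFinite T hT
  obtain ⟨t, htT, htc, ht⟩ := TopologicalSpace.countable_cover_nhdsWithin (f := V) (s := T)
    fun q hq => nhdsWithin_le_nhds (hV q hq)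
  refine Measure.sigmaFinite_of_countable (S := insert Tᶜ (V '' t)) ((htc.image V).insert _) ?_ ?_
  · rintro _ (rfl | ⟨q, hq, rfl⟩)
    · rw [μ.supported T hT]
      exact ENNReal.zero_lt_top
    · exact hfin q (htT hq)
  · refine eq_univ_of_forall fun p => ?_
    by_cases hp : p ∈ T
    · obtain ⟨q, hq, hpq⟩ := mem_iUnion₂.1 (ht hp)
      exact ⟨V q, Or.inr ⟨q, hq, rfl⟩, hpq⟩
    · exact ⟨Tᶜ, Or.inl rfl, hp⟩

/-- The measure on the transverse space of a flow-box. -/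
def boxMeasure (B : P.FlowBox) : Measure (Eu l) := (μ.measure B.transversal).map B.coord

variable [BorelSpace S] {B B' : P.FlowBox}

/-- The projection of the transversal of `B'` along the plaques of `B` is a holonomy map, so
invariance of `μ` identifies the measure of `B'` with the part of the measure of `B` over its image.
-/
theorem boxMeasure_image [PolishSpace S] (h : B'.IsSub B) {D : Set S} (hD : D ⊆ B'.transversal)
    (hDm : MeasurableSet D) :
    μ.boxMeasure B (B.transCoord '' D) = μ.measure B'.transversal D := by
  have : Nonempty S := ⟨h.nonempty.some⟩
  have hDB : D ⊆ B.domain := hD.trans h.subset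
  have hm : MeasurableSet (B.transCoord '' D) :=
    hDm.image_of_continuousOn_injOn (B.continuousOn_transCoord.mono hDB) (h.injOn.mono hD)
  have hT := FlowBox.isLocalTransversal h.nonempty_right
  rw [boxMeasure, Measure.map_apply B.measurable_coord hm, ← μ.measure_inter hT,
    ← μ.invariant _ _ _ _ (FlowBox.isLocalTransversal h.nonempty) hT h.isHolonomyMap D hD hDm]
  congr 1
  ext t
  constructor
  · rintro ⟨⟨q, hq, hqt⟩, ht⟩
    rw [FlowBox.coord_eq ht.1] at hqt
    exact ⟨q, hq, by rw [← FlowBox.proj_eq_self ht, FlowBox.proj_eq_proj_iff (hDB hq) ht.1, hqt]⟩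
  · rintro ⟨q, hq, rfl⟩
    have h1 := FlowBox.proj_mem (hDB hq)
    refine ⟨⟨q, hq, ?_⟩, h1⟩
    rw [FlowBox.coord_eq h1.1, FlowBox.transCoord_proj (hDB hq)]

theorem restrict_boxMeasure [PolishSpace S] (h : B'.IsSub B) :
    (μ.boxMeasure B).restrict (B.transCoord '' B'.transversal) =
      (μ.measure B'.transversal).map B.coord := by
  ext E hE
  have hT := FlowBox.isLocalTransversal h.nonempty
  rw [Measure.restrict_apply hE, Measure.map_apply B.measurable_coord hE, ← μ.measure_inter hT,
    ← μ.boxMeasure_image h inter_subset_right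
      ((B.measurable_coord hE).inter B'.measurableSet_transversal)]
  congr 1
  ext y
  constructor
  · rintro ⟨hy, q, hq, rfl⟩
    exact ⟨q, ⟨by rwa [mem_preimage, FlowBox.coord_eq (h.subset hq)], hq⟩, rfl⟩
  · rintro ⟨q, ⟨hq, hq'⟩, rfl⟩
    exact ⟨by rwa [mem_preimage, FlowBox.coord_eq (h.subset hq')] at hq, q, hq', rfl⟩

end TransversalMeasure

end PreSolenoid

/-! ### Products of transverse measures in pairs of flow-boxes -/

section ProductMeasure

variable {k₁ k₂ l₁ l₂ : ℕ} {r s : WithTop ℕ∞} {S₁ : Type u} [TopologicalSpace S₁]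
  [MeasurableSpace S₁] [BorelSpace S₁] [PolishSpace S₁] {S₂ : Type v} [TopologicalSpace S₂]
  [MeasurableSpace S₂] [BorelSpace S₂] [PolishSpace S₂] {P₁ : PreSolenoid k₁ l₁ r s S₁}
  {P₂ : PreSolenoid k₂ l₂ r s S₂} (μ₁ : P₁.TransversalMeasure) (μ₂ : P₂.TransversalMeasure)

open PreSolenoid

/-- The product of the measures on the transverse spaces of two flow-boxes. -/
def boxProduct (B₁ : P₁.FlowBox) (B₂ : P₂.FlowBox) : Measure (Eu l₁ × Eu l₂) :=
  (μ₁.boxMeasure B₁).prod (μ₂.boxMeasure B₂)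

/-- Over a rectangle the product measure is the product of the restrictions, and these come from the
smaller transversals by `restrict_boxMeasure`. Products in different flow-boxes can so be compared
on common smaller ones. -/
theorem boxProduct_apply {B₁ B₁' : P₁.FlowBox} {B₂ B₂' : P₂.FlowBox} (h₁ : B₁'.IsSub B₁)
    (h₂ : B₂'.IsSub B₂) {X : Set (Eu l₁ × Eu l₂)} (hX : MeasurableSet X)
    (hX' : X ⊆ (B₁.transCoord '' B₁'.transversal) ×ˢ (B₂.transCoord '' B₂'.transversal)) :
    boxProduct μ₁ μ₂ B₁ B₂ X =
      (μ₁.measure B₁'.transversal).prod (μ₂.measure B₂'.transversal)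
        {t | t.1 ∈ B₁'.transversal ∧ t.2 ∈ B₂'.transversal ∧
          (B₁.transCoord t.1, B₂.transCoord t.2) ∈ X} := by
  have T₁ := FlowBox.isLocalTransversal h₁.nonempty
  have T₂ := FlowBox.isLocalTransversal h₂.nonempty
  have f₁ := μ₁.sigmaFinite T₁
  have f₂ := μ₂.sigmaFinite T₂
  have g₁ := μ₁.sigmaFinite (FlowBox.isLocalTransversal h₁.nonempty_right)
  have g₂ := μ₂.sigmaFinite (FlowBox.isLocalTransversal h₂.nonempty_right)
  have s₁ : SFinite (μ₁.boxMeasure B₁) := by unfold TransversalMeasure.boxMeasure; infer_instance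
  have s₂ : SFinite (μ₂.boxMeasure B₂) := by unfold TransversalMeasure.boxMeasure; infer_instance
  have e₁ : (μ₁.measure B₁'.transversal).restrict B₁'.transversal = μ₁.measure B₁'.transversal :=
    Measure.restrict_eq_self_of_ae_mem (μ₁.supported _ T₁)
  have e₂ : (μ₂.measure B₂'.transversal).restrict B₂'.transversal = μ₂.measure B₂'.transversal :=
    Measure.restrict_eq_self_of_ae_mem (μ₂.supported _ T₂)
  have hm : Measurable (Prod.map B₁.coord B₂.coord) :=
    B₁.measurable_coord.prodMap B₂.measurable_coord
  rw [boxProduct, ← Measure.restrict_eq_self _ hX', ← Measure.prod_restrict,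
    μ₁.restrict_boxMeasure h₁, μ₂.restrict_boxMeasure h₂,
    Measure.map_prod_map _ _ B₁.measurable_coord B₂.measurable_coord, Measure.map_apply hm hX]
  conv_lhs => rw [← e₁, ← e₂, Measure.prod_restrict, Measure.restrict_apply (hm hX)]
  congr 1
  ext t
  constructor
  · rintro ⟨h, ht₁, ht₂⟩
    refine ⟨ht₁, ht₂, ?_⟩
    rwa [mem_preimage, Prod.map_apply', FlowBox.coord_eq (h₁.subset ht₁),
      FlowBox.coord_eq (h₂.subset ht₂)] at h
  · rintro ⟨ht₁, ht₂, h⟩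
    refine ⟨?_, ht₁, ht₂⟩
    rwa [mem_preimage, Prod.map_apply', FlowBox.coord_eq (h₁.subset ht₁),
      FlowBox.coord_eq (h₂.subset ht₂)]

end ProductMeasure

open PreSolenoid

namespace PreSolenoid.TransversalMeasure

variable {k l : ℕ} {r s : WithTop ℕ∞} {S : Type u} [TopologicalSpace S] [MeasurableSpace S]
  [BorelSpace S] {P : PreSolenoid k l r s S} (μ : P.TransversalMeasure) {B : P.FlowBox}

theorem sFinite_boxMeasure (hB : B.transversal.Nonempty) : SFinite (μ.boxMeasure B) := by
  have := μ.sigmaFinite (FlowBox.isLocalTransversal hB)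
  unfold boxMeasure
  infer_instance

theorem exists_boxMeasure_lt_top {p : S} (hp : p ∈ B.domain) :
    ∃ U, IsOpen U ∧ B.transCoord p ∈ U ∧ μ.boxMeasure B U < ⊤ := by
  have : Nonempty S := ⟨p⟩
  have hT := FlowBox.isLocalTransversal (FlowBox.transversal_nonempty ⟨p, hp⟩)
  obtain ⟨V, hV, hfin⟩ := μ.locallyFinite _ hT _ (FlowBox.proj_mem hp)
  have hc : ContinuousWithinAt (fun y => B.point (0, y)) B.K (B.transCoord p) :=
    (B.continuousOn_point.comp (continuousOn_const.prodMk continuousOn_id) fun y hy =>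
      ⟨Metric.mem_ball_self one_pos, hy⟩) _ (FlowBox.coord_mem hp).2
  obtain ⟨U, hU, hpU, hUV⟩ := mem_nhdsWithin.1 (hc.preimage_mem_nhdsWithin hV)
  refine ⟨U, hU, hpU, ?_⟩
  rw [boxMeasure, Measure.map_apply B.measurable_coord hU.measurableSet, ← μ.measure_inter hT]
  refine (measure_mono fun t ht => ?_).trans_lt hfin
  have h1 := ht.1
  rw [mem_preimage, FlowBox.coord_eq ht.2.1] at h1
  have h2 : B.proj t ∈ V := hUV ⟨h1, (FlowBox.coord_mem ht.2.1).2⟩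
  rwa [FlowBox.proj_eq_self ht.2] at h2

end PreSolenoid.TransversalMeasure

section PairCoord

variable {k k₁ k₂ l l₁ l₂ : ℕ} {r s : WithTop ℕ∞} {M : Type w} {S₁ : Type u} [TopologicalSpace S₁]
  {S₂ : Type v} [TopologicalSpace S₂] {f₁ : S₁ → M} {f₂ : S₂ → M}
  {P₁ : PreSolenoid k₁ l₁ r s S₁} {P₂ : PreSolenoid k₂ l₂ r s S₂}

/-- The transverse coordinates of a point of the fibre product in two flow-boxes. -/
def pairCoord (B₁ : P₁.FlowBox) (B₂ : P₂.FlowBox) (q : f₁.Pullback f₂) : Eu l₁ × Eu l₂ :=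
  (B₁.transCoord q.1.1, B₂.transCoord q.1.2)

/-- The part of the fibre product in the product of two flow-boxes. -/
def pairDomain (f₁ : S₁ → M) (f₂ : S₂ → M) (B₁ : P₁.FlowBox) (B₂ : P₂.FlowBox) :
    Set (f₁.Pullback f₂) :=
  {q | q.1.1 ∈ B₁.domain ∧ q.1.2 ∈ B₂.domain}

variable {B₁ B₁' : P₁.FlowBox} {B₂ B₂' : P₂.FlowBox}

theorem isOpen_pairDomain : IsOpen (pairDomain f₁ f₂ B₁ B₂) :=
  (B₁.isOpen_domain.preimage (continuous_fst.comp continuous_subtype_val)).inter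
    (B₂.isOpen_domain.preimage (continuous_snd.comp continuous_subtype_val))

theorem continuousOn_pairCoord :
    ContinuousOn (pairCoord B₁ B₂) (pairDomain f₁ f₂ B₁ B₂) :=
  (B₁.continuousOn_transCoord.comp (continuous_fst.comp continuous_subtype_val).continuousOn
    fun _ h => h.1).prodMk (B₂.continuousOn_transCoord.comp
      (continuous_snd.comp continuous_subtype_val).continuousOn fun _ h => h.2)

variable (P₁ P₂) in
theorem exists_mem_pairDomain (p : f₁.Pullback f₂) :
    ∃ (B₁ : P₁.FlowBox) (B₂ : P₂.FlowBox), p ∈ pairDomain f₁ f₂ B₁ B₂ := by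
  obtain ⟨B₁, h₁, -⟩ := P₁.exists_flowBox_mem p.1.1 univ_mem
  obtain ⟨B₂, h₂, -⟩ := P₂.exists_flowBox_mem p.1.2 univ_mem
  exact ⟨B₁, B₂, h₁.1, h₂.1⟩

/-- The transverse coordinates of the factors are locally injective on the local transversals. -/
theorem IsInducedStructure.exists_injOn {M : Type w} [TopologicalSpace M] {f₁ : S₁ → M}
    {f₂ : S₂ → M} {P : PreSolenoid k (l₁ + l₂) r s (f₁.Pullback f₂)}
    (h : IsInducedStructure P₁ P₂ P) {T : Set (f₁.Pullback f₂)} (hT : P.IsLocalTransversal T)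
    {p : f₁.Pullback f₂} (hp : p ∈ T) (hpB : p ∈ pairDomain f₁ f₂ B₁ B₂) :
    ∃ N, IsOpen N ∧ p ∈ N ∧ N ⊆ pairDomain f₁ f₂ B₁ B₂ ∧ InjOn (pairCoord B₁ B₂) (T ∩ N) := by
  obtain ⟨-, B₀, rfl⟩ := hT
  obtain ⟨B, hB, hBq⟩ := h p B₁ B₂ hpB.1 hpB.2
  obtain ⟨N, hN, hNe⟩ := FlowBox.exists_nhds_transCoord_eq B B₀ hB hp.1
  refine ⟨interior N ∩ B.domain, isOpen_interior.inter B.isOpen_domain,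
    ⟨mem_interior_iff_mem_nhds.2 hN, hB⟩, fun q hq => ⟨(hBq q hq.2).1, (hBq q hq.2).2.1⟩, ?_⟩
  rintro q ⟨hqT, hqN, hqB⟩ q' ⟨hqT', hqN', hqB'⟩ hqq
  refine FlowBox.eq_of_mem_transversal hqT hqT'
    ((hNe _ (interior_subset hqN) _ (interior_subset hqN')).1 ?_)
  obtain ⟨e₁, e₂⟩ : B₁.transCoord q.1.1 = B₁.transCoord q'.1.1 ∧
    B₂.transCoord q.1.2 = B₂.transCoord q'.1.2 := Prod.ext_iff.1 hqq
  rw [(hBq q hqB).2.2, (hBq q' hqB').2.2, e₁, e₂]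

end PairCoord

/-! ### Independence of the flow-boxes, and the product measure on a local transversal -/

section ProductMeasure

variable {k k₁ k₂ l l₁ l₂ : ℕ} {r s : WithTop ℕ∞} {M : Type w} {S₁ : Type u} [TopologicalSpace S₁]
  [MeasurableSpace S₁] [BorelSpace S₁] [PolishSpace S₁] {S₂ : Type v} [TopologicalSpace S₂]
  [MeasurableSpace S₂] [BorelSpace S₂] [PolishSpace S₂] {f₁ : S₁ → M} {f₂ : S₂ → M}
  {P₁ : PreSolenoid k₁ l₁ r s S₁} {P₂ : PreSolenoid k₂ l₂ r s S₂}
  (μ₁ : P₁.TransversalMeasure) (μ₂ : P₂.TransversalMeasure)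
  {B₁ B₁' : P₁.FlowBox} {B₂ B₂' : P₂.FlowBox}

theorem boxProduct_prod (h₂ : B₂.transversal.Nonempty) (U : Set (Eu l₁)) (V : Set (Eu l₂)) :
    boxProduct μ₁ μ₂ B₁ B₂ (U ×ˢ V) = μ₁.boxMeasure B₁ U * μ₂.boxMeasure B₂ V := by
  have := μ₂.sFinite_boxMeasure h₂
  exact Measure.prod_prod _ _

/-- The product measure does not depend on the flow-boxes, locally. -/
theorem exists_boxProduct_eq {p : f₁.Pullback f₂} (hp : p ∈ pairDomain f₁ f₂ B₁ B₂)
    (hp' : p ∈ pairDomain f₁ f₂ B₁' B₂') : ∃ N, IsOpen N ∧ p ∈ N ∧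
      N ⊆ pairDomain f₁ f₂ B₁ B₂ ∧ N ⊆ pairDomain f₁ f₂ B₁' B₂' ∧
      (∀ q ∈ N, ∀ q' ∈ N, pairCoord B₁ B₂ q = pairCoord B₁ B₂ q' ↔
        pairCoord B₁' B₂' q = pairCoord B₁' B₂' q') ∧
      ∀ E ⊆ N, MeasurableSet (pairCoord B₁ B₂ '' E) → MeasurableSet (pairCoord B₁' B₂' '' E) →
        boxProduct μ₁ μ₂ B₁ B₂ (pairCoord B₁ B₂ '' E) =
          boxProduct μ₁ μ₂ B₁' B₂' (pairCoord B₁' B₂' '' E) := by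
  obtain ⟨C₁, hpC₁, -, h₁, h₁'⟩ := FlowBox.exists_refines B₁ B₁' hp.1 hp'.1 univ_mem
  obtain ⟨C₂, hpC₂, -, h₂, h₂'⟩ := FlowBox.exists_refines B₂ B₂' hp.2 hp'.2 univ_mem
  -- In either pair of flow-boxes, the measure of the image of `E` is computed on the transversals
  -- of the common refinements `C₁`, `C₂`, by an expression in which the original flow-boxes do not
  -- appear.
  have key : ∀ {D₁ : P₁.FlowBox} {D₂ : P₂.FlowBox}, C₁.Refines D₁ → C₂.Refines D₂ →
      ∀ E ⊆ pairDomain f₁ f₂ C₁ C₂, MeasurableSet (pairCoord D₁ D₂ '' E) →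
        boxProduct μ₁ μ₂ D₁ D₂ (pairCoord D₁ D₂ '' E) =
          (μ₁.measure C₁.transversal).prod (μ₂.measure C₂.transversal)
            {t | t.1 ∈ C₁.transversal ∧ t.2 ∈ C₂.transversal ∧
              ∃ q ∈ E, C₁.transCoord q.1.1 = C₁.transCoord t.1 ∧
                C₂.transCoord q.1.2 = C₂.transCoord t.2} := by
    intro D₁ D₂ g₁ g₂ E hE hEm
    rw [boxProduct_apply μ₁ μ₂ (g₁.isSub ⟨_, hpC₁⟩) (g₂.isSub ⟨_, hpC₂⟩) hEm]
    · congr 1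
      ext t
      refine and_congr_right fun ht₁ => and_congr_right fun ht₂ => exists_congr fun q =>
        and_congr_right fun hq => ?_
      rw [pairCoord, Prod.mk.injEq, g₁.transCoord_eq_iff _ (hE hq).1 _ ht₁.1,
        g₂.transCoord_eq_iff _ (hE hq).2 _ ht₂.1]
    · rintro _ ⟨q, hq, rfl⟩
      exact ⟨g₁.transCoord_mem (hE hq).1, g₂.transCoord_mem (hE hq).2⟩
  refine ⟨pairDomain f₁ f₂ C₁ C₂, isOpen_pairDomain, ⟨hpC₁.1, hpC₂.1⟩,
    fun q hq => ⟨h₁.subset hq.1, h₂.subset hq.2⟩, fun q hq => ⟨h₁'.subset hq.1, h₂'.subset hq.2⟩,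
    fun q hq q' hq' => ?_, fun E hE hm hm' => ?_⟩
  · simp only [pairCoord, Prod.mk.injEq]
    rw [← h₁.transCoord_eq_iff _ hq.1 _ hq'.1, ← h₂.transCoord_eq_iff _ hq.2 _ hq'.2,
      h₁'.transCoord_eq_iff _ hq.1 _ hq'.1, h₂'.transCoord_eq_iff _ hq.2 _ hq'.2]
  · rw [key h₁ h₂ E hE hm, key h₁' h₂' E hE hm']

variable [PolishSpace (f₁.Pullback f₂)]

theorem boxProduct_image_eq {A : Set (f₁.Pullback f₂)} (hA : MeasurableSet A)
    (hB : A ⊆ pairDomain f₁ f₂ B₁ B₂) (hi : InjOn (pairCoord B₁ B₂) A)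
    (hB' : A ⊆ pairDomain f₁ f₂ B₁' B₂') (hi' : InjOn (pairCoord B₁' B₂') A) :
    boxProduct μ₁ μ₂ B₁ B₂ (pairCoord B₁ B₂ '' A) =
      boxProduct μ₁ μ₂ B₁' B₂' (pairCoord B₁' B₂' '' A) := by
  have hc := continuousOn_pairCoord.mono hB
  have hc' := continuousOn_pairCoord.mono hB'
  refine measure_image_eq_of_locally hA hc hi hc' hi' fun q hq => ?_
  obtain ⟨N, hN, hqN, -, -, -, h⟩ := exists_boxProduct_eq μ₁ μ₂ (hB hq) (hB' hq)
  refine ⟨N, hN.mem_nhds hqN, fun E hE hEm => ?_⟩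
  have hEA := hE.trans inter_subset_left
  exact h E (hE.trans inter_subset_right)
    (hEm.image_of_continuousOn_injOn (hc.mono hEA) (hi.mono hEA))
    (hEm.image_of_continuousOn_injOn (hc'.mono hEA) (hi'.mono hEA))

variable [TopologicalSpace M] {P : PreSolenoid k (l₁ + l₂) r s (f₁.Pullback f₂)}

/-- `m` is the product measure on the local transversal `T`. -/
def IsProductOn (T : Set (f₁.Pullback f₂)) (m : Measure (f₁.Pullback f₂)) : Prop :=
  ∀ (B₁ : P₁.FlowBox) (B₂ : P₂.FlowBox), ∀ A ⊆ T, MeasurableSet A → A ⊆ pairDomain f₁ f₂ B₁ B₂ →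
    InjOn (pairCoord B₁ B₂) A → m A = boxProduct μ₁ μ₂ B₁ B₂ (pairCoord B₁ B₂ '' A)

/-- Cut `T` into countably many disjoint Borel pieces, on each of which the transverse coordinates
in some pair of flow-boxes are injective; pull the product measure back to each piece and add up.
Independence of the flow-boxes gives the product formula in every other pair. -/
theorem exists_isProductOn (h : IsInducedStructure P₁ P₂ P) {T : Set (f₁.Pullback f₂)}
    (hT : P.IsLocalTransversal T) : ∃ m, m Tᶜ = 0 ∧ IsProductOn μ₁ μ₂ T m := by
  have hTm : MeasurableSet T := by
    obtain ⟨-, B, rfl⟩ := hT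
    exact B.measurableSet_transversal
  choose C₁ C₂ hC using fun p : f₁.Pullback f₂ => exists_mem_pairDomain P₁ P₂ p
  choose! N hN hpN hNC hNi using fun p (hp : p ∈ T) => h.exists_injOn hT hp (hC p)
  obtain ⟨t, htT, htc, ht⟩ := TopologicalSpace.countable_cover_nhdsWithin (f := N) (s := T)
    fun p hp => nhdsWithin_le_nhds ((hN p hp).mem_nhds (hpN p hp))
  have hne : t.Nonempty := by
    obtain ⟨p, hp⟩ := hT.1
    obtain ⟨q, hq, -⟩ := mem_iUnion₂.1 (ht hp)
    exact ⟨q, hq⟩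
  obtain ⟨e, rfl⟩ := htc.exists_eq_range hne
  have heT : ∀ j, e j ∈ T := fun j => htT (mem_range_self j)
  -- Disjoint pieces are needed so that the sum counts every part of `T` exactly once.
  let D : ℕ → Set (f₁.Pullback f₂) := fun j => T ∩ disjointed (fun j => N (e j)) j
  have hDN : ∀ j, D j ⊆ T ∩ N (e j) := fun j => inter_subset_inter_right _ (disjointed_subset _ _)
  have hDm : ∀ j, MeasurableSet (D j) := fun j =>
    hTm.inter (MeasurableSet.disjointed (fun j => (hN _ (heT j)).measurableSet) j)
  have hDd : Pairwise (Function.onFun Disjoint D) := fun i j hij =>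
    (disjoint_disjointed _ hij).mono inter_subset_right inter_subset_right
  have hDT : T = ⋃ j, D j := by
    rw [← inter_iUnion, iUnion_disjointed]
    refine (inter_eq_left.2 (ht.trans ?_)).symm
    rw [biUnion_range]
  have hDc : ∀ j, D j ⊆ pairDomain f₁ f₂ (C₁ (e j)) (C₂ (e j)) := fun j =>
    ((hDN j).trans inter_subset_right).trans (hNC _ (heT j))
  have hDi : ∀ j, InjOn (pairCoord (C₁ (e j)) (C₂ (e j))) (D j) := fun j =>
    (hNi _ (heT j)).mono (hDN j)
  let m : Measure (f₁.Pullback f₂) := Measure.sum fun j =>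
    pullMeasure (boxProduct μ₁ μ₂ (C₁ (e j)) (C₂ (e j))) (pairCoord (C₁ (e j)) (C₂ (e j))) (D j)
  have hm : ∀ A, MeasurableSet A → m A = ∑' j, boxProduct μ₁ μ₂ (C₁ (e j)) (C₂ (e j))
      (pairCoord (C₁ (e j)) (C₂ (e j)) '' (A ∩ D j)) := fun A hA => by
    rw [Measure.sum_apply _ hA]
    exact tsum_congr fun j => pullMeasure_apply _ (hDm j)
      (continuousOn_pairCoord.mono (hDc j)) (hDi j) hA
  refine ⟨m, ?_, fun B₁ B₂ A hAT hA hAB hi => ?_⟩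
  · rw [hm _ hTm.compl, ENNReal.tsum_eq_zero]
    intro j
    have : Tᶜ ∩ D j = ∅ := by
      ext p
      simpa using fun hp hp' => absurd hp'.1 hp
    rw [this, image_empty, measure_empty]
  · have hAD : A = ⋃ j, A ∩ D j := by
      rw [← inter_iUnion, ← hDT, inter_eq_left.2 hAT]
    have hmi : ∀ j, MeasurableSet (A ∩ D j) := fun j => hA.inter (hDm j)
    rw [hm A hA]
    conv_rhs => rw [hAD, image_iUnion]
    rw [measure_iUnion]
    · exact tsum_congr fun j => boxProduct_image_eq μ₁ μ₂ (hmi j)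
        (inter_subset_right.trans (hDc j)) ((hDi j).mono inter_subset_right)
        (inter_subset_left.trans hAB) (hi.mono inter_subset_left)
    · intro i j hij
      rw [Function.onFun, disjoint_iff_inter_eq_empty,
        ← hi.image_inter inter_subset_left inter_subset_left,
        ((hDd hij).mono inter_subset_right inter_subset_right).inter_eq, image_empty]
    · exact fun j => (hmi j).image_of_continuousOn_injOn
        (continuousOn_pairCoord.mono (inter_subset_left.trans hAB)) (hi.mono inter_subset_left)

end ProductMeasure

/-! ### Holonomy invariance of the product measure -/

theorem exists_isPreconnected_subset {t : I} {J : Set I} (hJ : J ∈ 𝓝 t) :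
    ∃ J' ∈ 𝓝 t, IsPreconnected J' ∧ J' ⊆ J := by
  obtain ⟨ε, hε, h⟩ := Metric.mem_nhds_iff.1 hJ
  refine ⟨_, Metric.ball_mem_nhds t hε, ?_, h⟩
  rw [← IsInducing.subtypeVal.isPreconnected_image]
  have : Subtype.val '' Metric.ball t ε = Icc (0 : ℝ) 1 ∩ Metric.ball (t : ℝ) ε :=
    Subtype.image_preimage_coe (Icc (0 : ℝ) 1) (Metric.ball (t : ℝ) ε)
  rw [this]
  exact ((convex_Icc 0 1).inter (convex_ball _ _)).isPreconnected

section Invariance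

variable {k k₁ k₂ l l₁ l₂ : ℕ} {r s : WithTop ℕ∞} {M : Type w} [TopologicalSpace M]
  {S₁ : Type u} [TopologicalSpace S₁]
  [MeasurableSpace S₁] [BorelSpace S₁] [PolishSpace S₁] {S₂ : Type v} [TopologicalSpace S₂]
  [MeasurableSpace S₂] [BorelSpace S₂] [PolishSpace S₂] {f₁ : S₁ → M} {f₂ : S₂ → M}
  {P₁ : PreSolenoid k₁ l₁ r s S₁} {P₂ : PreSolenoid k₂ l₂ r s S₂}
  (μ₁ : P₁.TransversalMeasure) (μ₂ : P₂.TransversalMeasure)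
  {B₁ B₁' : P₁.FlowBox} {B₂ B₂' : P₂.FlowBox} [PolishSpace (f₁.Pullback f₂)]

/-- The map `g` transports the measure `m` on `V`, near `q₀`, to the product measure on the
transverse space of two flow-boxes. -/
def IsTransported (m : Measure (f₁.Pullback f₂)) (V : Set (f₁.Pullback f₂))
    (g : f₁.Pullback f₂ → f₁.Pullback f₂) (q₀ : f₁.Pullback f₂) (B₁ : P₁.FlowBox)
    (B₂ : P₂.FlowBox) : Prop :=
  ∃ U ∈ 𝓝[V] q₀, U ⊆ V ∧ MapsTo g U (pairDomain f₁ f₂ B₁ B₂) ∧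
    InjOn (pairCoord B₁ B₂ ∘ g) U ∧ ∀ E ⊆ U, MeasurableSet E →
      boxProduct μ₁ μ₂ B₁ B₂ (pairCoord B₁ B₂ ∘ g '' E) = m E

variable {m : Measure (f₁.Pullback f₂)} {V : Set (f₁.Pullback f₂)}
  {g g' : f₁.Pullback f₂ → f₁.Pullback f₂} {q₀ : f₁.Pullback f₂}

variable {μ₁ μ₂}

/-- Near `g q₀` the two pairs of flow-boxes separate the same points and assign the same measure to
images of sets, so the transport property passes from one to the other after shrinking. -/
theorem IsTransported.change (h : IsTransported μ₁ μ₂ m V g q₀ B₁ B₂) (hq₀ : q₀ ∈ V)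
    (hg : ContinuousOn g V) (hB : g q₀ ∈ pairDomain f₁ f₂ B₁' B₂') :
    IsTransported μ₁ μ₂ m V g q₀ B₁' B₂' := by
  obtain ⟨U, hU, hUV, hm, hi, hE⟩ := h
  obtain ⟨N, hN, hqN, hNB, hNB', hiff, heq⟩ := exists_boxProduct_eq μ₁ μ₂
    (hm (mem_of_mem_nhdsWithin hq₀ hU)) hB
  have hi' : InjOn (pairCoord B₁' B₂' ∘ g) (U ∩ g ⁻¹' N) := fun q hq q' hq' hqq =>
    hi hq.1 hq'.1 ((hiff _ hq.2 _ hq'.2).2 hqq)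
  refine ⟨U ∩ g ⁻¹' N, inter_mem hU ((hg q₀ hq₀).preimage_mem_nhdsWithin (hN.mem_nhds hqN)),
    inter_subset_left.trans hUV, fun q hq => hNB' hq.2, hi', fun E hEU hEm => ?_⟩
  have hEN : g '' E ⊆ N := image_subset_iff.2 fun q hq => (hEU hq).2
  have hgE : ContinuousOn g E := hg.mono (hEU.trans (inter_subset_left.trans hUV))
  have hm₁ : MeasurableSet (pairCoord B₁ B₂ ∘ g '' E) := hEm.image_of_continuousOn_injOn
    (continuousOn_pairCoord.comp hgE fun q hq => hNB (hEU hq).2)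
    (hi.mono (hEU.trans inter_subset_left))
  have hm₂ : MeasurableSet (pairCoord B₁' B₂' ∘ g '' E) := hEm.image_of_continuousOn_injOn
    (continuousOn_pairCoord.comp hgE fun q hq => hNB' (hEU hq).2) (hi'.mono hEU)
  have := heq _ hEN (by rwa [← image_comp]) (by rwa [← image_comp])
  rw [image_comp, ← this, ← image_comp]
  exact hE E (hEU.trans inter_subset_left) hEm

theorem IsTransported.congr (h : IsTransported μ₁ μ₂ m V g q₀ B₁ B₂) {U' : Set (f₁.Pullback f₂)}
    (hU' : U' ∈ 𝓝[V] q₀) (hm' : MapsTo g' U' (pairDomain f₁ f₂ B₁ B₂))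
    (heq : ∀ q ∈ U' ∩ V, pairCoord B₁ B₂ (g' q) = pairCoord B₁ B₂ (g q)) :
    IsTransported μ₁ μ₂ m V g' q₀ B₁ B₂ := by
  obtain ⟨U, hU, hUV, hm, hi, hE⟩ := h
  have e : EqOn (pairCoord B₁ B₂ ∘ g') (pairCoord B₁ B₂ ∘ g) (U ∩ U') :=
    fun q hq => heq q ⟨hq.2, hUV hq.1⟩
  refine ⟨U ∩ U', inter_mem hU hU', inter_subset_left.trans hUV, fun q hq => hm' hq.2,
    (hi.mono inter_subset_left).congr e.symm, fun E hEU hEm => ?_⟩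
  rw [(e.mono hEU).image_eq]
  exact hE E (hEU.trans inter_subset_left) hEm

/-- The start of the transport: at time `0` the map is the identity, and the property is the product
formula on a piece of `T` where the pair of coordinates is injective. -/
theorem IsProductOn.isTransported {P : PreSolenoid k (l₁ + l₂) r s (f₁.Pullback f₂)}
    (h : IsInducedStructure P₁ P₂ P) {T : Set (f₁.Pullback f₂)} (hT : P.IsLocalTransversal T)
    (hm : IsProductOn μ₁ μ₂ T m) (hV : V ⊆ T) (hq₀ : q₀ ∈ V)
    (hB : q₀ ∈ pairDomain f₁ f₂ B₁ B₂) : IsTransported μ₁ μ₂ m V id q₀ B₁ B₂ := by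
  obtain ⟨N, hN, hqN, hNB, hi⟩ := h.exists_injOn hT (hV hq₀) hB
  refine ⟨V ∩ N, inter_mem_nhdsWithin _ (hN.mem_nhds hqN), inter_subset_left,
    fun q hq => hNB hq.2, hi.mono (inter_subset_inter_left _ hV), fun E hE hEm => ?_⟩
  exact (hm B₁ B₂ E (hE.trans (inter_subset_left.trans hV)) hEm
    (hE.trans (inter_subset_right.trans hNB))
      (hi.mono (hE.trans (inter_subset_inter_left _ hV)))).symm

/-- Transport of the product measure along a continuous family of leaf paths. -/
theorem isTransported_of_leafPath {P : PreSolenoid k (l₁ + l₂) r s (f₁.Pullback f₂)}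
    (hpath : ∀ γ, P.IsLeafPath γ →
      P₁.IsLeafPath (fun t => (γ t).1.1) ∧ P₂.IsLeafPath (fun t => (γ t).1.2))
    {H : f₁.Pullback f₂ × I → f₁.Pullback f₂} (hH : ContinuousOn H (V ×ˢ univ))
    (hl : ∀ q ∈ V, P.IsLeafPath fun t => H (q, t)) (hq₀ : q₀ ∈ V)
    (h0 : ∀ (B₁ : P₁.FlowBox) (B₂ : P₂.FlowBox), H (q₀, 0) ∈ pairDomain f₁ f₂ B₁ B₂ →
      IsTransported μ₁ μ₂ m V (fun q => H (q, 0)) q₀ B₁ B₂) :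
    ∀ (B₁ : P₁.FlowBox) (B₂ : P₂.FlowBox), H (q₀, 1) ∈ pairDomain f₁ f₂ B₁ B₂ →
      IsTransported μ₁ μ₂ m V (fun q => H (q, 1)) q₀ B₁ B₂ := by
  have hHt : ∀ t, ContinuousOn (fun q => H (q, t)) V := fun t =>
    hH.comp (by fun_prop) fun q hq => ⟨hq, mem_univ t⟩
  -- The transport property at time `t`, required in all pairs of flow-boxes around the moving
  -- point. It is locally constant in `t`: for a short time the points starting near `q₀` stay in
  -- one pair of flow-boxes, and there their transverse coordinates do not change. Connectedness of
  -- the interval carries it from `0` to `1`.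
  let C : I → Prop := fun t => ∀ (B₁ : P₁.FlowBox) (B₂ : P₂.FlowBox),
    H (q₀, t) ∈ pairDomain f₁ f₂ B₁ B₂ → IsTransported μ₁ μ₂ m V (fun q => H (q, t)) q₀ B₁ B₂
  have hC : IsLocallyConstant C := by
    rw [IsLocallyConstant.iff_eventually_eq]
    intro t
    obtain ⟨B₁, B₂, hB⟩ := exists_mem_pairDomain P₁ P₂ (H (q₀, t))
    have h1 := (hH (q₀, t) ⟨hq₀, mem_univ t⟩).preimage_mem_nhdsWithin
      (isOpen_pairDomain.mem_nhds hB)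
    rw [nhdsWithin_prod_eq, nhdsWithin_univ] at h1
    obtain ⟨U, hU, J, hJ, hUJ⟩ := mem_prod_iff.1 h1
    obtain ⟨J', hJ', hJc, hJJ⟩ := exists_isPreconnected_subset hJ
    filter_upwards [hJ'] with s hs
    have he : ∀ q ∈ U ∩ V, pairCoord B₁ B₂ (H (q, s)) = pairCoord B₁ B₂ (H (q, t)) := by
      intro q hq
      obtain ⟨p₁, p₂⟩ := hpath _ (hl q hq.2)
      exact Prod.ext
        (p₁.snd_eq_of_isPreconnected B₁.isFlowChart hJc (fun t' ht' => (hUJ ⟨hq.1, hJJ ht'⟩).1) hs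
          (mem_of_mem_nhds hJ'))
        (p₂.snd_eq_of_isPreconnected B₂.isFlowChart hJc (fun t' ht' => (hUJ ⟨hq.1, hJJ ht'⟩).2) hs
          (mem_of_mem_nhds hJ'))
    have hst : ∀ t' ∈ J, MapsTo (fun q => H (q, t')) U (pairDomain f₁ f₂ B₁ B₂) :=
      fun t' ht' q hq => hUJ ⟨hq, ht'⟩
    have hsJ := hJJ hs
    have htJ := mem_of_mem_nhds hJ
    have hq₀U := mem_of_mem_nhdsWithin hq₀ hU
    refine propext ⟨fun h B₁' B₂' hB' => ?_, fun h B₁' B₂' hB' => ?_⟩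
    · exact ((h B₁ B₂ (hst s hsJ hq₀U)).congr hU (hst t htJ) fun q hq => (he q hq).symm).change hq₀
        (hHt t) hB'
    · exact ((h B₁ B₂ hB).congr hU (hst s hsJ) he).change hq₀ (hHt s) hB'
  exact (hC.apply_eq_of_preconnectedSpace 0 1).mp h0

/-- Locally both measures equal the product measure of the transverse coordinates of `h '' E`: for
`m'` this is its product formula, for `m` it is the transport along the holonomy paths. Equality on
small pieces then globalizes. -/
theorem measure_image_eq_of_isHolonomyMap {P : PreSolenoid k (l₁ + l₂) r s (f₁.Pullback f₂)}
    (hP : IsInducedStructure P₁ P₂ P) (hpath : ∀ γ, P.IsLeafPath γ →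
      P₁.IsLeafPath (fun t => (γ t).1.1) ∧ P₂.IsLeafPath (fun t => (γ t).1.2))
    {T T' : Set (f₁.Pullback f₂)} (hT : P.IsLocalTransversal T)
    {m' : Measure (f₁.Pullback f₂)} (hm : IsProductOn μ₁ μ₂ T m) (hm' : IsProductOn μ₁ μ₂ T' m')
    {h : f₁.Pullback f₂ → f₁.Pullback f₂} (hh : P.IsHolonomyMap T T' V h)
    {A : Set (f₁.Pullback f₂)} (hA : A ⊆ V) (hAm : MeasurableSet A) : m' (h '' A) = m A := by
  obtain ⟨⟨O, hO, hVO⟩, hi, hmaps, H, hH, hHq⟩ := hh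
  have hVT : V ⊆ T := hVO ▸ inter_subset_left
  have h1 : EqOn h (fun q => H (q, 1)) V := fun q hq => (hHq q hq).2.2.symm
  have hc : ContinuousOn h V := (hH.comp (f := fun q => (q, (1 : I))) (by fun_prop)
    fun q hq => ⟨hq, mem_univ _⟩).congr h1
  have := measure_image_eq_of_locally (ν := m') (ν' := m) (g := h) (g' := id) hAm (hc.mono hA)
    (hi.mono hA) continuousOn_id (injOn_id A) fun q₀ hq₀ => by
      obtain ⟨B₁, B₂, hB⟩ := exists_mem_pairDomain P₁ P₂ (H (q₀, 1))
      obtain ⟨U, hU, hUV, hUB, hUi, hUE⟩ := isTransported_of_leafPath hpath hH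
        (fun q hq => (hHq q hq).1) (hA hq₀) (fun B₁ B₂ hB => by
          rw [(hHq _ (hA hq₀)).2.1] at hB
          obtain ⟨N, hN, hqN, hNB, -⟩ := hP.exists_injOn hT (hVT (hA hq₀)) hB
          refine (hm.isTransported hP hT hVT (hA hq₀) hB).congr (U' := V ∩ N)
            (inter_mem_nhdsWithin _ (hN.mem_nhds hqN)) (fun q hq => ?_) fun q hq => ?_
          · simp only [(hHq q hq.1).2.1]
            exact hNB hq.2
          · rw [(hHq q hq.2).2.1]
            rfl) B₁ B₂ hB
      rw [mem_nhdsWithin_iff_exists_mem_nhds_inter] at hU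
      obtain ⟨O', hO', hOU⟩ := hU
      refine ⟨O', hO', fun E hE hEm => ?_⟩
      have hEU : E ⊆ U := fun q hq => hOU ⟨(hE hq).2, hA (hE hq).1⟩
      have hEV := hEU.trans hUV
      have hhE : MeasurableSet (h '' E) :=
        hEm.image_of_continuousOn_injOn (hc.mono hEV) (hi.mono hEV)
      rw [image_id, ← hUE E hEU hEm, hm' B₁ B₂ (h '' E)
        ((image_mono hEV).trans hmaps.image_subset) hhE, image_comp, (h1.mono hEV).image_eq]
      · rw [(h1.mono hEV).image_eq]
        exact image_subset_iff.2 fun q hq => hUB (hEU hq)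
      · rw [(h1.mono hEV).image_eq]
        exact (hUi.mono hEU).image_of_comp
  rwa [image_id] at this

end Invariance

/-! ### The product measure -/

section ProductMeasure

variable {k k₁ k₂ l l₁ l₂ : ℕ} {r s : WithTop ℕ∞} {M : Type w} [TopologicalSpace M] [T2Space M]
  {S₁ : Type u} [TopologicalSpace S₁]
  [MeasurableSpace S₁] [BorelSpace S₁] [PolishSpace S₁] {S₂ : Type v} [TopologicalSpace S₂]
  [MeasurableSpace S₂] [BorelSpace S₂] [PolishSpace S₂] {f₁ : S₁ → M} {f₂ : S₂ → M}
  {P₁ : PreSolenoid k₁ l₁ r s S₁} {P₂ : PreSolenoid k₂ l₂ r s S₂}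
  {P : PreSolenoid k (l₁ + l₂) r s (f₁.Pullback f₂)}
  {μ₁ : P₁.TransversalMeasure} {μ₂ : P₂.TransversalMeasure}
  {B₁ B₁' : P₁.FlowBox} {B₂ B₂' : P₂.FlowBox} [PolishSpace (f₁.Pullback f₂)]
  {m : Measure (f₁.Pullback f₂)} {T : Set (f₁.Pullback f₂)}

theorem measurableSet_of_isLocalTransversal (hT : P.IsLocalTransversal T) : MeasurableSet T := by
  obtain ⟨-, B, rfl⟩ := hT
  exact B.measurableSet_transversal

theorem IsProductOn.locallyFinite (h : IsInducedStructure P₁ P₂ P) (hT : P.IsLocalTransversal T)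
    (hm : IsProductOn μ₁ μ₂ T m) (h0 : m Tᶜ = 0) {p : f₁.Pullback f₂} (hp : p ∈ T) :
    ∃ V ∈ 𝓝 p, m V < ⊤ := by
  obtain ⟨B₁, B₂, hB⟩ := exists_mem_pairDomain P₁ P₂ p
  obtain ⟨N, hN, hpN, hNB, hi⟩ := h.exists_injOn hT hp hB
  obtain ⟨U₁, hU₁, hpU₁, h₁⟩ := μ₁.exists_boxMeasure_lt_top hB.1
  obtain ⟨U₂, hU₂, hpU₂, h₂⟩ := μ₂.exists_boxMeasure_lt_top hB.2
  have hV : IsOpen (N ∩ pairCoord B₁ B₂ ⁻¹' (U₁ ×ˢ U₂)) :=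
    (continuousOn_pairCoord.mono hNB).isOpen_inter_preimage hN (hU₁.prod hU₂)
  refine ⟨_, hV.mem_nhds ⟨hpN, hpU₁, hpU₂⟩, ?_⟩
  rw [← measure_inter_conull h0, inter_comm, hm B₁ B₂ _ inter_subset_left
    ((measurableSet_of_isLocalTransversal hT).inter hV.measurableSet)
    (fun q hq => hNB hq.2.1) (hi.mono (inter_subset_inter_right _ inter_subset_left))]
  calc _ ≤ boxProduct μ₁ μ₂ B₁ B₂ (U₁ ×ˢ U₂) :=
        measure_mono (image_subset_iff.2 fun q hq => hq.2.2)
    _ = _ := boxProduct_prod μ₁ μ₂ (FlowBox.transversal_nonempty (B := B₂) ⟨_, hB.2⟩) U₁ U₂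
    _ < ⊤ := ENNReal.mul_lt_top h₁ h₂

theorem isProductMeasure_of_isProductOn {μ : P.TransversalMeasure}
    (hμ : ∀ T, P.IsLocalTransversal T → IsProductOn μ₁ μ₂ T (μ.measure T)) :
    IsProductMeasure μ₁ μ₂ μ := by
  intro B₁ B₂ T A hT hAT hA hAB hi
  obtain rfl | ⟨p, hp⟩ := A.eq_empty_or_nonempty
  · simp
  have : Nonempty S₁ := ⟨p.1.1⟩
  have : Nonempty S₂ := ⟨p.1.2⟩
  rw [hμ T hT B₁ B₂ A hAT hA hAB hi, boxProduct_apply μ₁ μ₂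
    (FlowBox.isSub_self (FlowBox.transversal_nonempty ⟨_, (hAB p hp).1⟩))
    (FlowBox.isSub_self (FlowBox.transversal_nonempty ⟨_, (hAB p hp).2⟩))
    (hA.image_of_continuousOn_injOn (continuousOn_pairCoord.mono hAB) hi)]
  · simp only [pairCoord, mem_image, Prod.mk.injEq]
  · rintro _ ⟨q, hq, rfl⟩
    exact ⟨⟨_, FlowBox.proj_mem (hAB q hq).1, FlowBox.transCoord_proj (hAB q hq).1⟩,
      ⟨_, FlowBox.proj_mem (hAB q hq).2, FlowBox.transCoord_proj (hAB q hq).2⟩⟩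

theorem PreSolenoid.TransversalMeasure.measure_self_ne_zero {k l : ℕ} {S : Type u}
    [TopologicalSpace S] [MeasurableSpace S] {P : PreSolenoid k l r s S} (μ : P.TransversalMeasure)
    {T : Set S} (hT : P.IsLocalTransversal T) (h : μ.measure T ≠ 0) : μ.measure T T ≠ 0 :=
  fun h0 => h (by rw [← Measure.measure_univ_eq_zero, ← μ.measure_inter hT, univ_inter, h0])

/-- In the support, the transverse space of a flow-box has positive measure near a point. -/
theorem PreSolenoid.TransversalMeasure.exists_boxMeasure_pos {k l : ℕ} {S : Type u}
    [TopologicalSpace S] [MeasurableSpace S] [BorelSpace S] [PolishSpace S]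
    {P : PreSolenoid k l r s S} {μ : P.TransversalMeasure} {p : S} (hp : p ∈ μ.support)
    {B : P.FlowBox} (hB : p ∈ B.domain) {V : Set (Eu l)} (hV : V ∈ 𝓝 (B.transCoord p)) :
    ∃ E ⊆ V ∩ B.K, μ.boxMeasure B E ≠ 0 := by
  have hN : B.domain ∩ B.transCoord ⁻¹' V ∈ 𝓝 p := inter_mem (B.domain_mem_nhds hB)
    ((B.continuousOn_transCoord.continuousAt (B.domain_mem_nhds hB)).preimage_mem_nhds hV)
  obtain ⟨B', hpB', hB'N, hB', -⟩ := FlowBox.exists_refines B B hB hB hN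
  refine ⟨B.transCoord '' B'.transversal, ?_, ?_⟩
  · rintro _ ⟨q, hq, rfl⟩
    exact ⟨(hB'N hq.1).2, (FlowBox.coord_mem (hB'N hq.1).1).2⟩
  · have hT := FlowBox.isLocalTransversal ⟨p, hpB'⟩
    rw [μ.boxMeasure_image (hB'.isSub ⟨p, hpB'⟩) subset_rfl B'.measurableSet_transversal]
    exact μ.measure_self_ne_zero hT (hp _ hT hpB')

/-- If `μ_T` is non-zero, some point of `T` has only neighbourhoods of positive measure; every
product of box measures around it is then non-zero, and so are both factors. Conversely, around a
point of both supports there are sets of positive measure arbitrarily near in the two transverse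
spaces, and a strongly induced flow-box contains the points over their product. -/
theorem isNontrivial_iff (h : IsStronglyInduced P₁ P₂ P) {μ : P.TransversalMeasure}
    (hμ : ∀ T, P.IsLocalTransversal T → IsProductOn μ₁ μ₂ T (μ.measure T)) :
    μ.IsNontrivial ↔ ∃ p : f₁.Pullback f₂, p.1.1 ∈ μ₁.support ∧ p.1.2 ∈ μ₂.support := by
  constructor
  · rintro ⟨T, hT, hT0⟩
    obtain ⟨p, hp, hpos⟩ :=
      exists_mem_forall_mem_nhdsWithin_pos_measure (μ.measure_self_ne_zero hT hT0)
    have key : ∀ B₁ B₂, p ∈ pairDomain f₁ f₂ B₁ B₂ → boxProduct μ₁ μ₂ B₁ B₂ ≠ 0 := by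
      intro B₁ B₂ hB h0
      obtain ⟨N, hN, hpN, hNB, hi⟩ := h.isInducedStructure.exists_injOn hT hp hB
      refine (hpos _ (inter_mem_nhdsWithin T (hN.mem_nhds hpN))).ne' ?_
      rw [hμ T hT B₁ B₂ _ inter_subset_left
        ((measurableSet_of_isLocalTransversal hT).inter hN.measurableSet)
        (fun q hq => hNB hq.2) hi, h0]
      rfl
    refine ⟨p, ?_, ?_⟩
    · rintro _ ⟨hT₁, B₁, rfl⟩ hp₁ h0
      obtain ⟨B₂, hp₂, -⟩ := P₂.exists_flowBox_mem p.1.2 univ_mem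
      refine key B₁ B₂ ⟨hp₁.1, hp₂.1⟩ ?_
      rw [boxProduct, TransversalMeasure.boxMeasure, h0, Measure.map_zero, Measure.zero_prod]
    · rintro _ ⟨hT₂, B₂, rfl⟩ hp₂ h0
      obtain ⟨B₁, hp₁, -⟩ := P₁.exists_flowBox_mem p.1.1 univ_mem
      refine key B₁ B₂ ⟨hp₁.1, hp₂.1⟩ ?_
      have : μ₂.boxMeasure B₂ = 0 := by rw [TransversalMeasure.boxMeasure, h0, Measure.map_zero]
      rw [boxProduct, this, Measure.prod_zero]
  · rintro ⟨p, hp₁, hp₂⟩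
    obtain ⟨B₁, B₂, hB⟩ := exists_mem_pairDomain P₁ P₂ p
    obtain ⟨B, hpB, hBq, V₁, hV₁, V₂, hV₂, hK⟩ := h p B₁ B₂ hB.1 hB.2
    obtain ⟨E₁, hE₁, h₁⟩ := TransversalMeasure.exists_boxMeasure_pos hp₁ hB.1 hV₁
    obtain ⟨E₂, hE₂, h₂⟩ := TransversalMeasure.exists_boxMeasure_pos hp₂ hB.2 hV₂
    have hT := FlowBox.isLocalTransversal ⟨p, hpB⟩
    refine ⟨_, hT, fun h0 => mul_ne_zero h₁ h₂ ?_⟩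
    have hi : InjOn (pairCoord B₁ B₂) B.transversal := by
      intro q hq q' hq' hqq
      obtain ⟨e₁, e₂⟩ : B₁.transCoord q.1.1 = B₁.transCoord q'.1.1 ∧
        B₂.transCoord q.1.2 = B₂.transCoord q'.1.2 := Prod.ext_iff.1 hqq
      refine FlowBox.eq_of_mem_transversal hq hq' ?_
      rw [(hBq q hq.1).2.2, (hBq q' hq'.1).2.2, e₁, e₂]
    rw [← boxProduct_prod μ₁ μ₂ (FlowBox.transversal_nonempty ⟨_, hB.2⟩)]
    -- Every `(y, z)` of the rectangle is an admissible transverse value of `B`, hence the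
    -- coordinate of a point of its transversal; a null transversal would make the rectangle null.
    refine measure_mono_null (t := pairCoord B₁ B₂ '' B.transversal) ?_ ?_
    · rintro ⟨y, z⟩ ⟨hy, hz⟩
      obtain ⟨q, hq, hq0, hqt⟩ := FlowBox.exists_coord_eq (Metric.mem_ball_self one_pos)
        (hK y (hE₁ hy).1 (hE₁ hy).2 z (hE₂ hz).1 (hE₂ hz).2)
      refine ⟨q, ⟨hq, hq0⟩, ?_⟩
      rw [(hBq q hq).2.2] at hqt
      have h3 := congr_arg (appendEquiv l₁ l₂).symm hqt
      rwa [appendEquiv_symm_appendCoord, appendEquiv_symm_appendCoord] at h3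
    · rw [← hμ _ hT B₁ B₂ _ subset_rfl B.measurableSet_transversal
        (fun q hq => ⟨(hBq q hq.1).1, (hBq q hq.1).2.1⟩) hi, h0]
      rfl

theorem exists_isProductMeasure (h : IsStronglyInduced P₁ P₂ P) (hpath : ∀ γ, P.IsLeafPath γ →
      P₁.IsLeafPath (fun t => (γ t).1.1) ∧ P₂.IsLeafPath (fun t => (γ t).1.2))
    (μ₁ : P₁.TransversalMeasure) (μ₂ : P₂.TransversalMeasure) :
    ∃ μ : P.TransversalMeasure, IsProductMeasure μ₁ μ₂ μ ∧ (μ.IsNontrivial ↔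
      ∃ p : f₁.Pullback f₂, p.1.1 ∈ μ₁.support ∧ p.1.2 ∈ μ₂.support) := by
  have hi := h.isInducedStructure
  choose! m hm₀ hm using fun T (hT : P.IsLocalTransversal T) => exists_isProductOn μ₁ μ₂ hi hT
  let μ : P.TransversalMeasure := ⟨m, hm₀,
    fun T hT p hp => (hm T hT).locallyFinite hi hT (hm₀ T hT) hp,
    fun T T' V h hT hT' hh A hA hAm =>
      measure_image_eq_of_isHolonomyMap hi hpath hT (hm T hT) (hm T' hT') hh hA hAm⟩
  exact ⟨μ, isProductMeasure_of_isProductOn hm, isNontrivial_iff h hm⟩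

end ProductMeasure

/-! ### Dimension counts and the main theorem -/

section Dimension

variable {n k₁ k₂ l₁ l₂ : ℕ} {r s : WithTop ℕ∞} {M : Type w} [TopologicalSpace M]
  [ChartedSpace (Eu n) M] {S₁ : Type u} [TopologicalSpace S₁] {S₂ : Type v} [TopologicalSpace S₂]
  {P₁ : PreSolenoid k₁ l₁ r s S₁} {P₂ : PreSolenoid k₂ l₂ r s S₂} {f₁ : S₁ → M} {f₂ : S₂ → M}

theorem PreSolenoid.IsImmersion.le_dim (h : P₁.IsImmersion n f₁) (p : S₁) : k₁ ≤ n := by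
  obtain ⟨φ, hφ, hp⟩ := P₁.foliation.cover (P₁.ι p)
  have := LinearMap.finrank_le_finrank_of_injective
    (f := (P₁.leafDiff n f₁ φ p).toLinearMap) (h.2 p φ hφ hp)
  simpa using this

theorem IntersectTransversally.dim_le (h : IntersectTransversally n P₁ P₂ f₁ f₂)
    (p : f₁.Pullback f₂) : n ≤ k₁ + k₂ := by
  obtain ⟨φ₁, hφ₁, hp₁⟩ := P₁.foliation.cover (P₁.ι p.1.1)
  obtain ⟨φ₂, hφ₂, hp₂⟩ := P₂.foliation.cover (P₂.ι p.1.2)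
  have h1 := h p.1.1 p.1.2 p.2 φ₁ hφ₁ hp₁ φ₂ hφ₂ hp₂
  have h2 := Submodule.finrank_add_le_finrank_add_finrank
    (P₁.leafDiff n f₁ φ₁ p.1.1).range (P₂.leafDiff n f₂ φ₂ p.1.2).range
  rw [h1, finrank_top, finrank_euclideanSpace_fin] at h2
  have h3 := LinearMap.finrank_range_le (P₁.leafDiff n f₁ φ₁ p.1.1).toLinearMap
  have h4 := LinearMap.finrank_range_le (P₂.leafDiff n f₂ φ₂ p.1.2).toLinearMap
  rw [finrank_euclideanSpace_fin] at h3 h4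
  exact h2.trans (add_le_add h3 h4)

end Dimension

end

theorem mainTheorem10 {n k₁ k₂ l₁ l₂ : ℕ} {r s : WithTop ℕ∞} (hr : 1 ≤ r) (hs : s ≤ r)
    {M : Type w} [TopologicalSpace M] [T2Space M] [SecondCountableTopology M]
    [ChartedSpace (Eu n) M] [IsManifold (𝓡 n) ∞ M] [IsManifold (𝓡 n) r M]
    {S₁ : Type u} [TopologicalSpace S₁] [MeasurableSpace S₁] [BorelSpace S₁]
    {S₂ : Type v} [TopologicalSpace S₂] [MeasurableSpace S₂] [BorelSpace S₂]
    (P₁ : PreSolenoid k₁ l₁ r s S₁) (P₂ : PreSolenoid k₂ l₂ r s S₂)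
    (f₁ : S₁ → M) (f₂ : S₂ → M) (hf₁ : P₁.IsImmersion n f₁) (hf₂ : P₂.IsImmersion n f₂)
    (htr : IntersectTransversally n P₁ P₂ f₁ f₂) (hne : Nonempty (f₁.Pullback f₂)) :
    ∃ (k : ℕ) (hk : k + n = k₁ + k₂) (P : PreSolenoid k (l₁ + l₂) r s (f₁.Pullback f₂)),
      P.IsImmersion n (commonMap f₁ f₂) ∧
      IsInducedStructure P₁ P₂ P ∧
      (∀ (oM : ManifoldOrientation n M) (o₁ : P₁.LeafOrientation) (o₂ : P₂.LeafOrientation),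
        ∃ o : P.LeafOrientation, IsInducedOrientation hk P₁ P₂ P oM o₁ o₂ o) ∧
      (∀ (μ₁ : P₁.TransversalMeasure) (μ₂ : P₂.TransversalMeasure),
        ∃ μ : P.TransversalMeasure, IsProductMeasure μ₁ μ₂ μ ∧
          (μ.IsNontrivial ↔
            ∃ p : f₁.Pullback f₂, p.1.1 ∈ μ₁.support ∧ p.1.2 ∈ μ₂.support)) := by
  obtain ⟨p⟩ := hne
  -- Transversality at one point of the non-empty fibre product gives `n ≤ k₁ + k₂`, so the
  -- truncated subtraction is the true one. The immersions give `k₁ ≤ n` and `k₂ ≤ n`, hence `k ≤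
  -- k₁` and `k ≤ k₂`, as the frames of the orientation require.
  have hk : k₁ + k₂ - n + n = k₁ + k₂ := Nat.sub_add_cancel (htr.dim_le p)
  have h₁ := hf₁.le_dim p.1.1
  have h₂ := hf₂.le_dim p.1.2
  obtain ⟨E₁⟩ := hf₁.exists_extension
  obtain ⟨E₂⟩ := hf₂.exists_extension
  have hind := fibreSolenoid_isStronglyInduced E₁ E₂ hr hk htr
  have := P₁.polishSpace
  have := P₂.polishSpace
  have := (fibreSolenoid E₁ E₂ hr hk htr).polishSpace
  exact ⟨_, hk, fibreSolenoid E₁ E₂ hr hk htr,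
    fibreSolenoid_isImmersion E₁ E₂ hr hk htr hf₁ hf₂, hind.isInducedStructure,
    fun oM o₁ o₂ => exists_inducedOrientation E₁ E₂ hk oM o₁ o₂ hr htr hf₁ hf₂
      (by omega) (by omega),
    fun μ₁ μ₂ => exists_isProductMeasure hind
      (fun _ hγ => isLeafPath_fibre hr hk E₁.isClassCrsMap E₂.isClassCrsMap hγ) μ₁ μ₂⟩
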